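/- Let $n\ge 1$, $\mathbb F=\mathbb Q(q,t)$, $\mathbb K=\mathbb Q(q,t,a)$ with $q,t,a$ indeterminates, and let $\iota$ be the field automorphism of $\mathbb K$ inverting $q$, $t$ and $a$, extended coefficientwise to $\mathbb K(x)=\mathbb K(x_1,\dots,x_n)$. For $v\in\mathbb Z^n$ let $\overline v\in\mathbb F^n$ be the point with $\overline v_i=q^{v_i}t^{-k_i(v)}$, where $k_i(v)=\#\{k<i: v_k\ge v_i\}+\#\{k>i: v_k>v_i\}$. For $\alpha\in\mathbb Z_{\ge0}^n$ with $|\alpha|=\alpha_1+\dots+\alpha_n$ let $G_\alpha\in\mathbb F[x]$ be the non-symmetric interpolation Macdonald polynomial, i.e. the unique polynomial of degree at most $|\alpha|$ whose coefficient of $x^\alpha$ is $1$ and with $G_\alpha(\overline\beta)=0$ for all $\beta\in\mathbb Z_{\ge0}^n$ with $|\beta|\le|\alpha|$, $\beta\ne\alpha$. Put $\tau=(1,t^{-1},\dots,t^{1-n})$ and $K_\alpha(x)=G_\alpha(x)/G_\alpha(a\tau)$. For $v\in\mathbb Z^n$ define $K_v\in\mathbb K(x)$ by $$K_v(x)=\Bigl(\prod_{i=1}^n\frac{(q^{1-m}a\overline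 v_i^{-1};q)_m}{(qt^{n-1}x_i;q)_m}\Bigr)K_{v+(m^n)}(q^mx),\qquad (y;q)_m=\prod_{j=0}^{m-1}(1-q^jy),$$ where $v+(m^n)=(v_1+m,\dots,v_n+m)$ and $m\ge0$ is the least integer such that $v+(m^n)\in\mathbb Z_{\ge0}^n$ (any other such $m$ gives the same function), and let $K_v^\circ=\iota(K_v)$. Let the symmetric group $S_n$ act on $\mathbb K(x)$ by permuting the variables, let $s_i$ be the transposition $(i,i+1)$, let $w_0$ be the longest element, $i\mapsto n+1-i$, of length $\ell(w_0)=n(n-1)/2$, and let $$H_i^\circ=t^{-1}+\frac{x_i-t^{-1}x_{i+1}}{x_i-x_{i+1}}(s_i-1)\quad(1\le i<n),\qquad H_{w_0}^\circ=H_{i_1}^\circ\cdots H_{i_\ell}^\circ$$ for a reduced expression $w_0=s_{i_1}\cdots s_{i_\ell}$ (the operator does not depend on it). Define $K_v'\in\mathbb K(x)$ for $v\in\mathbb Z^n$ by $$K_v'(x)=t^{\ell(w_0)}\,w_0H_{w_0}^\circ K_v^\circ(t^{n-1}x).$$ Then for all $u,v\in\mathbb Z^n$ the rational function $K_v'$ is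 regular at the point $a^{-1}\overline u$, $K_u'$ is regular at $a^{-1}\overline v$, and $$K_v'(a^{-1}\overline u)=K_u'(a^{-1}\overline v).$$ -/

import Mathlib

noncomputable section

namespace InterpMacdonald

/-! ### The coefficient fields `𝔽 = ℚ(q,t)` and `𝕂 = ℚ(q,t,a)`, and the automorphism `ι` -/

/-- Semilinear inversion of the variable: the ring endomorphism `f(X) ↦ f^σ(X⁻¹)` of `k[X]` into
`k(X)`, where `σ` is applied to the coefficients. -/
def invPoly {k : Type*} [Field k] (σ : k →+* k) : Polynomial k →+* RatFunc k :=
  Polynomial.eval₂RingHom ((algebraMap k (RatFunc k)).comp σ) (RatFunc.X)⁻¹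

theorem invPoly_injective {k : Type*} [Field k] (σ : k →+* k) :
    Function.Injective (invPoly σ) := by
  have hX : Transcendental k ((RatFunc.X : RatFunc k)⁻¹) := by
    intro h
    have h1 : IsAlgebraic k (RatFunc.X : RatFunc k) := by simpa using h.inv
    exact RatFunc.transcendental_X h1
  have h2 := transcendental_iff_injective.1 hX
  have h3 : ∀ p, invPoly σ p = Polynomial.aeval ((RatFunc.X : RatFunc k)⁻¹) (p.map σ) := by
    intro p
    simp [invPoly, Polynomial.aeval_def, Polynomial.eval₂_map]
  intro p p' hp
  rw [h3, h3] at hp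
  exact Polynomial.map_injective σ σ.injective (h2 hp)

/-- The endomorphism of the field `k(X)` that acts by `σ` on `k` and sends `X` to `X⁻¹`. -/
def invExt {k : Type*} [Field k] (σ : k →+* k) : RatFunc k →+* RatFunc k :=
  RatFunc.liftRingHom (invPoly σ)
    (nonZeroDivisors_le_comap_nonZeroDivisors_of_injective _ (invPoly_injective σ))

theorem invExt_algebraMap {k : Type*} [Field k] (σ : k →+* k) (c : k) :
    invExt σ (algebraMap k (RatFunc k) c) = algebraMap k (RatFunc k) (σ c) := by
  rw [IsScalarTower.algebraMap_apply k (Polynomial k) (RatFunc k)]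
  simp [invExt, invPoly]

theorem invExt_X {k : Type*} [Field k] (σ : k →+* k) :
    invExt σ (RatFunc.X : RatFunc k) = (RatFunc.X)⁻¹ := by
  rw [← RatFunc.algebraMap_X]
  simp [invExt, invPoly]

theorem invExt_invExt {k : Type*} [Field k] {σ : k →+* k} (hσ : ∀ c, σ (σ c) = c)
    (f : RatFunc k) : invExt σ (invExt σ f) = f := by
  have h : ∀ p : Polynomial k, invExt σ (invExt σ (algebraMap _ (RatFunc k) p)) =
      algebraMap _ (RatFunc k) p := by
    intro p
    induction p using Polynomial.induction_on' with
    | add p p' hp hp' => simp only [map_add, hp, hp']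
    | monomial m c =>
      rw [← Polynomial.C_mul_X_pow_eq_monomial]
      simp only [map_mul, map_pow, RatFunc.algebraMap_X, RatFunc.algebraMap_C, invExt_X,
        map_inv₀, inv_inv]
      rw [← RatFunc.algebraMap_eq_C, invExt_algebraMap, invExt_algebraMap, hσ]
  induction f using RatFunc.induction_on with
  | f p d hd => rw [map_div₀, map_div₀, h, h]

/-- `𝔽 = ℚ(q,t)`, as `ℚ(q)(t)`. -/
abbrev FF : Type := RatFunc (RatFunc ℚ)

/-- `𝕂 = ℚ(q,t,a)`, as `𝔽(a)`. -/
abbrev KK : Type := RatFunc FF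

def qF : FF := algebraMap (RatFunc ℚ) FF RatFunc.X
def tF : FF := RatFunc.X

theorem qF_ne_zero : qF ≠ 0 :=
  (map_ne_zero_iff _ (algebraMap (RatFunc ℚ) FF).injective).2 RatFunc.X_ne_zero

theorem tF_ne_zero : tF ≠ 0 := RatFunc.X_ne_zero

/-- The indeterminates `q`, `t`, `a` as units of `𝕂`. -/
def q : KKˣ := Units.mk0 (algebraMap FF KK qF)
  ((map_ne_zero_iff _ (algebraMap FF KK).injective).2 qF_ne_zero)
def t : KKˣ := Units.mk0 (algebraMap FF KK tF)
  ((map_ne_zero_iff _ (algebraMap FF KK).injective).2 tF_ne_zero)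
def a : KKˣ := Units.mk0 (RatFunc.X : KK) RatFunc.X_ne_zero

/-- The automorphism `ι` of `𝕂` inverting `q`, `t` and `a`. -/
def iota : KK →+* KK := invExt (invExt (invExt (RingHom.id ℚ)))

theorem iota_q : iota (q : KK) = (q : KK)⁻¹ := by
  simp only [iota, q, qF, Units.val_mk0, invExt_algebraMap, invExt_X, map_inv₀]

theorem iota_t : iota (t : KK) = (t : KK)⁻¹ := by
  simp only [iota, t, tF, Units.val_mk0, invExt_algebraMap, invExt_X, map_inv₀]

theorem iota_a : iota (a : KK) = (a : KK)⁻¹ := by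
  simp only [iota, a, Units.val_mk0, invExt_X]

theorem iota_iota (c : KK) : iota (iota c) = c :=
  invExt_invExt (invExt_invExt (invExt_invExt fun _ => rfl)) c

/-! ### Rational functions in `x₁, …, xₙ`, substitutions and values -/

/-- The field `k(x) = k(x₁,…,xₙ)`. -/
abbrev RatField (k : Type*) [Field k] (n : ℕ) : Type _ := FractionRing (MvPolynomial (Fin n) k)

section Rational

variable {k : Type*} [Field k] {n : ℕ}

/-- The variable `xᵢ` of `k(x)`. -/
def var (i : Fin n) : RatField k n :=
  algebraMap (MvPolynomial (Fin n) k) (RatField k n) (MvPolynomial.X i)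

/-- A permutation `w` of the indices acting on `k(x)` by the `k`-automorphism `xᵢ ↦ x_{w i}`. -/
def permAct (w : Equiv.Perm (Fin n)) : RatField k n →+* RatField k n :=
  IsFractionRing.map (A := MvPolynomial (Fin n) k)
    (j := (MvPolynomial.rename w : MvPolynomial (Fin n) k →ₐ[k] MvPolynomial (Fin n) k).toRingHom)
    (MvPolynomial.rename_injective w w.injective)

theorem permAct_var (w : Equiv.Perm (Fin n)) (i : Fin n) :
    permAct w (var i : RatField k n) = var (w i) := by
  simp [permAct, var, IsFractionRing.map]

theorem permAct_const (w : Equiv.Perm (Fin n)) (c : k) :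
    permAct w (algebraMap k (RatField k n) c) = algebraMap k (RatField k n) c := by
  rw [IsScalarTower.algebraMap_apply k (MvPolynomial (Fin n) k) (RatField k n)]
  simp [permAct, IsFractionRing.map, MvPolynomial.algebraMap_eq]

/-- `p(x) ↦ p(c x)` on polynomials. -/
def scalePoly (c : kˣ) : MvPolynomial (Fin n) k →ₐ[k] MvPolynomial (Fin n) k :=
  MvPolynomial.aeval fun i => MvPolynomial.C (c : k) * MvPolynomial.X i

theorem scalePoly_injective (c : kˣ) :
    Function.Injective (scalePoly c : MvPolynomial (Fin n) k →ₐ[k] MvPolynomial (Fin n) k) := by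
  have h : ((scalePoly c⁻¹).comp (scalePoly c) :
      MvPolynomial (Fin n) k →ₐ[k] MvPolynomial (Fin n) k) = AlgHom.id k _ := by
    ext1 i
    simp only [scalePoly, AlgHom.comp_apply, MvPolynomial.aeval_X, map_mul, AlgHom.id_apply,
      MvPolynomial.algHom_C, MvPolynomial.algebraMap_eq]
    rw [← mul_assoc, ← MvPolynomial.C_mul]
    simp
  intro p p' hp
  have := congrArg (scalePoly c⁻¹) hp
  rw [← AlgHom.comp_apply, ← AlgHom.comp_apply, h] at this
  simpa using this

/-- `f(x) ↦ f(c x) = f(c x₁, …, c xₙ)` on rational functions, for `c ≠ 0`. -/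
def scale (c : kˣ) : RatField k n →+* RatField k n :=
  IsFractionRing.map (A := MvPolynomial (Fin n) k)
    (j := (scalePoly c : MvPolynomial (Fin n) k →ₐ[k] MvPolynomial (Fin n) k).toRingHom)
    (scalePoly_injective c)

theorem scale_var (c : kˣ) (i : Fin n) :
    scale c (var i : RatField k n) = algebraMap k (RatField k n) c * var i := by
  rw [IsScalarTower.algebraMap_apply k (MvPolynomial (Fin n) k) (RatField k n)]
  simp [scale, var, IsFractionRing.map, scalePoly, MvPolynomial.algebraMap_eq]

/-- A field endomorphism `σ` of `k` acting on the coefficients of a rational function. -/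
def coeffAct (σ : k →+* k) : RatField k n →+* RatField k n :=
  IsFractionRing.map (A := MvPolynomial (Fin n) k) (j := MvPolynomial.map σ)
    (MvPolynomial.map_injective σ σ.injective)

theorem coeffAct_var (σ : k →+* k) (i : Fin n) :
    coeffAct σ (var i : RatField k n) = var i := by
  simp [coeffAct, var, IsFractionRing.map]

theorem coeffAct_const (σ : k →+* k) (c : k) :
    coeffAct σ (algebraMap k (RatField k n) c) = algebraMap k (RatField k n) (σ c) := by
  rw [IsScalarTower.algebraMap_apply k (MvPolynomial (Fin n) k) (RatField k n),
    IsScalarTower.algebraMap_apply k (MvPolynomial (Fin n) k) (RatField k n)]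
  simp [coeffAct, IsFractionRing.map, MvPolynomial.algebraMap_eq]

/-- `f` is regular at the point `y`: it is a quotient of polynomials whose denominator does not
vanish at `y`. -/
def IsRegularAt (f : RatField k n) (y : Fin n → k) : Prop :=
  ∃ p d : MvPolynomial (Fin n) k, MvPolynomial.eval y d ≠ 0 ∧
    f = algebraMap _ (RatField k n) p / algebraMap _ (RatField k n) d

open Classical in
/-- The value `f(y)` of a rational function at a point `y` at which it is regular. -/
def value (f : RatField k n) (y : Fin n → k) : k :=
  if h : IsRegularAt f y then
    MvPolynomial.eval y h.choose / MvPolynomial.eval y h.choose_spec.choose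
  else 0

theorem value_div (y : Fin n → k) (p d : MvPolynomial (Fin n) k)
    (hd : MvPolynomial.eval y d ≠ 0) :
    value (algebraMap _ (RatField k n) p / algebraMap _ (RatField k n) d) y =
      MvPolynomial.eval y p / MvPolynomial.eval y d := by
  have h : IsRegularAt (algebraMap _ (RatField k n) p / algebraMap _ (RatField k n) d) y :=
    ⟨p, d, hd, rfl⟩
  rw [value, dif_pos h]
  obtain ⟨h1, h2⟩ := h.choose_spec.choose_spec
  have hd0 : d ≠ 0 := by rintro rfl; simp at hd
  have hd1 : h.choose_spec.choose ≠ 0 := by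
    intro h0
    rw [h0] at h1
    simp at h1
  have inj := IsFractionRing.injective (MvPolynomial (Fin n) k) (RatField k n)
  rw [div_eq_div_iff ((map_ne_zero_iff _ inj).2 hd0) ((map_ne_zero_iff _ inj).2 hd1),
    ← map_mul, ← map_mul] at h2
  have h3 := congrArg (MvPolynomial.eval y) (inj h2)
  rw [map_mul, map_mul] at h3
  rw [div_eq_div_iff h1 hd]
  exact h3.symm

/-! ### The symmetric group and the Demazure–Lusztig operators -/

/-- The positions `i` and `i + 1` exchanged by the `i`-th simple transposition; there are
`n - 1` simple transpositions, numbered from `0`. -/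
def lft (i : Fin (n - 1)) : Fin n := ⟨i, by omega⟩
def rgt (i : Fin (n - 1)) : Fin n := ⟨i + 1, by omega⟩

/-- The simple transposition `sᵢ`. -/
def simple (i : Fin (n - 1)) : Equiv.Perm (Fin n) := Equiv.swap (lft i) (rgt i)

/-- The length `ℓ(w)` of a permutation: its number of inversions. -/
def len (w : Equiv.Perm (Fin n)) : ℕ :=
  (Finset.univ.filter fun p : Fin n × Fin n => p.1 < p.2 ∧ w p.2 < w p.1).card

/-- The Demazure–Lusztig operator
`Hᵢ = t + (xᵢ - t xᵢ₊₁) / (xᵢ - xᵢ₊₁) · (sᵢ - 1)` on `k(x)`, with parameter `t`. -/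
def heckeOp (t : k) (i : Fin (n - 1)) (f : RatField k n) : RatField k n :=
  algebraMap k (RatField k n) t * f +
    (var (lft i) - algebraMap k (RatField k n) t * var (rgt i)) / (var (lft i) - var (rgt i)) *
      (permAct (simple i) f - f)

/-- `H_{i₁} H_{i₂} ⋯ H_{iₗ} f` for a word `i₁ i₂ ⋯ iₗ`. -/
def heckeWord (t : k) (L : List (Fin (n - 1))) (f : RatField k n) : RatField k n :=
  L.foldr (heckeOp t) f

end Rational

/-- The word `s_{m-1} ⋯ s₁ s₀`. -/
def descWord (n : ℕ) : (m : ℕ) → m ≤ n - 1 → List (Fin (n - 1))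
  | 0, _ => []
  | m + 1, h => ⟨m, h⟩ :: descWord n m (Nat.le_of_succ_le h)

/-- The word `(s₀)(s₁ s₀)(s₂ s₁ s₀) ⋯ (s_{m-1} ⋯ s₁ s₀)`. -/
def stairWord (n : ℕ) : (m : ℕ) → m ≤ n - 1 → List (Fin (n - 1))
  | 0, _ => []
  | m + 1, h => stairWord n m (Nat.le_of_succ_le h) ++ descWord n (m + 1) h

/-- The reduced word `(s₀)(s₁ s₀) ⋯ (s_{n-2} ⋯ s₁ s₀)` of the longest permutation `w₀`. -/
def longWord (n : ℕ) : List (Fin (n - 1)) := stairWord n (n - 1) le_rfl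

/-- The longest permutation `w₀`, which reverses the order of the indices. -/
def w0 (n : ℕ) : Equiv.Perm (Fin n) := Fin.revPerm

theorem simple_val {n : ℕ} (i : Fin (n - 1)) (j : Fin n) :
    ((simple i j : Fin n) : ℕ) =
      if (j : ℕ) = i then (i : ℕ) + 1 else if (j : ℕ) = i + 1 then (i : ℕ) else j := by
  simp only [simple, Equiv.swap_apply_def, lft, rgt, Fin.ext_iff]
  split_ifs <;> rfl

theorem descWord_val {n : ℕ} (m : ℕ) (h : m ≤ n - 1) (j : Fin n) :
    ((((descWord n m h).map simple).prod j : Fin n) : ℕ) =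
      if (j : ℕ) = 0 then m else if (j : ℕ) ≤ m then (j : ℕ) - 1 else j := by
  induction m with
  | zero =>
    simp only [descWord, List.map_nil, List.prod_nil, Equiv.Perm.coe_one, id]
    split_ifs <;> omega
  | succ m ih =>
    simp only [descWord, List.map_cons, List.prod_cons, Equiv.Perm.mul_apply, simple_val, ih]
    split_ifs <;> omega

theorem stairWord_val {n : ℕ} (m : ℕ) (h : m ≤ n - 1) (j : Fin n) :
    ((((stairWord n m h).map simple).prod j : Fin n) : ℕ) =
      if (j : ℕ) ≤ m then m - (j : ℕ) else j := by
  induction m generalizing j with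
  | zero =>
    simp only [stairWord, List.map_nil, List.prod_nil, Equiv.Perm.coe_one, id]
    split_ifs <;> omega
  | succ m ih =>
    simp only [stairWord, List.map_append, List.prod_append, Equiv.Perm.mul_apply, ih,
      descWord_val]
    split_ifs <;> omega

/-- `longWord` is an expression of `w₀` as a product of simple transpositions. -/
theorem longWord_prod (n : ℕ) : ((longWord n).map simple).prod = w0 n := by
  ext j
  have := j.isLt
  rw [longWord, stairWord_val, w0, Fin.revPerm_apply, Fin.val_rev]
  split_ifs <;> omega

/-- This expression of `w₀` is reduced. -/
theorem longWord_length (n : ℕ) : (longWord n).length = len (w0 n) := by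
  have h1 : ∀ m h, (descWord n m h).length = m := by
    intro m
    induction m with
    | zero => intro h; rfl
    | succ m ih => intro h; simp [descWord, ih]
  have h2 : ∀ m h, (stairWord n m h).length = ∑ i ∈ Finset.range (m + 1), i := by
    intro m
    induction m with
    | zero => intro h; rfl
    | succ m ih => intro h; rw [Finset.sum_range_succ]; simp [stairWord, ih, h1]
  have h3 : len (w0 n) = ∑ j : Fin n, (j : ℕ) := by
    have : ∀ j : Fin n, (j : ℕ) =
        (Finset.univ.filter fun p : Fin n × Fin n => (p.1 < p.2 ∧ w0 n p.2 < w0 n p.1) ∧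
          p.2 = j).card := by
      intro j
      have h4 : (Finset.univ.filter fun p : Fin n × Fin n =>
          (p.1 < p.2 ∧ w0 n p.2 < w0 n p.1) ∧ p.2 = j) =
          (Finset.Iio j).map ⟨fun i => (i, j), fun x y h => by simpa using h⟩ := by
        ext ⟨x, y⟩
        simp only [w0, Fin.revPerm_apply, Fin.rev_lt_rev, Finset.mem_filter, Finset.mem_univ,
          true_and, Finset.mem_map, Finset.mem_Iio]
        constructor
        · rintro ⟨⟨h, -⟩, rfl⟩
          exact ⟨x, h, rfl⟩
        · rintro ⟨i, h, h'⟩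
          obtain ⟨rfl, rfl⟩ := Prod.mk.inj h'
          exact ⟨⟨h, h⟩, rfl⟩
      rw [h4, Finset.card_map, Fin.card_Iio]
    rw [Finset.sum_congr rfl fun j _ => this j, len]
    rw [Finset.card_eq_sum_card_fiberwise (f := Prod.snd) (t := Finset.univ)
      (fun x _ => Finset.mem_univ _)]
    simp only [Finset.filter_filter]
  rw [h3, longWord, h2, Fin.sum_univ_eq_sum_range (fun i => i) n]
  rcases n with _ | n <;> rfl

/-- `H_{w₀}`, with parameter `t`. -/
def heckeLong {k : Type*} [Field k] {n : ℕ} (t : k) (f : RatField k n) : RatField k n :=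
  heckeWord t (longWord n) f

/-! ### Interpolation polynomials -/

section Points

variable {k : Type*} [Field k] {n : ℕ}

/-- `kᵢ(v) = #{j < i | v_j ≥ v_i} + #{j > i | v_j > v_i}`. -/
def rank (v : Fin n → ℤ) (i : Fin n) : ℕ :=
  (Finset.univ.filter fun j => j < i ∧ v i ≤ v j).card +
    (Finset.univ.filter fun j => i < j ∧ v i < v j).card

/-- The spectral point `v̄ = (q^{v_i} t^{-k_i(v)})_i`. -/
def bar (q t : k) (v : Fin n → ℤ) : Fin n → k :=
  fun i => q ^ v i * t ^ (-(rank v i : ℤ))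

/-- The defining properties of the non-symmetric interpolation Macdonald polynomial of degree
`α`: degree at most `|α|`, vanishing at `β̄` for all compositions `β ≠ α` with `|β| ≤ |α|`, and
coefficient `1` at `x^α`. -/
structure IsInterpolation (q t : k) (α : Fin n → ℕ) (G : MvPolynomial (Fin n) k) : Prop where
  totalDegree_le : G.totalDegree ≤ ∑ i, α i
  vanishing : ∀ β : Fin n → ℕ, ∑ i, β i ≤ ∑ i, α i → β ≠ α →
    MvPolynomial.eval (bar q t fun i => (β i : ℤ)) G = 0
  coeff_eq_one : MvPolynomial.coeff (Finsupp.equivFunOnFinite.symm α) G = 1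

/-- The `q`-shifted factorial `(y; q)_m = ∏_{j < m} (1 - q^j y)`. -/
def qPoch {A : Type*} [CommRing A] (q y : A) (m : ℕ) : A :=
  ∏ j ∈ Finset.range m, (1 - q ^ j * y)

end Points

variable {n : ℕ}

/-- The non-symmetric interpolation Macdonald polynomial `G_α ∈ 𝔽[x]`: the unique polynomial
with the properties `IsInterpolation`. -/
def G (α : Fin n → ℕ) : MvPolynomial (Fin n) FF :=
  Classical.epsilon (IsInterpolation qF tF α)

/-- `G_α` as an element of `𝕂[x]`. -/
def GK (α : Fin n → ℕ) : MvPolynomial (Fin n) KK :=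
  MvPolynomial.map (algebraMap FF KK) (G α)

/-- The point `τ = (1, t⁻¹, …, t^{1-n})`. -/
def tau : Fin n → KK := fun i => (t : KK) ^ (-((i : ℕ) : ℤ))

/-- `K_α(x) = G_α(x) / G_α(aτ) ∈ 𝕂[x]` for a composition `α`. -/
def Kpol (α : Fin n → ℕ) : MvPolynomial (Fin n) KK :=
  MvPolynomial.C (MvPolynomial.eval (fun i => (a : KK) * tau i) (GK α))⁻¹ * GK α

/-- `A_m(x; v) = ∏ᵢ (q^{1-m} a v̄ᵢ⁻¹; q)_m / (q t^{n-1} xᵢ; q)_m`. -/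
def Afactor (m : ℕ) (v : Fin n → ℤ) : RatField KK n :=
  ∏ i, algebraMap KK (RatField KK n)
      (qPoch (q : KK) ((q : KK) ^ (1 - (m : ℤ)) * a * (bar (q : KK) t v i)⁻¹) m) /
    qPoch (algebraMap KK (RatField KK n) q)
      (algebraMap KK (RatField KK n) ((q : KK) * (t : KK) ^ ((n : ℤ) - 1)) * var i) m

/-- The least `m ≥ 0` such that `v + (mⁿ)` is a composition. -/
def shift (v : Fin n → ℤ) : ℕ := Finset.univ.sup fun i => (-v i).toNat

theorem shift_nonneg (v : Fin n → ℤ) (i : Fin n) : 0 ≤ v i + shift v := by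
  have : (-v i).toNat ≤ shift v :=
    Finset.le_sup (f := fun i => (-v i).toNat) (Finset.mem_univ i)
  omega

/-- `K_v(x) = A_m(x; v) K_{v + (mⁿ)}(q^m x) ∈ 𝕂(x)` for `v ∈ ℤⁿ`, where `m ≥ 0` is such that
`v + (mⁿ)` is a composition (the least such `m` is taken; the result does not depend on it). -/
def K (v : Fin n → ℤ) : RatField KK n :=
  Afactor (shift v) v *
    scale (q ^ shift v) (algebraMap _ (RatField KK n)
      (Kpol fun i => (v i + shift v).toNat))

/-- `K_v° = ι(K_v)`. -/
def Kcirc (v : Fin n → ℤ) : RatField KK n := coeffAct iota (K v)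

/-- `Ψ = w₀ H°_{w₀}`, where `H°` is `H` with `t` replaced by `t⁻¹`. -/
def Psi (f : RatField KK n) : RatField KK n :=
  permAct (w0 n) (heckeLong (t : KK)⁻¹ f)

/-- `K'_v(x) = t^{ℓ(w₀)} Ψ K_v°(t^{n-1} x)`. -/
def Kprime (v : Fin n → ℤ) : RatField KK n :=
  algebraMap KK (RatField KK n) ((t : KK) ^ len (w0 n)) *
    Psi (scale (t ^ ((n : ℤ) - 1)) (Kcirc v))

/-- The point `a⁻¹ v̄`. -/
def ainvBar (v : Fin n → ℤ) : Fin n → KK := fun i => (a : KK)⁻¹ * bar (q : KK) t v i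

end InterpMacdonald

end

/-! The functions `K_v` satisfy two kinds of relations, and both become symmetric in label and point
at suitable points. Since `G_α` is characterised by vanishing, `Hᵢ G_α` is a combination of `G_α`
and `G_{sᵢα}`, and the raising operator `f(x) ↦ (xₙ - t^{1-n}) f(q⁻¹xₙ, x₁, …, xₙ₋₁)` sends `G_α` to
a multiple of `G_{cyc α}`. Normalising at `aτ` fixes the constants: the Hecke coefficients vanish at
`aτ`, and the raising constant comes from the eigenvalue equation of a Cherednik operator
(`IsInterpolation.eval_geom`). The factor `A_m` carries the relations over to all integer vectors
(`Family.Kval_hecke`, `Family.Kval_rot`).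

Let `ṽ` be the spectral point of `-w₀ v`. At `aṽ` both relations treat `u` and `v` alike
(`Family.Kval_dualPoint_cyc`, `Family.Kval_dualPoint_hecke`). Starting from `u = 0`, where both
sides are `1`, induction gives `K_u(aṽ) = K_v(aũ)` (`Family.duality`).

For the primed functions, `t^{n-1} a⁻¹ w₀ū = ι(aũ)`, so `K_v°(t^{n-1}x)` takes at `a⁻¹ w₀ū` the
value `S(v,u) = ι(K_v(aũ))`, which is symmetric. The operators `Hᵢ°` act on these values through
operators in `u`, and the Hecke relation identifies them with operators in `v` of mirrored index.
Hence a word for `w₀` applied in one variable equals the reversed, mirrored word applied in the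
other (`foldr_opRight_symm`). By the braid relations both words give the same `H°_{w₀}`
(`heckeWord_longWord`), so the symmetry survives. -/

noncomputable section

namespace InterpMacdonald

/-! ### Ranks and spectral points -/

/-- The relation `j` comes before `i` in the decreasing arrangement of the entries of `v`. -/
def Before {n : ℕ} (v : Fin n → ℤ) (j i : Fin n) : Prop := v i < v j ∨ (v i = v j ∧ j < i)

instance {n : ℕ} (v : Fin n → ℤ) (j i : Fin n) : Decidable (Before v j i) := by
  unfold Before; infer_instance

/-- The set of indices that come before `i`. -/
def beforeSet {n : ℕ} (v : Fin n → ℤ) (i : Fin n) : Finset (Fin n) :=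
  Finset.univ.filter fun j => Before v j i

theorem mem_beforeSet {n : ℕ} {v : Fin n → ℤ} {i j : Fin n} :
    j ∈ beforeSet v i ↔ Before v j i := by simp [beforeSet]

theorem rank_eq_card {n : ℕ} (v : Fin n → ℤ) (i : Fin n) :
    rank v i = (beforeSet v i).card := by
  rw [rank, ← Finset.card_union_of_disjoint]
  · congr 1
    ext j
    simp only [Finset.mem_union, Finset.mem_filter, Finset.mem_univ, true_and, mem_beforeSet,
      Before]
    rcases lt_trichotomy i j with h | rfl | h
    · simp [h, h.not_gt]
    · simp
    · simp [h, h.not_gt, le_iff_lt_or_eq]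
  · rw [Finset.disjoint_filter]
    rintro j - ⟨h, -⟩ ⟨h', -⟩
    exact absurd h h'.not_gt

/-- The rank depends only on the order `Before`, so an order isomorphism carries one rank to the
other. The identities for translations, adjacent swaps and `cyc` are instances. -/
theorem rank_comp_perm {n : ℕ} {v w : Fin n → ℤ} (σ : Equiv.Perm (Fin n))
    (h : ∀ j i, Before w j i ↔ Before v (σ j) (σ i)) (i : Fin n) :
    rank w i = rank v (σ i) := by
  rw [rank_eq_card, rank_eq_card]
  refine Finset.card_bij (fun j _ => σ j) ?_ ?_ ?_
  · intro j hj
    simpa [h, mem_beforeSet] using hj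
  · intro j _ j' _ e
    exact σ.injective e
  · intro j hj
    exact ⟨σ.symm j, by simpa [h, mem_beforeSet] using hj, by simp⟩

theorem Before.asymm {n : ℕ} {v : Fin n → ℤ} {i j : Fin n} (h : Before v j i) :
    ¬ Before v i j := by
  unfold Before at *
  rcases h with h | ⟨h, h'⟩
  · rintro (h1 | ⟨h1, -⟩) <;> omega
  · rintro (h1 | ⟨-, h1⟩)
    · omega
    · exact absurd h1 h'.not_gt

theorem before_total {n : ℕ} (v : Fin n → ℤ) {i j : Fin n} (h : i ≠ j) :
    Before v j i ∨ Before v i j := by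
  unfold Before
  rcases lt_trichotomy (v i) (v j) with h1 | h1 | h1
  · exact Or.inl (Or.inl h1)
  · rcases lt_or_gt_of_ne h with h2 | h2
    · exact Or.inr (Or.inr ⟨h1.symm, h2⟩)
    · exact Or.inl (Or.inr ⟨h1, h2⟩)
  · exact Or.inr (Or.inl h1)

theorem Before.trans {n : ℕ} {v : Fin n → ℤ} {i j l : Fin n} (h : Before v l j)
    (h' : Before v j i) : Before v l i := by
  unfold Before at *
  rcases h with h | ⟨h, h1⟩ <;> rcases h' with h' | ⟨h', h2⟩
  · left; omega
  · left; omega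
  · left; omega
  · exact Or.inr ⟨h'.trans h, h1.trans h2⟩

theorem rank_lt_of_before {n : ℕ} {v : Fin n → ℤ} {i j : Fin n} (h : Before v j i) :
    rank v j < rank v i := by
  rw [rank_eq_card, rank_eq_card]
  refine Finset.card_lt_card ⟨?_, ?_⟩
  · intro l hl
    rw [mem_beforeSet] at hl ⊢
    exact hl.trans h
  · intro h1
    have := mem_beforeSet.1 (h1 (mem_beforeSet.2 h))
    exact this.asymm this

theorem rank_injective {n : ℕ} (v : Fin n → ℤ) : Function.Injective (rank v) := by
  intro i j h
  by_contra hne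
  rcases before_total v hne with h1 | h1
  · exact absurd h (rank_lt_of_before h1).ne'
  · exact absurd h (rank_lt_of_before h1).ne

/-- Negating and reversing turns the order `Before` around, ties included. The two ranks therefore
count the indices after and before a given one, missing only that index. -/
theorem rank_neg_rev {n : ℕ} (v : Fin n → ℤ) (i : Fin n) :
    rank (fun j => -v j.rev) i + rank v i.rev + 1 = n := by
  have h1 : rank (fun j => -v j.rev) i =
      (Finset.univ.filter fun j => Before v i.rev j).card := by
    rw [rank_eq_card]
    refine Finset.card_bij (fun j _ => j.rev) ?_ ?_ ?_
    · intro j hj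
      have := mem_beforeSet.1 hj
      rw [Finset.mem_filter]
      refine ⟨Finset.mem_univ _, ?_⟩
      simpa [Before, eq_comm] using this
    · intro j _ j' _ e
      exact Fin.rev_injective e
    · intro j hj
      have := (Finset.mem_filter.1 hj).2
      refine ⟨j.rev, mem_beforeSet.2 ?_, by simp⟩
      simpa [Before, eq_comm, Fin.rev_lt_iff] using this
  have h2 : (Finset.univ.filter fun j => Before v i.rev j) ∪ beforeSet v i.rev =
      Finset.univ.erase i.rev := by
    ext j
    simp only [Finset.mem_union, Finset.mem_filter, Finset.mem_univ, true_and, Finset.mem_erase,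
      and_true, mem_beforeSet]
    constructor
    · rintro h rfl
      rcases h with h | h <;> exact h.asymm h
    · intro h
      exact before_total v h
  have h3 : (Finset.univ.erase i.rev).card = n - 1 := by simp
  rw [h1, rank_eq_card, ← Finset.card_union_of_disjoint, h2, h3]
  · have := i.pos
    omega
  · rw [Finset.disjoint_left]
    intro j h h'
    exact (Finset.mem_filter.1 h).2.asymm (mem_beforeSet.1 h')

theorem rank_add_const {n : ℕ} (v : Fin n → ℤ) (c : ℤ) (i : Fin n) :
    rank (fun j => v j + c) i = rank v i :=
  rank_comp_perm 1 (by intro j i; simp [Before]) i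

theorem rank_comp_swap {n : ℕ} (v : Fin n → ℤ) {i j : Fin n} (hij : (j : ℕ) = i + 1)
    (hv : v i ≠ v j) (l : Fin n) :
    rank (fun l => v (Equiv.swap i j l)) l = rank v (Equiv.swap i j l) := by
  refine rank_comp_perm (Equiv.swap i j) ?_ l
  intro x y
  unfold Before
  have hne : i ≠ j := by rintro rfl; omega
  -- An adjacent swap changes the relative order of no two positions other than `i` and `j`, and
  -- these carry different entries.
  have key : v (Equiv.swap i j y) = v (Equiv.swap i j x) →
      (x < y ↔ Equiv.swap i j x < Equiv.swap i j y) := by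
    intro h
    simp only [Equiv.swap_apply_def] at h ⊢
    split_ifs at h ⊢ <;> simp_all only [Fin.lt_def, Fin.ext_iff] <;> omega
  constructor
  · rintro (h | ⟨h, h'⟩)
    · exact Or.inl h
    · exact Or.inr ⟨h, (key h).1 h'⟩
  · rintro (h | ⟨h, h'⟩)
    · exact Or.inl h
    · exact Or.inr ⟨h, (key h).2 h'⟩

theorem rank_succ_of_eq {n : ℕ} (v : Fin n → ℤ) {i j : Fin n} (hij : (j : ℕ) = i + 1)
    (hv : v i = v j) : rank v j = rank v i + 1 := by
  rw [rank_eq_card, rank_eq_card]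
  have : beforeSet v j = insert i (beforeSet v i) := by
    ext l
    simp only [Finset.mem_insert, mem_beforeSet, Before, hv,
      Fin.lt_def, Fin.ext_iff]
    constructor
    · rintro (h | ⟨h, h'⟩)
      · exact Or.inr (Or.inl h)
      · rcases (by omega : (l : ℕ) = i ∨ (l : ℕ) < i) with h1 | h1
        · exact Or.inl h1
        · exact Or.inr (Or.inr ⟨h, h1⟩)
    · rintro (h | h | ⟨h, h'⟩)
      · right
        have : l = i := Fin.ext h
        subst this
        exact ⟨hv.symm, by omega⟩
      · exact Or.inl h
      · exact Or.inr ⟨h, by omega⟩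
  rw [this, Finset.card_insert_of_notMem]
  exact fun h => (mem_beforeSet.1 h).asymm (mem_beforeSet.1 h)

/-! ### The cyclic shift of vectors -/

/-- `(v₁, …, vₙ) ↦ (v₂, …, vₙ, v₁ + 1)`. -/
def cyc {N : ℕ} {A : Type*} [Add A] [One A] (v : Fin (N + 1) → A) : Fin (N + 1) → A :=
  Fin.snoc (fun i : Fin N => v i.succ) (v 0 + 1)

theorem cyc_last {N : ℕ} {A : Type*} [Add A] [One A] (v : Fin (N + 1) → A) :
    cyc v (Fin.last N) = v 0 + 1 := by simp [cyc]

theorem cyc_castSucc {N : ℕ} {A : Type*} [Add A] [One A] (v : Fin (N + 1) → A) (i : Fin N) :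
    cyc v i.castSucc = v i.succ := by simp [cyc]

/-- The first entry wins its ties by position; after the move to the end it wins them by having been
raised by one. So `finRotate` is an order isomorphism. -/
theorem rank_cyc {N : ℕ} (v : Fin (N + 1) → ℤ) (i : Fin (N + 1)) :
    rank (cyc v) i = rank v (finRotate (N + 1) i) := by
  refine rank_comp_perm (finRotate (N + 1)) ?_ i
  intro j i
  induction i using Fin.lastCases with
  | last =>
    induction j using Fin.lastCases with
    | last => simp [Before]
    | cast j =>
      have h : finRotate (N + 1) j.castSucc = j.succ := by simp
      have h1 : ¬ j.succ < 0 := Fin.not_lt_zero _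
      rw [h, finRotate_last]
      simp only [Before, cyc_last, cyc_castSucc, Fin.castSucc_lt_last, h1, and_true, and_false,
        or_false]
      omega
  | cast i =>
    have h : finRotate (N + 1) i.castSucc = i.succ := by simp
    induction j using Fin.lastCases with
    | last =>
      have h1 : ¬ Fin.last N < i.castSucc := not_lt.2 (Fin.le_last _)
      have h2 : 0 < i.succ := Fin.succ_pos i
      rw [h, finRotate_last]
      simp only [Before, cyc_last, cyc_castSucc, h1, h2, and_true, and_false, or_false]
      omega
    | cast j => simp [Before, cyc_castSucc]

theorem rank_last_of_nonneg {N : ℕ} (v : Fin (N + 1) → ℤ) (h : ∀ i, 0 ≤ v i)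
    (h0 : v (Fin.last N) = 0) : rank v (Fin.last N) = N := by
  have : beforeSet v (Fin.last N) = Finset.univ.erase (Fin.last N) := by
    ext j
    simp only [mem_beforeSet, Finset.mem_univ, Finset.mem_erase, and_true, Before,
      h0]
    constructor
    · rintro h1 rfl
      rcases h1 with h1 | ⟨-, h1⟩
      · omega
      · exact lt_irrefl _ h1
    · intro h1
      have := h j
      rcases (by omega : 0 < v j ∨ 0 = v j) with h2 | h2
      · exact Or.inl h2
      · exact Or.inr ⟨h2, lt_of_le_of_ne (Fin.le_last j) h1⟩
  rw [rank_eq_card, this]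
  simp

/-! ### Spectral points under translation, swaps, reversal and cyclic shift -/

section Bar

variable {k : Type*} [Field k] {q t : k} {n : ℕ}

theorem bar_ne_zero (hq : q ≠ 0) (ht : t ≠ 0) (v : Fin n → ℤ) (i : Fin n) : bar q t v i ≠ 0 :=
  mul_ne_zero (zpow_ne_zero _ hq) (zpow_ne_zero _ ht)

theorem bar_add_const (hq : q ≠ 0) (v : Fin n → ℤ) (c : ℤ) (i : Fin n) :
    bar q t (fun j => v j + c) i = q ^ c * bar q t v i := by
  rw [bar, bar, rank_add_const, zpow_add₀ hq]
  ring

theorem bar_comp_swap (v : Fin n → ℤ) {i j : Fin n} (hij : (j : ℕ) = i + 1) (hv : v i ≠ v j)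
    (l : Fin n) :
    bar q t (fun l => v (Equiv.swap i j l)) l = bar q t v (Equiv.swap i j l) := by
  rw [bar, bar, rank_comp_swap v hij hv]

/-- This ratio makes the Hecke coefficient vanish exactly where swapping the coordinates could leave
the set of spectral points. -/
theorem bar_of_eq (ht : t ≠ 0) (v : Fin n → ℤ) {i j : Fin n} (hij : (j : ℕ) = i + 1)
    (hv : v i = v j) : bar q t v i = t * bar q t v j := by
  rw [bar, bar, rank_succ_of_eq v hij hv, hv, mul_left_comm, ← zpow_one_add₀ ht]
  congr 2
  push_cast
  ring

/-- The source of the scaling by `t^{n-1}` in `Kprime`: it cancels this power of `t` when dual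
points are compared with inverted spectral points. -/
theorem bar_neg_rev (ht : t ≠ 0) (v : Fin n → ℤ) (i : Fin n) :
    bar q t (fun j => -v j.rev) i = t ^ (1 - (n : ℤ)) * (bar q t v i.rev)⁻¹ := by
  have h := rank_neg_rev v i
  rw [bar, bar, mul_inv, ← zpow_neg, ← zpow_neg, mul_left_comm, ← zpow_add₀ ht]
  congr 2
  omega

theorem bar_cyc_last (hq : q ≠ 0) {N : ℕ} (v : Fin (N + 1) → ℤ) :
    bar q t (cyc v) (Fin.last N) = q * bar q t v 0 := by
  rw [bar, bar, rank_cyc, cyc_last, finRotate_last, zpow_add₀ hq, zpow_one]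
  ring

theorem bar_cyc_castSucc {N : ℕ} (v : Fin (N + 1) → ℤ) (i : Fin N) :
    bar q t (cyc v) i.castSucc = bar q t v i.succ := by
  rw [bar, bar, rank_cyc, cyc_castSucc]
  simp

theorem bar_last_of_nonneg {N : ℕ} (v : Fin (N + 1) → ℤ) (h : ∀ i, 0 ≤ v i)
    (h0 : v (Fin.last N) = 0) : bar q t v (Fin.last N) = t ^ (-(N : ℤ)) := by
  rw [bar, rank_last_of_nonneg v h h0, h0]
  simp

end Bar

/-! ### Algebraic independence of the parameters -/

/-- The parameters `q` and `t` of `k` are nonzero and algebraically independent over `ℚ`. -/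
structure Generic {k : Type*} [Field k] (q t : k) : Prop where
  q_ne : q ≠ 0
  t_ne : t ≠ 0
  indep : ∃ j : Polynomial (Polynomial ℚ) →+* k, Function.Injective j ∧
    j (Polynomial.C Polynomial.X) = q ∧ j Polynomial.X = t

theorem generic_FF : Generic qF tF := by
  refine ⟨qF_ne_zero, tF_ne_zero, (algebraMap (Polynomial (RatFunc ℚ)) FF).comp
    (Polynomial.mapRingHom (algebraMap (Polynomial ℚ) (RatFunc ℚ))), ?_, ?_, ?_⟩
  · exact (IsFractionRing.injective (Polynomial (RatFunc ℚ)) FF).comp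
      (Polynomial.map_injective _ (IsFractionRing.injective (Polynomial ℚ) (RatFunc ℚ)))
  · simp only [RingHom.comp_apply, Polynomial.coe_mapRingHom, Polynomial.map_C,
      RatFunc.algebraMap_X, RatFunc.algebraMap_C, qF]
    rfl
  · simp [tF]

theorem Generic.map {k K : Type*} [Field k] [Field K] {q t : k} (h : Generic q t) (f : k →+* K) :
    Generic (f q) (f t) := by
  obtain ⟨hq, ht, j, hj, rfl, rfl⟩ := h
  exact ⟨(map_ne_zero f).2 hq, (map_ne_zero f).2 ht, f.comp j, f.injective.comp hj, rfl, rfl⟩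

theorem generic_KK : Generic (q : KK) (t : KK) := generic_FF.map (algebraMap FF KK)

section Interp

variable {k : Type*} [Field k] {q t : k} {n : ℕ}

/-- Once negative exponents are cleared, this is an equality of monomials in `ℚ[q][t]`. Setting
`(q,t)` to `(2,1)` and to `(1,2)` separates the exponents. -/
theorem Generic.zpow_mul_zpow_eq_one (h : Generic q t) {a b : ℤ} (e : q ^ a * t ^ b = 1) :
    a = 0 ∧ b = 0 := by
  obtain ⟨hq, ht, j, hj, hjq, hjt⟩ := h
  have e1 : q ^ (a.toNat) * t ^ (b.toNat) = q ^ ((-a).toNat) * t ^ ((-b).toNat) := by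
    have ha : (a : ℤ) = (a.toNat : ℤ) - ((-a).toNat : ℤ) := by omega
    have hb : (b : ℤ) = (b.toNat : ℤ) - ((-b).toNat : ℤ) := by omega
    rw [ha, hb, zpow_sub₀ hq, zpow_sub₀ ht] at e
    simp only [zpow_natCast] at e
    field_simp at e
    exact e
  rw [← hjq, ← hjt, ← map_pow j, ← map_pow j, ← map_pow j, ← map_pow j, ← map_mul j,
    ← map_mul j] at e1
  have e2 := hj e1
  have e3 := congrArg (fun p => (p.eval 1).eval 2) e2
  have e4 := congrArg (fun p => (p.eval (Polynomial.C 2)).eval 1) e2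
  simp only [Polynomial.eval_mul, Polynomial.eval_pow, Polynomial.eval_C, Polynomial.eval_X,
    one_pow, mul_one, one_mul] at e3 e4
  have e5 := Nat.pow_right_injective (le_refl 2) (by exact_mod_cast e3 :
    (2 : ℕ) ^ a.toNat = 2 ^ (-a).toNat)
  have e6 := Nat.pow_right_injective (le_refl 2) (by exact_mod_cast e4 :
    (2 : ℕ) ^ b.toNat = 2 ^ (-b).toNat)
  omega

theorem Generic.zpow_eq (h : Generic q t) {a b c d : ℤ}
    (e : q ^ a * t ^ b = q ^ c * t ^ d) : a = c ∧ b = d := by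
  have h1 := h.zpow_mul_zpow_eq_one (a := a - c) (b := b - d) (by
    rw [zpow_sub₀ h.q_ne, zpow_sub₀ h.t_ne, div_mul_div_comm, e]
    exact div_self (mul_ne_zero (zpow_ne_zero _ h.q_ne) (zpow_ne_zero _ h.t_ne)))
  omega

theorem Generic.bar_injective (h : Generic q t) (v : Fin n → ℤ) :
    Function.Injective (bar q t v) := by
  intro i j e
  have := (h.zpow_eq e).2
  exact rank_injective v (by omega)

theorem Generic.bar_eq_mul (h : Generic q t) {v : Fin n → ℤ} {i j : Fin n}
    (e : bar q t v i = t * bar q t v j) : v i = v j := by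
  have h1 : t * bar q t v j = q ^ v j * t ^ (1 + -(rank v j : ℤ)) := by
    rw [bar, zpow_add₀ h.t_ne, zpow_one]
    ring
  rw [h1] at e
  exact (h.zpow_eq e).1

/-! ### Nonsingularity of the interpolation problem -/

/-- Twice the difference of the two sides is `∑ |x_{σ b} - x_b|²`, which is positive because `σ`
moves some index and `x` is injective. -/
theorem sum_mul_perm_lt {ι : Type*} [Fintype ι] (x : ι → Fin n →₀ ℕ)
    (hx : Function.Injective x) (σ : Equiv.Perm ι) (hσ : σ ≠ 1) :
    ∑ b, ∑ i, x (σ b) i * x b i < ∑ b, ∑ i, x b i * x b i := by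
  have h1 : ∑ b, ∑ i, x (σ b) i * x (σ b) i = ∑ b, ∑ i, x b i * x b i :=
    Equiv.sum_comp σ fun b => ∑ i, x b i * x b i
  have h2 : 0 < ∑ b, ∑ i, ((x (σ b) i : ℤ) - x b i) ^ 2 := by
    obtain ⟨b, hb⟩ : ∃ b, σ b ≠ b := by
      by_contra! h
      exact hσ (Equiv.ext h)
    obtain ⟨i, hi⟩ : ∃ i, x (σ b) i ≠ x b i := by
      by_contra! h
      exact hb (hx (Finsupp.ext h))
    refine Finset.sum_pos' (fun b _ => Finset.sum_nonneg fun i _ => sq_nonneg _)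
      ⟨b, Finset.mem_univ _, Finset.sum_pos' (fun i _ => sq_nonneg _)
        ⟨i, Finset.mem_univ _, ?_⟩⟩
    have : (x (σ b) i : ℤ) - x b i ≠ 0 := by omega
    positivity
  have h3 : ∑ b, ∑ i, ((x (σ b) i : ℤ) - x b i) ^ 2 =
      (∑ b, ∑ i, x (σ b) i * x (σ b) i : ℕ) + (∑ b, ∑ i, x b i * x b i : ℕ) -
        2 * (∑ b, ∑ i, x (σ b) i * x b i : ℕ) := by
    push_cast
    rw [Finset.mul_sum, ← Finset.sum_add_distrib, ← Finset.sum_sub_distrib]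
    refine Finset.sum_congr rfl fun b _ => ?_
    rw [Finset.mul_sum, ← Finset.sum_add_distrib, ← Finset.sum_sub_distrib]
    refine Finset.sum_congr rfl fun i _ => ?_
    ring
  rw [h1] at h3
  omega

/-- By `sum_mul_perm_lt` only the identity permutation contributes to the power `X^{∑ |x_b|²}`, so
this coefficient of the determinant is `1`. -/
theorem det_X_pow_ne_zero {ι : Type*} [Fintype ι] [DecidableEq ι] (x : ι → Fin n →₀ ℕ)
    (hx : Function.Injective x) :
    (Matrix.of fun b c => (Polynomial.X : Polynomial ℚ) ^ (∑ i, x b i * x c i)).det ≠ 0 := by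
  intro h
  have h1 := congrArg (fun p => p.coeff (∑ b, ∑ i, x b i * x b i)) h
  simp only [Matrix.det_apply, Matrix.of_apply, Finset.prod_pow_eq_pow_sum,
    Polynomial.finsetSum_coeff, Polynomial.coeff_zero, Polynomial.coeff_smul,
    Polynomial.coeff_X_pow] at h1
  rw [Finset.sum_eq_single 1] at h1
  · simp at h1
  · intro σ _ hσ
    rw [if_neg (sum_mul_perm_lt x hx σ hσ).ne', smul_zero]
  · simp

theorem rank_le (v : Fin n → ℤ) (i : Fin n) : rank v i ≤ n := by
  rw [rank_eq_card]
  exact (Finset.card_le_univ _).trans (by simp)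

/-- The matrix of values of monomials at spectral points is nonsingular. -/
theorem Generic.det_ne_zero (h : Generic q t) {ι : Type*} [Fintype ι] [DecidableEq ι]
    (x : ι → Fin n →₀ ℕ) (hx : Function.Injective x) :
    (Matrix.of fun b c => ∏ i, bar q t (fun i => (x b i : ℤ)) i ^ x c i).det ≠ 0 := by
  obtain ⟨hq, ht, j, hj, rfl, rfl⟩ := h
  -- Scaling column `c` by `t^{n|x_c|}` clears the negative powers of `t`, so the determinant can be
  -- specialised.
  let M : Matrix ι ι (Polynomial (Polynomial ℚ)) := Matrix.of fun b c =>
    ∏ i, (Polynomial.C Polynomial.X ^ x b i *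
      Polynomial.X ^ (n - rank (fun i => (x b i : ℤ)) i)) ^ x c i
  have h1 : M.det ≠ 0 := by
    intro h0
    -- At `t = 1` the ranks disappear and the entries become `q^{⟨x_b, x_c⟩}`.
    refine det_X_pow_ne_zero x hx ?_
    have := congrArg (Polynomial.evalRingHom 1) h0
    rw [RingHom.map_det, map_zero] at this
    rw [← this]
    congr 1
    ext1 b c
    simp [M, Polynomial.eval_prod, ← pow_mul, Finset.prod_pow_eq_pow_sum]
  have h2 : (j.mapMatrix M) = Matrix.of fun b c =>
      (∏ i, (j Polynomial.X ^ n) ^ x c i) *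
        (Matrix.of fun b c => ∏ i, bar (j (Polynomial.C Polynomial.X)) (j Polynomial.X)
          (fun i => (x b i : ℤ)) i ^ x c i) b c := by
    ext1 b c
    simp only [M, RingHom.mapMatrix_apply, Matrix.map_apply, Matrix.of_apply, map_prod, map_pow,
      map_mul, ← Finset.prod_mul_distrib, ← mul_pow, bar]
    refine Finset.prod_congr rfl fun i _ => ?_
    congr 1
    rw [zpow_natCast, zpow_neg, zpow_natCast, pow_sub₀ _ ht (rank_le _ i)]
    ring
  intro h0
  have h3 := congrArg Matrix.det h2
  rw [← RingHom.map_det, Matrix.det_mul_row, h0, mul_zero] at h3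
  exact h1 ((map_eq_zero_iff j hj).1 h3)

/-- The set of exponents is arbitrary, not only those of bounded degree:
`Generic.exists_isInterpolation` needs it with one exponent removed. -/
theorem Generic.eq_zero_of_support_subset (h : Generic q t) (S : Finset (Fin n →₀ ℕ))
    {p : MvPolynomial (Fin n) k} (hp : p.support ⊆ S)
    (h0 : ∀ β ∈ S, MvPolynomial.eval (bar q t fun i => (β i : ℤ)) p = 0) : p = 0 := by
  classical
  have h1 : (fun c : S => p.coeff c) = 0 := by
    refine Matrix.eq_zero_of_mulVec_eq_zero
      (h.det_ne_zero (fun b : S => (b : Fin n →₀ ℕ)) Subtype.val_injective) ?_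
    ext b
    rw [Pi.zero_apply, ← h0 b b.2, MvPolynomial.eval_eq', Finset.sum_subset hp,
      ← Finset.sum_coe_sort S]
    · simp only [Matrix.mulVec, dotProduct, Matrix.of_apply]
      exact Finset.sum_congr rfl fun c _ => mul_comm _ _
    · intro c _ hc
      rw [MvPolynomial.notMem_support_iff.1 hc, zero_mul]
  ext c
  by_cases hc : c ∈ S
  · exact congrFun h1 ⟨c, hc⟩
  · rw [MvPolynomial.coeff_zero]
    exact MvPolynomial.notMem_support_iff.1 fun h => hc (hp h)

theorem Generic.exists_interpolation (h : Generic q t) (S : Finset (Fin n →₀ ℕ))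
    (f : (Fin n →₀ ℕ) → k) : ∃ p : MvPolynomial (Fin n) k, p.support ⊆ S ∧
      ∀ β ∈ S, MvPolynomial.eval (bar q t fun i => (β i : ℤ)) p = f β := by
  classical
  set M : Matrix S S k := Matrix.of fun b c =>
    ∏ i, bar q t (fun i => ((b : Fin n →₀ ℕ) i : ℤ)) i ^ (c : Fin n →₀ ℕ) i with hM
  have hdet : IsUnit M.det :=
    (h.det_ne_zero (fun b : S => (b : Fin n →₀ ℕ)) Subtype.val_injective).isUnit
  set c : S → k := M⁻¹.mulVec (fun b : S => f b) with hc
  refine ⟨∑ b : S, MvPolynomial.monomial (b : Fin n →₀ ℕ) (c b), ?_, ?_⟩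
  · intro b hb
    obtain ⟨b', -, hb'⟩ := Finset.mem_biUnion.1 (MvPolynomial.support_sum hb)
    have := MvPolynomial.support_monomial_subset hb'
    rw [Finset.mem_singleton] at this
    exact this ▸ b'.2
  · intro β hβ
    have h1 : M.mulVec c = fun b : S => f b := by
      rw [hc, Matrix.mulVec_mulVec, Matrix.mul_nonsing_inv _ hdet, Matrix.one_mulVec]
    have h2 := congrFun h1 ⟨β, hβ⟩
    simp only [] at h2
    rw [← h2, map_sum]
    simp only [Matrix.mulVec, dotProduct, hM, Matrix.of_apply, MvPolynomial.eval_monomial,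
      Finsupp.prod_fintype _ _ (fun i => pow_zero _)]
    exact Finset.sum_congr rfl fun b _ => mul_comm _ _

/-! ### Existence and uniqueness of interpolation polynomials -/

/-- The exponents of degree at most `d`. -/
def exponents (n d : ℕ) : Finset (Fin n →₀ ℕ) :=
  (Finsupp.finite_of_degree_le (σ := Fin n) d).toFinset

theorem mem_exponents {d : ℕ} {β : Fin n →₀ ℕ} : β ∈ exponents n d ↔ ∑ i, β i ≤ d := by
  simp [exponents, Finsupp.degree_eq_sum]

theorem totalDegree_le_iff {d : ℕ} {p : MvPolynomial (Fin n) k} :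
    p.totalDegree ≤ d ↔ p.support ⊆ exponents n d := by
  rw [MvPolynomial.totalDegree, Finset.sup_le_iff]
  refine forall₂_congr fun β _ => ?_
  rw [mem_exponents, Finsupp.sum_fintype _ _ fun _ => rfl]

/-- `p` vanishes at all spectral points of compositions of degree at most `d`, apart from `α`. -/
def VanishesOff (q t : k) (d : ℕ) (α : Fin n → ℕ) (p : MvPolynomial (Fin n) k) : Prop :=
  ∀ β : Fin n → ℕ, ∑ i, β i ≤ d → β ≠ α →
    MvPolynomial.eval (bar q t fun i => (β i : ℤ)) p = 0

theorem Generic.eq_zero_of_vanishing (h : Generic q t) {d : ℕ} {p : MvPolynomial (Fin n) k}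
    (hd : p.totalDegree ≤ d) (h0 : ∀ β : Fin n → ℕ, ∑ i, β i ≤ d →
      MvPolynomial.eval (bar q t fun i => (β i : ℤ)) p = 0) : p = 0 :=
  h.eq_zero_of_support_subset _ (totalDegree_le_iff.1 hd) fun β hβ =>
    h0 β (mem_exponents.1 hβ)

theorem Generic.exists_isInterpolation (h : Generic q t) (α : Fin n → ℕ) :
    ∃ p, IsInterpolation q t α p := by
  classical
  set α' : Fin n →₀ ℕ := Finsupp.equivFunOnFinite.symm α with hα'
  set d := ∑ i, α i with hd
  obtain ⟨p, hp, hp'⟩ := h.exists_interpolation (exponents n d) fun β => if β = α' then 1 else 0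
  have hv : ∀ β : Fin n → ℕ, ∑ i, β i ≤ d → β ≠ α →
      MvPolynomial.eval (bar q t fun i => (β i : ℤ)) p = 0 := by
    intro β hβ hne
    have := hp' (Finsupp.equivFunOnFinite.symm β) (mem_exponents.2 hβ)
    rw [if_neg (fun e => hne (Finsupp.equivFunOnFinite.symm.injective e))] at this
    exact this
  -- With zero coefficient at `x^α`, `p` would be supported on the other exponents and vanish at all
  -- their spectral points, hence be zero.
  have hc : p.coeff α' ≠ 0 := by
    intro hc
    have h0 : p = 0 := by
      refine h.eq_zero_of_support_subset ((exponents n d).erase α') ?_ ?_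
      · intro β hβ
        rw [Finset.mem_erase]
        refine ⟨?_, hp hβ⟩
        rintro rfl
        exact MvPolynomial.mem_support_iff.1 hβ hc
      · intro β hβ
        rw [Finset.mem_erase] at hβ
        rw [hp' β hβ.2, if_neg hβ.1]
    have := hp' α' (mem_exponents.2 (le_refl d))
    rw [h0, map_zero, if_pos rfl] at this
    exact zero_ne_one this
  refine ⟨MvPolynomial.C (p.coeff α')⁻¹ * p, ?_, ?_, ?_⟩
  · refine (MvPolynomial.totalDegree_mul _ _).trans ?_
    rw [MvPolynomial.totalDegree_C, zero_add]
    exact totalDegree_le_iff.2 hp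
  · intro β hβ hne
    rw [map_mul, hv β hβ hne, mul_zero]
  · rw [MvPolynomial.coeff_C_mul]
    exact inv_mul_cancel₀ hc

theorem IsInterpolation.ne_zero {α : Fin n → ℕ} {p : MvPolynomial (Fin n) k}
    (hp : IsInterpolation q t α p) : p ≠ 0 := by
  rintro rfl
  simpa using hp.coeff_eq_one

theorem IsInterpolation.eval_ne_zero (h : Generic q t) {α : Fin n → ℕ}
    {p : MvPolynomial (Fin n) k} (hp : IsInterpolation q t α p) :
    MvPolynomial.eval (bar q t fun i => (α i : ℤ)) p ≠ 0 := by
  intro h0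
  refine hp.ne_zero (h.eq_zero_of_vanishing hp.totalDegree_le fun β hβ => ?_)
  by_cases hne : β = α
  · rw [hne, h0]
  · exact hp.vanishing β hβ hne

/-- A polynomial of degree at most `d` with the same vanishing as `G_α`, and possibly a nonzero
value at `ᾱ`, is a multiple of `G_α`. -/
theorem IsInterpolation.eq_C_mul (h : Generic q t) {α : Fin n → ℕ}
    {g p : MvPolynomial (Fin n) k} (hg : IsInterpolation q t α g)
    (hd : p.totalDegree ≤ ∑ i, α i) (hp : VanishesOff q t (∑ i, α i) α p) :
    p = MvPolynomial.C (MvPolynomial.eval (bar q t fun i => (α i : ℤ)) p /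
      MvPolynomial.eval (bar q t fun i => (α i : ℤ)) g) * g := by
  rw [← sub_eq_zero]
  refine h.eq_zero_of_vanishing (d := ∑ i, α i) ?_ fun β hβ => ?_
  · refine (MvPolynomial.totalDegree_sub _ _).trans (max_le hd ?_)
    refine (MvPolynomial.totalDegree_mul _ _).trans ?_
    rw [MvPolynomial.totalDegree_C, zero_add]
    exact hg.totalDegree_le
  · rw [map_sub, map_mul, MvPolynomial.eval_C]
    by_cases hne : β = α
    · rw [hne, div_mul_cancel₀ _ (hg.eval_ne_zero h), sub_self]
    · rw [hp β hβ hne, hg.vanishing β hβ hne, mul_zero, sub_zero]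

theorem IsInterpolation.map {K : Type*} [Field K] {α : Fin n → ℕ} {p : MvPolynomial (Fin n) k}
    (hp : IsInterpolation q t α p) (f : k →+* K) :
    IsInterpolation (f q) (f t) α (MvPolynomial.map f p) := by
  refine ⟨?_, ?_, ?_⟩
  · exact totalDegree_le_iff.2 ((MvPolynomial.support_map_subset f p).trans
      (totalDegree_le_iff.1 hp.totalDegree_le))
  · intro β hβ hne
    have h1 : bar (f q) (f t) (fun i => (β i : ℤ)) =
        fun i => f (bar q t (fun i => (β i : ℤ)) i) := by
      ext i
      simp [bar]
    have h2 := congrArg f (hp.vanishing β hβ hne)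
    rw [h1, MvPolynomial.eval_map]
    rw [map_zero, ← MvPolynomial.eval₂_id, MvPolynomial.eval₂_eq'] at h2
    rw [MvPolynomial.eval₂_eq', ← h2]
    simp
  · rw [MvPolynomial.coeff_map, hp.coeff_eq_one, map_one]

end Interp

theorem isInterpolation_G {n : ℕ} (α : Fin n → ℕ) : IsInterpolation qF tF α (G α) :=
  Classical.epsilon_spec (generic_FF.exists_isInterpolation α)

theorem isInterpolation_GK {n : ℕ} (α : Fin n → ℕ) :
    IsInterpolation (q : KK) (t : KK) α (GK α) :=
  (isInterpolation_G α).map (algebraMap FF KK)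

/-! ### Operators on polynomials -/

section Operators

variable {k : Type*} [Field k] {n : ℕ}

/-- The coefficient `(yᵢ - t yⱼ) / (yᵢ - yⱼ)` of the Demazure–Lusztig operators. -/
def heckeCoeff (t : k) (i j : Fin n) (y : Fin n → k) : k := (y i - t * y j) / (y i - y j)

theorem X_sub_X_dvd_sub_rename (i j : Fin n) (p : MvPolynomial (Fin n) k) :
    (MvPolynomial.X i - MvPolynomial.X j : MvPolynomial (Fin n) k) ∣
      MvPolynomial.rename (Equiv.swap i j) p - p := by
  rw [← Ideal.mem_span_singleton, ← Ideal.Quotient.mk_eq_mk_iff_sub_mem]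
  set I : Ideal (MvPolynomial (Fin n) k) :=
    Ideal.span {(MvPolynomial.X i - MvPolynomial.X j : MvPolynomial (Fin n) k)} with hI
  have hX : Ideal.Quotient.mk I (MvPolynomial.X i) = Ideal.Quotient.mk I (MvPolynomial.X j) := by
    rw [Ideal.Quotient.mk_eq_mk_iff_sub_mem]
    exact Ideal.mem_span_singleton_self _
  have : ((Ideal.Quotient.mkₐ k I).comp (MvPolynomial.rename (Equiv.swap i j))) =
      Ideal.Quotient.mkₐ k I := by
    ext l
    simp only [AlgHom.comp_apply, MvPolynomial.rename_X, Ideal.Quotient.mkₐ_eq_mk,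
      Equiv.swap_apply_def]
    split_ifs with h1 h2
    · rw [h1, hX]
    · rw [h2, hX]
    · rfl
  exact AlgHom.congr_fun this p

theorem eval_aeval_eq (f : Fin n → MvPolynomial (Fin n) k) (y : Fin n → k)
    (p : MvPolynomial (Fin n) k) :
    MvPolynomial.eval y (MvPolynomial.aeval f p) =
      MvPolynomial.eval (fun i => MvPolynomial.eval y (f i)) p := by
  induction p using MvPolynomial.induction_on with
  | C c => simp [MvPolynomial.algebraMap_eq]
  | add p p' hp hp' => simp only [map_add, hp, hp']
  | mul_X p i hp => simp only [map_mul, hp, MvPolynomial.aeval_X, MvPolynomial.eval_X]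

/-- The substitution `xᵢ = 0`. -/
def killVar (i : Fin n) : MvPolynomial (Fin n) k →ₐ[k] MvPolynomial (Fin n) k :=
  MvPolynomial.aeval fun l => if l = i then 0 else MvPolynomial.X l

theorem eval_killVar (i : Fin n) (y : Fin n → k) (p : MvPolynomial (Fin n) k) :
    MvPolynomial.eval y (killVar i p) = MvPolynomial.eval (Function.update y i 0) p := by
  rw [killVar, eval_aeval_eq]
  congr 2
  ext l
  rw [Function.update_apply]
  split_ifs <;> simp

theorem eval_killVar_of_eq_zero {i : Fin n} {y : Fin n → k} (hy : y i = 0)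
    (p : MvPolynomial (Fin n) k) :
    MvPolynomial.eval y (killVar i p) = MvPolynomial.eval y p := by
  rw [eval_killVar]
  congr 1
  rw [← hy, Function.update_eq_self]

theorem X_dvd_of_killVar_eq_zero {i : Fin n} {p : MvPolynomial (Fin n) k}
    (h : killVar i p = 0) : (MvPolynomial.X i : MvPolynomial (Fin n) k) ∣ p := by
  have h1 : (MvPolynomial.X i : MvPolynomial (Fin n) k) ∣ killVar i p - p := by
    rw [← Ideal.mem_span_singleton, ← Ideal.Quotient.mk_eq_mk_iff_sub_mem]
    set I : Ideal (MvPolynomial (Fin n) k) :=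
      Ideal.span {(MvPolynomial.X i : MvPolynomial (Fin n) k)} with hI
    have hX : Ideal.Quotient.mk I (MvPolynomial.X i) = 0 := by
      rw [Ideal.Quotient.eq_zero_iff_mem]
      exact Ideal.mem_span_singleton_self _
    have : ((Ideal.Quotient.mkₐ k I).comp (killVar i)) = Ideal.Quotient.mkₐ k I := by
      ext l
      simp only [AlgHom.comp_apply, killVar, MvPolynomial.aeval_X, Ideal.Quotient.mkₐ_eq_mk]
      split_ifs with h1
      · rw [h1, hX, map_zero]
      · rfl
    exact AlgHom.congr_fun this p
  rw [h, zero_sub] at h1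
  exact (dvd_neg).1 h1

theorem eval_rename_swap (i j : Fin n) (y : Fin n → k) (p : MvPolynomial (Fin n) k) :
    MvPolynomial.eval y (MvPolynomial.rename (Equiv.swap i j) p) =
      MvPolynomial.eval (fun l => y (Equiv.swap i j l)) p := by
  rw [MvPolynomial.eval_rename]
  rfl

/-- The Demazure–Lusztig operators preserve polynomials and do not raise the degree. -/
theorem exists_heckePoly (t : k) {i j : Fin n} (hij : i ≠ j) (p : MvPolynomial (Fin n) k) :
    ∃ p' : MvPolynomial (Fin n) k, p'.totalDegree ≤ p.totalDegree ∧
      (∀ y : Fin n → k, y i ≠ y j → MvPolynomial.eval y p' = t * MvPolynomial.eval y p +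
        heckeCoeff t i j y * (MvPolynomial.eval (fun l => y (Equiv.swap i j l)) p -
          MvPolynomial.eval y p)) ∧
      ∀ y : Fin n → k, y i = 0 → MvPolynomial.eval y p' =
        t * MvPolynomial.eval (fun l => y (Equiv.swap i j l)) p := by
  obtain ⟨r, hr⟩ := X_sub_X_dvd_sub_rename i j p
  have hXX : (MvPolynomial.X i - MvPolynomial.X j : MvPolynomial (Fin n) k) ≠ 0 := by
    rw [sub_ne_zero]
    exact fun h => hij (MvPolynomial.X_injective h)
  -- Here `r` is the divided difference `(sp - p) / (xᵢ - xⱼ)`.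
  refine ⟨MvPolynomial.C t * p +
    (MvPolynomial.X i - MvPolynomial.C t * MvPolynomial.X j) * r, ?_, ?_, ?_⟩
  · refine (MvPolynomial.totalDegree_add _ _).trans (max_le ?_ ?_)
    · refine (MvPolynomial.totalDegree_mul _ _).trans ?_
      rw [MvPolynomial.totalDegree_C, zero_add]
    · by_cases hr0 : r = 0
      · simp [hr0]
      have h1 : (MvPolynomial.X i - MvPolynomial.X j : MvPolynomial (Fin n) k).totalDegree +
          r.totalDegree ≤ p.totalDegree := by
        rw [← MvPolynomial.totalDegree_mul_of_isDomain hXX hr0, ← hr]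
        exact (MvPolynomial.totalDegree_sub _ _).trans
          (max_le (MvPolynomial.totalDegree_rename_le _ _) le_rfl)
      have h2 : 1 ≤ (MvPolynomial.X i - MvPolynomial.X j :
          MvPolynomial (Fin n) k).totalDegree := by
        have : Finsupp.single i 1 ∈ (MvPolynomial.X i - MvPolynomial.X j :
            MvPolynomial (Fin n) k).support := by
          have hji : ¬ (Finsupp.single j 1 : Fin n →₀ ℕ) = Finsupp.single i 1 := fun h =>
            hij (Finsupp.single_left_injective one_ne_zero h).symm
          rw [MvPolynomial.mem_support_iff, MvPolynomial.coeff_sub, MvPolynomial.coeff_X,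
            MvPolynomial.coeff_X, if_pos rfl, if_neg hji, sub_zero]
          exact one_ne_zero
        simpa using MvPolynomial.le_totalDegree this
      have h3 : (MvPolynomial.X i - MvPolynomial.C t * MvPolynomial.X j :
          MvPolynomial (Fin n) k).totalDegree ≤ 1 := by
        refine (MvPolynomial.totalDegree_sub _ _).trans (max_le ?_ ?_)
        · rw [MvPolynomial.totalDegree_X]
        · refine (MvPolynomial.totalDegree_mul _ _).trans ?_
          rw [MvPolynomial.totalDegree_C, MvPolynomial.totalDegree_X]
      have := MvPolynomial.totalDegree_mul
        (MvPolynomial.X i - MvPolynomial.C t * MvPolynomial.X j) r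
      omega
  · intro y hy
    have h1 := congrArg (MvPolynomial.eval y) hr
    simp only [map_sub, map_mul, eval_rename_swap, MvPolynomial.eval_X] at h1
    simp only [map_add, map_sub, map_mul, MvPolynomial.eval_X, MvPolynomial.eval_C, h1,
      heckeCoeff]
    have := sub_ne_zero.2 hy
    field_simp
  · intro y hy
    -- Modulo `xᵢ`, `sp - p = -xⱼ r`, so `t p - t xⱼ r` collapses to `t · sp`.
    have h1 : killVar i (MvPolynomial.rename (Equiv.swap i j) p - p +
        MvPolynomial.X j * r) = 0 := by
      rw [hr, ← add_mul, sub_add_cancel, map_mul]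
      simp [killVar]
    have h2 := congrArg (MvPolynomial.eval y) h1
    rw [eval_killVar_of_eq_zero hy] at h2
    simp only [map_add, map_sub, map_mul, eval_rename_swap, MvPolynomial.eval_X,
      map_zero] at h2
    simp only [map_add, map_sub, map_mul, MvPolynomial.eval_X, MvPolynomial.eval_C, hy]
    linear_combination (-t) * h2

theorem totalDegree_aeval_le {f : Fin n → MvPolynomial (Fin n) k}
    (hf : ∀ i, (f i).totalDegree ≤ 1) (p : MvPolynomial (Fin n) k) :
    (MvPolynomial.aeval f p).totalDegree ≤ p.totalDegree := by
  rw [MvPolynomial.aeval_def, MvPolynomial.eval₂_eq']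
  refine MvPolynomial.totalDegree_finsetSum_le fun d hd => ?_
  refine (MvPolynomial.totalDegree_mul _ _).trans ?_
  rw [MvPolynomial.algebraMap_eq, MvPolynomial.totalDegree_C, zero_add]
  refine (MvPolynomial.totalDegree_finsetProd _ _).trans ?_
  refine le_trans ?_ (MvPolynomial.le_totalDegree hd)
  rw [Finsupp.sum_fintype _ _ fun _ => rfl]
  refine Finset.sum_le_sum fun i _ => (MvPolynomial.totalDegree_pow _ _).trans ?_
  exact (Nat.mul_le_mul_left _ (hf i)).trans_eq (mul_one _)

/-- `(y₁, …, yₙ) ↦ (q⁻¹ yₙ, y₁, …, yₙ₋₁)`. -/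
def rot {N : ℕ} (q : k) (y : Fin (N + 1) → k) : Fin (N + 1) → k :=
  Fin.cons (q⁻¹ * y (Fin.last N)) fun i : Fin N => y i.castSucc

/-- The raising operator `f(x) ↦ (xₙ - t^{1-n}) f(q⁻¹ xₙ, x₁, …, xₙ₋₁)`. -/
def raise {N : ℕ} (q t : k) (p : MvPolynomial (Fin (N + 1)) k) :
    MvPolynomial (Fin (N + 1)) k :=
  (MvPolynomial.X (Fin.last N) - MvPolynomial.C (t ^ (-(N : ℤ)))) *
    MvPolynomial.aeval (Fin.cons (MvPolynomial.C q⁻¹ * MvPolynomial.X (Fin.last N))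
      fun i : Fin N => MvPolynomial.X i.castSucc : Fin (N + 1) → MvPolynomial (Fin (N + 1)) k) p

theorem eval_raise {N : ℕ} (q t : k) (y : Fin (N + 1) → k) (p : MvPolynomial (Fin (N + 1)) k) :
    MvPolynomial.eval y (raise q t p) =
      (y (Fin.last N) - t ^ (-(N : ℤ))) * MvPolynomial.eval (rot q y) p := by
  rw [raise, map_mul, map_sub, MvPolynomial.eval_X, MvPolynomial.eval_C]
  rw [eval_aeval_eq]
  refine congrArg (fun z => (y (Fin.last N) - t ^ (-(N : ℤ))) * MvPolynomial.eval z p)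
    (funext fun l => ?_)
  refine Fin.cases ?_ (fun l => ?_) l <;> simp [rot]

theorem totalDegree_raise_le {N : ℕ} (q t : k) (p : MvPolynomial (Fin (N + 1)) k) :
    (raise q t p).totalDegree ≤ p.totalDegree + 1 := by
  refine (MvPolynomial.totalDegree_mul _ _).trans ?_
  rw [add_comm]
  refine add_le_add (totalDegree_aeval_le (fun i => ?_) p) ?_
  · refine Fin.cases ?_ (fun i => ?_) i
    · rw [Fin.cons_zero]
      refine (MvPolynomial.totalDegree_mul _ _).trans ?_
      rw [MvPolynomial.totalDegree_C, MvPolynomial.totalDegree_X]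
    · rw [Fin.cons_succ, MvPolynomial.totalDegree_X]
  · refine (MvPolynomial.totalDegree_sub _ _).trans (max_le ?_ ?_)
    · rw [MvPolynomial.totalDegree_X]
    · rw [MvPolynomial.totalDegree_C]
      exact zero_le_one

end Operators

/-! ### Recursions for interpolation polynomials -/

section Recursions

variable {k : Type*} [Field k] {q t : k} {n : ℕ}

theorem Generic.t_ne_one (h : Generic q t) : t ≠ 1 := by
  intro e
  have := h.zpow_mul_zpow_eq_one (a := 0) (b := 1) (by simp [e])
  omega

theorem heckeCoeff_bar_of_eq (ht : t ≠ 0) {v : Fin n → ℤ} {i j : Fin n}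
    (hij : (j : ℕ) = i + 1) (hv : v i = v j) : heckeCoeff t i j (bar q t v) = 0 := by
  rw [heckeCoeff, bar_of_eq ht v hij hv, sub_self, zero_div]

theorem Generic.heckeCoeff_bar_ne_zero (h : Generic q t) {v : Fin n → ℤ} {i j : Fin n}
    (hij : (j : ℕ) = i + 1) (hv : v i ≠ v j) : heckeCoeff t i j (bar q t v) ≠ 0 := by
  have hne : i ≠ j := by rintro rfl; omega
  refine div_ne_zero (fun e => hv (h.bar_eq_mul (sub_eq_zero.1 e))) (sub_ne_zero.2 ?_)
  exact fun e => hne (h.bar_injective v e)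

theorem comp_swap_of_eq {A : Type*} {v : Fin n → A} {i j : Fin n} (hv : v i = v j) :
    (fun l => v (Equiv.swap i j l)) = v := by
  ext l
  rw [Equiv.swap_apply_def]
  split_ifs with h1 h2
  · rw [h1, hv]
  · rw [h2, hv]
  · rfl

theorem comp_swap_swap {A : Type*} (v : Fin n → A) (i j : Fin n) :
    (fun l => (fun l => v (Equiv.swap i j l)) (Equiv.swap i j l)) = v := by
  ext l
  simp

/-- At a spectral point, `Hᵢ f` is a combination of the values of `f` at `v̄` and at the spectral
point of `sᵢ v`. -/
theorem heckeCoeff_mul_eval_swap (ht : t ≠ 0) (f : (Fin n → k) → k) (v : Fin n → ℤ)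
    {i j : Fin n} (hij : (j : ℕ) = i + 1) :
    heckeCoeff t i j (bar q t v) * (f (fun l => bar q t v (Equiv.swap i j l)) - f (bar q t v)) =
      heckeCoeff t i j (bar q t v) *
        (f (bar q t fun l => v (Equiv.swap i j l)) - f (bar q t v)) := by
  by_cases hv : v i = v j
  -- The swapped point need not be spectral here, but its coefficient is zero.
  · rw [heckeCoeff_bar_of_eq ht hij hv, zero_mul, zero_mul]
  · rw [show (fun l => bar q t v (Equiv.swap i j l)) = bar q t fun l => v (Equiv.swap i j l) from
      funext fun l => (bar_comp_swap v hij hv l).symm]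

theorem sum_comp_swap (β : Fin n → ℕ) (i j : Fin n) :
    ∑ l, β (Equiv.swap i j l) = ∑ l, β l := Equiv.sum_comp (Equiv.swap i j) β

/-- With `s` chosen to kill the value at `ᾱ`, `Hᵢ G_α - s G_α` vanishes at every spectral point of
degree at most `|α|` except that of `sᵢα`, so it is a multiple of `G_{sᵢα}`. -/
theorem IsInterpolation.hecke_of_ne (h : Generic q t) {α : Fin n → ℕ} {i j : Fin n}
    (hij : (j : ℕ) = i + 1) (hα : α i ≠ α j) {g g' : MvPolynomial (Fin n) k}
    (hg : IsInterpolation q t α g)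
    (hg' : IsInterpolation q t (fun l => α (Equiv.swap i j l)) g') :
    ∃ e : k, ∀ y : Fin n → k, y i ≠ y j →
      heckeCoeff t i j y * (MvPolynomial.eval (fun l => y (Equiv.swap i j l)) g -
        MvPolynomial.eval y g) = e * MvPolynomial.eval y g' -
          heckeCoeff t i j (bar q t fun l => (α l : ℤ)) * MvPolynomial.eval y g := by
  have hne : i ≠ j := by rintro rfl; omega
  obtain ⟨p, hp1, hp2, -⟩ := exists_heckePoly t hne g
  set s := t - heckeCoeff t i j (bar q t fun l => (α l : ℤ)) with hs
  have hval : ∀ β : Fin n → ℕ, MvPolynomial.eval (bar q t fun l => (β l : ℤ)) p =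
      t * MvPolynomial.eval (bar q t fun l => (β l : ℤ)) g +
        heckeCoeff t i j (bar q t fun l => (β l : ℤ)) *
          (MvPolynomial.eval (bar q t fun l => (β (Equiv.swap i j l) : ℤ)) g -
            MvPolynomial.eval (bar q t fun l => (β l : ℤ)) g) := by
    intro β
    rw [hp2 _ fun e => hne (h.bar_injective _ e)]
    rw [heckeCoeff_mul_eval_swap h.t_ne (fun z => MvPolynomial.eval z g) _ hij]
  have hαs : (fun l => α (Equiv.swap i j l)) ≠ α := by
    intro e
    have := congrFun e i
    simp only [Equiv.swap_apply_left] at this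
    exact hα this.symm
  suffices key : ∃ e, p - MvPolynomial.C s * g = MvPolynomial.C e * g' by
    obtain ⟨e, key⟩ := key
    refine ⟨e, fun y hy => ?_⟩
    have h1 := congrArg (MvPolynomial.eval y) key
    rw [map_sub, map_mul, map_mul, MvPolynomial.eval_C, MvPolynomial.eval_C, hp2 y hy] at h1
    rw [← h1, hs]
    ring
  refine ⟨_, hg'.eq_C_mul h ?_ ?_⟩
  · rw [sum_comp_swap]
    refine (MvPolynomial.totalDegree_sub _ _).trans
      (max_le (hp1.trans hg.totalDegree_le) ?_)
    refine (MvPolynomial.totalDegree_mul _ _).trans ?_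
    rw [MvPolynomial.totalDegree_C, zero_add]
    exact hg.totalDegree_le
  · intro β hβ hβne
    rw [sum_comp_swap] at hβ
    rw [map_sub, map_mul, MvPolynomial.eval_C, hval]
    by_cases hβα : β = α
    · subst hβα
      rw [hg.vanishing (fun l => β (Equiv.swap i j l)) (sum_comp_swap β i j).le hαs, hs]
      ring
    · have h2 : (fun l => β (Equiv.swap i j l)) ≠ α := by
        rintro rfl
        exact hβne (comp_swap_swap β i j).symm
      rw [hg.vanishing β hβ hβα, hg.vanishing (fun l => β (Equiv.swap i j l))
        ((sum_comp_swap β i j).le.trans hβ) h2]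
      ring

/-- For equal entries the coefficient is zero at `ᾱ`, so `Hᵢ G_α - t G_α` vanishes there as well and
uniqueness makes it zero. -/
theorem IsInterpolation.hecke_of_eq (h : Generic q t) {α : Fin n → ℕ} {i j : Fin n}
    (hij : (j : ℕ) = i + 1) (hα : α i = α j) {g : MvPolynomial (Fin n) k}
    (hg : IsInterpolation q t α g) (y : Fin n → k) (hy : y i ≠ y j) :
    heckeCoeff t i j y * (MvPolynomial.eval (fun l => y (Equiv.swap i j l)) g -
        MvPolynomial.eval y g) = 0 := by
  have hne : i ≠ j := by rintro rfl; omega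
  obtain ⟨p, hp1, hp2, -⟩ := exists_heckePoly t hne g
  have hval : ∀ β : Fin n → ℕ, MvPolynomial.eval (bar q t fun l => (β l : ℤ)) p =
      t * MvPolynomial.eval (bar q t fun l => (β l : ℤ)) g +
        heckeCoeff t i j (bar q t fun l => (β l : ℤ)) *
          (MvPolynomial.eval (bar q t fun l => (β (Equiv.swap i j l) : ℤ)) g -
            MvPolynomial.eval (bar q t fun l => (β l : ℤ)) g) := by
    intro β
    rw [hp2 _ fun e => hne (h.bar_injective _ e)]
    rw [heckeCoeff_mul_eval_swap h.t_ne (fun z => MvPolynomial.eval z g) _ hij]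
  have key : p - MvPolynomial.C t * g = 0 := by
    refine h.eq_zero_of_vanishing (d := ∑ l, α l) ?_ fun β hβ => ?_
    · refine (MvPolynomial.totalDegree_sub _ _).trans
        (max_le (hp1.trans hg.totalDegree_le) ?_)
      refine (MvPolynomial.totalDegree_mul _ _).trans ?_
      rw [MvPolynomial.totalDegree_C, zero_add]
      exact hg.totalDegree_le
    · rw [map_sub, map_mul, MvPolynomial.eval_C, hval]
      by_cases hβα : β = α
      · subst hβα
        rw [heckeCoeff_bar_of_eq h.t_ne hij (by exact_mod_cast hα)]
        ring
      · have h2 : (fun l => β (Equiv.swap i j l)) ≠ α := by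
          rintro rfl
          refine hβα ?_
          simp only [Equiv.swap_apply_left, Equiv.swap_apply_right] at hα
          exact (comp_swap_of_eq hα.symm).symm
        rw [hg.vanishing β hβ hβα, hg.vanishing (fun l => β (Equiv.swap i j l))
          ((sum_comp_swap β i j).le.trans hβ) h2]
        ring
  have h1 := congrArg (MvPolynomial.eval y) key
  rw [map_sub, map_mul, MvPolynomial.eval_C, hp2 y hy, map_zero] at h1
  linear_combination h1

theorem sum_cyc {N : ℕ} (α : Fin (N + 1) → ℕ) : ∑ i, cyc α i = ∑ i, α i + 1 := by
  rw [Fin.sum_univ_castSucc, Fin.sum_univ_succ α, cyc_last]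
  simp only [cyc_castSucc]
  ring

theorem cast_cyc {N : ℕ} (α : Fin (N + 1) → ℕ) :
    (fun i => ((cyc α i : ℕ) : ℤ)) = cyc fun i => (α i : ℤ) := by
  ext i
  refine Fin.lastCases ?_ (fun i => ?_) i <;> simp [cyc]

/-- The inverse of `cyc` on functions with positive last value. -/
theorem exists_cyc_eq {N : ℕ} (β : Fin (N + 1) → ℕ) (h : β (Fin.last N) ≠ 0) :
    ∃ γ, β = cyc γ := by
  refine ⟨Fin.cons (β (Fin.last N) - 1) fun i => β i.castSucc, ?_⟩
  ext i
  refine Fin.lastCases ?_ (fun i => ?_) i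
  · rw [cyc_last, Fin.cons_zero]
    omega
  · rw [cyc_castSucc, Fin.cons_succ]

theorem rot_bar_cyc (hq : q ≠ 0) {N : ℕ} (v : Fin (N + 1) → ℤ) :
    rot q (bar q t (cyc v)) = bar q t v := by
  ext i
  refine Fin.cases ?_ (fun i => ?_) i
  · rw [rot, Fin.cons_zero, bar_cyc_last hq, inv_mul_cancel_left₀ hq]
  · rw [rot, Fin.cons_succ, bar_cyc_castSucc]

/-- If the last entry of `β` is zero, the linear factor kills `β̄`. Otherwise `β = cyc γ`, and the
rotated argument is `γ̄`, where `G_α` vanishes unless `γ = α`. -/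
theorem IsInterpolation.vanishesOff_raise (hq : q ≠ 0) {N : ℕ} {α : Fin (N + 1) → ℕ}
    {g : MvPolynomial (Fin (N + 1)) k} (hg : IsInterpolation q t α g) :
    VanishesOff q t (∑ i, α i + 1) (cyc α) (raise q t g) := by
  intro β hβ hne
  rw [eval_raise]
  by_cases h0 : β (Fin.last N) = 0
  · rw [bar_last_of_nonneg _ (fun i => by positivity) (by exact_mod_cast h0), sub_self, zero_mul]
  · obtain ⟨γ, rfl⟩ := exists_cyc_eq β h0
    rw [sum_cyc] at hβ
    rw [cast_cyc, rot_bar_cyc hq, hg.vanishing γ (by omega), mul_zero]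
    rintro rfl
    exact hne rfl

theorem IsInterpolation.raise_eq (h : Generic q t) {N : ℕ} {α : Fin (N + 1) → ℕ}
    {g g' : MvPolynomial (Fin (N + 1)) k} (hg : IsInterpolation q t α g)
    (hg' : IsInterpolation q t (cyc α) g') :
    ∃ c : k, raise q t g = MvPolynomial.C c * g' := by
  refine ⟨_, hg'.eq_C_mul h ?_ ?_⟩
  · rw [sum_cyc]
    exact (totalDegree_raise_le q t g).trans (Nat.add_le_add_right hg.totalDegree_le 1)
  · rw [sum_cyc]
    exact hg.vanishesOff_raise h.q_ne

/-! ### The Cherednik operator and values at multiples of `τ` -/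

/-- The point `b (1, t⁻¹, …, t^{1-n})`. -/
def geom (t b : k) : Fin n → k := fun i => b * t ^ (-((i : ℕ) : ℤ))

theorem geom_eq_mul (ht : t ≠ 0) (b : k) {i j : Fin n} (hij : (j : ℕ) = i + 1) :
    (geom t b i : k) = t * geom t b j := by
  rw [geom, geom, hij, mul_left_comm, ← zpow_one_add₀ ht]
  congr 2
  push_cast
  ring

theorem heckeCoeff_geom (ht : t ≠ 0) (b : k) {i j : Fin n} (hij : (j : ℕ) = i + 1) :
    heckeCoeff t i j (geom t b) = 0 := by
  rw [heckeCoeff, geom_eq_mul ht b hij, sub_self, zero_div]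

theorem Generic.geom_ne (h : Generic q t) {b : k} (hb : b ≠ 0) {i j : Fin n}
    (hij : (j : ℕ) = i + 1) : (geom t b i : k) ≠ geom t b j := by
  rw [geom_eq_mul h.t_ne b hij]
  intro e
  have h1 : (geom t b j : k) ≠ 0 := mul_ne_zero hb (zpow_ne_zero _ h.t_ne)
  exact h.t_ne_one (mul_right_cancel₀ h1 (by rw [one_mul]; exact e))

/-- Moves the entry at position `N - m` to the end. -/
def moveLast {N : ℕ} {A : Type*} (m : ℕ) (y : Fin (N + 1) → A) : Fin (N + 1) → A := fun l =>
  if (l : ℕ) < N - m then y l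
  else if h : (l : ℕ) < N then y ⟨l + 1, by omega⟩ else y ⟨N - m, by omega⟩

theorem moveLast_swap {N : ℕ} {A : Type*} (m : ℕ) (hm : m < N) (y : Fin (N + 1) → A)
    (i j : Fin (N + 1)) (hi : (i : ℕ) = N - (m + 1)) (hj : (j : ℕ) = N - m) :
    moveLast m (fun l => y (Equiv.swap i j l)) = moveLast (m + 1) y := by
  ext l
  simp only [moveLast, Equiv.swap_apply_def, Fin.ext_iff, hi, hj]
  split_ifs <;> first | omega | (congr 1; ext; simp only []; omega) | rfl

/-- In one-based numbering `p = H_{n-m} ⋯ H_{n-1} g`. At multiples of `τ` every coefficient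
vanishes, leaving a factor `t` per operator. At points with the indicated zero coordinate each
operator is `t` times a swap, and the swaps compose to `moveLast`. -/
theorem exists_hecke_chain (h : Generic q t) {N : ℕ} (m : ℕ) (hm : m ≤ N)
    (g : MvPolynomial (Fin (N + 1)) k) (d : ℕ)
    (hv : ∀ β : Fin (N + 1) → ℕ, ∑ i, β i ≤ d →
      MvPolynomial.eval (bar q t fun i => (β i : ℤ)) g = 0) :
    ∃ p : MvPolynomial (Fin (N + 1)) k, p.totalDegree ≤ g.totalDegree ∧
      (∀ β : Fin (N + 1) → ℕ, ∑ i, β i ≤ d →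
        MvPolynomial.eval (bar q t fun i => (β i : ℤ)) p = 0) ∧
      (∀ b : k, b ≠ 0 → MvPolynomial.eval (geom t b) p =
        t ^ m * MvPolynomial.eval (geom t b) g) ∧
      ∀ y : Fin (N + 1) → k, y ⟨N - m, by omega⟩ = 0 → MvPolynomial.eval y p =
        t ^ m * MvPolynomial.eval (moveLast m y) g := by
  induction m with
  | zero =>
    refine ⟨g, le_rfl, hv, fun b _ => by simp, fun y _ => ?_⟩
    rw [pow_zero, one_mul]
    refine congrArg (fun z => MvPolynomial.eval z g) (funext fun l => ?_)
    rw [moveLast]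
    split_ifs with h1 h2
    · rfl
    · omega
    · congr 1
      ext
      simp only []
      omega
  | succ m ih =>
    obtain ⟨p, hp1, hp2, hp3, hp4⟩ := ih (by omega)
    set i : Fin (N + 1) := ⟨N - (m + 1), by omega⟩ with hi
    set j : Fin (N + 1) := ⟨N - m, by omega⟩ with hj
    have hij : (j : ℕ) = i + 1 := by simp only [hi, hj]; omega
    have hne : i ≠ j := by rintro e; rw [e] at hij; omega
    obtain ⟨p', h1, h2, h3⟩ := exists_heckePoly t hne p
    refine ⟨p', h1.trans hp1, fun β hβ => ?_, fun b hb => ?_, fun y hy => ?_⟩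
    · rw [h2 _ fun e => hne (h.bar_injective _ e),
        heckeCoeff_mul_eval_swap h.t_ne (fun z => MvPolynomial.eval z p) _ hij, hp2 β hβ,
        hp2 (fun l => β (Equiv.swap i j l)) ((sum_comp_swap β i j).le.trans hβ)]
      ring
    · rw [h2 _ (h.geom_ne hb hij), heckeCoeff_geom h.t_ne b hij, zero_mul, add_zero, hp3 b hb,
        pow_succ]
      ring
    · rw [h3 y hy, hp4 _ (by rw [Equiv.swap_apply_right]; exact hy),
        moveLast_swap m (by omega) y i j rfl rfl, pow_succ]
      ring

/-- The eigenvalue equation of the first inhomogeneous Cherednik operator, evaluated at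
`b (1, t⁻¹, …, t^{1-n})`. -/
theorem IsInterpolation.eval_geom (h : Generic q t) {N : ℕ} {α : Fin (N + 1) → ℕ}
    {g : MvPolynomial (Fin (N + 1)) k} (hg : IsInterpolation q t α g) {b : k} (hb : b ≠ 0) :
    (b * (bar q t (fun i => (α i : ℤ)) 0)⁻¹ - 1) * MvPolynomial.eval (geom t b) g =
      t ^ N * MvPolynomial.eval (geom t b) (raise q t g) := by
  -- The only exceptional point of the raised polynomial is that of `cyc α`, of degree `|α| + 1`, so
  -- up to degree `|α|` the raised polynomial vanishes at every spectral point.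
  obtain ⟨p, hp1, hp2, hp3, hp4⟩ := exists_hecke_chain h N le_rfl (raise q t g) (∑ i, α i)
    (fun β hβ => hg.vanishesOff_raise h.q_ne β (by omega) (by
      rintro rfl
      rw [sum_cyc] at hβ
      omega))
  -- At `x₁ = 0` the chain moves the zero to the last place, where the linear factor is `-t^{-N}`
  -- and the rotation undoes the move. With the factor `t^N` this gives `p = -g` there.
  have hdvd : (MvPolynomial.X 0 : MvPolynomial (Fin (N + 1)) k) ∣ g + p := by
    apply X_dvd_of_killVar_eq_zero
    have : Infinite k := by
      obtain ⟨j, hj, -⟩ := h.indep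
      exact Infinite.of_injective j hj
    apply MvPolynomial.funext
    intro y
    rw [eval_killVar, map_zero]
    set z := Function.update y 0 0 with hz
    have hz0 : z 0 = 0 := by simp [hz]
    have e1 := hp4 z (by rw [← hz0]; congr 1; ext; simp)
    have e2 : moveLast N z (Fin.last N) = 0 := by
      rw [moveLast, if_neg (by simp), dif_neg (by simp), ← hz0]
      congr 1
      ext
      simp
    have e3 : rot q (moveLast N z) = z := by
      ext l
      refine Fin.cases ?_ (fun l => ?_) l
      · rw [rot, Fin.cons_zero, e2, mul_zero, hz0]
      · rw [rot, Fin.cons_succ, moveLast, if_neg (by simp), dif_pos (by simp)]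
        congr 1
    rw [eval_raise, e2, e3, zero_sub, zpow_neg, zpow_natCast] at e1
    rw [map_add, e1]
    have := pow_ne_zero N h.t_ne
    field_simp
    ring
  obtain ⟨r, hr⟩ := hdvd
  have hX : (MvPolynomial.X 0 : MvPolynomial (Fin (N + 1)) k) ≠ 0 := MvPolynomial.X_ne_zero 0
  have hrdeg : r.totalDegree ≤ ∑ i, α i := by
    by_cases hr0 : r = 0
    · simp [hr0]
    have h1 := MvPolynomial.totalDegree_mul_of_isDomain hX hr0
    rw [← hr, MvPolynomial.totalDegree_X] at h1
    have h2 := MvPolynomial.totalDegree_add g p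
    have h3 := hg.totalDegree_le
    have h4 := totalDegree_raise_le q t g
    have h5 := max_le (h3.trans (Nat.le_succ _)) (hp1.trans (h4.trans (Nat.add_le_add_right h3 1)))
    omega
  set c := (bar q t (fun i => (α i : ℤ)) 0)⁻¹ with hc
  -- From `x₁ r = g + p`, with `p` zero at these points and their first coordinates nonzero, `r`
  -- vanishes where `g` does and equals `g / ᾱ₁` at `ᾱ`.
  have key : r - MvPolynomial.C c * g = 0 := by
    refine h.eq_zero_of_vanishing (d := ∑ i, α i) ?_ fun β hβ => ?_
    · refine (MvPolynomial.totalDegree_sub _ _).trans (max_le hrdeg ?_)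
      refine (MvPolynomial.totalDegree_mul _ _).trans ?_
      rw [MvPolynomial.totalDegree_C, zero_add]
      exact hg.totalDegree_le
    · have h1 := congrArg (MvPolynomial.eval (bar q t fun i => (β i : ℤ))) hr
      rw [map_add, map_mul, MvPolynomial.eval_X, hp2 β hβ, add_zero] at h1
      have h2 := bar_ne_zero h.q_ne h.t_ne (fun i => (β i : ℤ)) 0
      rw [map_sub, map_mul, MvPolynomial.eval_C]
      by_cases hne : β = α
      · subst hne
        rw [h1, hc, inv_mul_cancel_left₀ h2, sub_self]
      · rw [hg.vanishing β hβ hne] at h1 ⊢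
        rw [mul_zero, sub_zero]
        exact (mul_eq_zero.1 h1.symm).resolve_left h2
  have h1 := congrArg (MvPolynomial.eval (geom t b)) hr
  rw [sub_eq_zero.1 key] at h1
  rw [map_add, hp3 b hb, map_mul, map_mul, MvPolynomial.eval_X, MvPolynomial.eval_C] at h1
  have h2 : (geom t b : Fin (N + 1) → k) 0 = b := by simp [geom]
  rw [h2] at h1
  linear_combination -h1

end Recursions

/-- Every composition is reached from `0` by `cyc` and adjacent transpositions. -/
theorem composition_induction {N : ℕ} {P : (Fin (N + 1) → ℕ) → Prop} (h0 : P 0)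
    (hcyc : ∀ α, P α → P (cyc α))
    (hswap : ∀ α (i j : Fin (N + 1)), (j : ℕ) = i + 1 →
      P (fun l => α (Equiv.swap i j l)) → P α) (α : Fin (N + 1) → ℕ) : P α := by
  induction hd : ∑ i, α i using Nat.strong_induction_on generalizing α with
  | h d ih =>
    by_cases hα : α = 0
    · rw [hα]
      exact h0
    obtain ⟨i, hi⟩ : ∃ i, α i ≠ 0 := by
      by_contra! hne
      exact hα (funext hne)
    -- Here `m` is the distance of a nonzero entry from the last place. Swaps carry it there; then
    -- one `cyc` can be undone, which lowers the degree.
    have key : ∀ m : ℕ, ∀ α : Fin (N + 1) → ℕ, ∑ i, α i = d →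
        ∀ i : Fin (N + 1), (i : ℕ) + m = N → α i ≠ 0 → P α := by
      intro m
      induction m with
      | zero =>
        intro α hd i him hi
        have : i = Fin.last N := Fin.ext (by simpa using him)
        subst this
        obtain ⟨γ, rfl⟩ := exists_cyc_eq α hi
        rw [sum_cyc] at hd
        exact hcyc γ (ih (∑ i, γ i) (by omega) γ rfl)
      | succ m ihm =>
        intro α hd i him hi
        refine hswap α i ⟨i + 1, by omega⟩ rfl (ihm _ ((sum_comp_swap α _ _).trans hd)
          ⟨i + 1, by omega⟩ (by simp only []; omega) ?_)
        rw [Equiv.swap_apply_right]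
        exact hi
    exact key (N - i) α hd i (by omega) hi

/-! ### Iterated cyclic shifts -/

theorem cyc_iterate {N : ℕ} {A : Type*} [Add A] [One A] (v : Fin (N + 1) → A) (m : ℕ)
    (hm : m ≤ N + 1) (l : Fin (N + 1)) :
    (cyc^[m] v) l = if h : l + m < N + 1 then v ⟨l + m, h⟩
      else v ⟨l + m - (N + 1), by omega⟩ + 1 := by
  induction m generalizing l with
  | zero => rw [dif_pos (by omega)]; rfl
  | succ m ih =>
    rw [Function.iterate_succ_apply']
    refine Fin.lastCases ?_ (fun l => ?_) l
    · rw [cyc_last, ih (by omega), dif_pos (by simp; omega), dif_neg (by simp)]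
      congr 2
      ext
      simp
      omega
    · rw [cyc_castSucc, ih (by omega)]
      simp only [Fin.val_succ, Fin.val_castSucc, add_right_comm _ 1 m, add_assoc]

theorem cyc_iterate_full {N : ℕ} {A : Type*} [Add A] [One A] (v : Fin (N + 1) → A) :
    cyc^[N + 1] v = fun l => v l + 1 := by
  ext l
  rw [cyc_iterate v _ le_rfl, dif_neg (by omega)]
  simp

section

variable {k : Type*} [Field k] {q t : k}

theorem bar_cyc_iterate {N : ℕ} (v : Fin (N + 1) → ℤ) (m : ℕ) (l : Fin (N + 1))
    (h : l + m < N + 1) : bar q t (cyc^[m] v) l = bar q t v ⟨l + m, h⟩ := by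
  induction m generalizing l with
  | zero => rfl
  | succ m ih =>
    rw [Function.iterate_succ_apply']
    obtain ⟨l', rfl⟩ : ∃ l' : Fin N, l = l'.castSucc := ⟨⟨l, by omega⟩, rfl⟩
    simp only [Fin.val_castSucc] at h
    rw [bar_cyc_castSucc, ih _ (by simp only [Fin.val_succ]; omega)]
    congr 1
    ext
    simp only [Fin.val_succ, Fin.val_castSucc]
    omega

theorem rot_iterate {N : ℕ} (y : Fin (N + 1) → k) (m : ℕ) (hm : m ≤ N + 1) (l : Fin (N + 1)) :
    ((rot q)^[m] y) l = if m ≤ (l : ℕ) then y ⟨l - m, by omega⟩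
      else q⁻¹ * y (Fin.ofNat (N + 1) (N + 1 + l - m)) := by
  induction m generalizing l with
  | zero => simp
  | succ m ih =>
    rw [Function.iterate_succ_apply']
    refine Fin.cases ?_ (fun l => ?_) l
    · rw [rot, Fin.cons_zero, ih (by omega), if_pos (by simp; omega), if_neg (by simp)]
      congr 2
      ext
      simp only [Fin.val_last, Fin.val_ofNat, Fin.val_zero]
      rw [Nat.mod_eq_of_lt (by omega)]
      omega
    · rw [rot, Fin.cons_succ, ih (by omega)]
      simp only [Fin.val_succ, Fin.val_castSucc]
      split_ifs with h1 h2 h2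
      · congr 1
        ext
        simp only []
        omega
      · omega
      · omega
      · congr 3
        omega

theorem rot_smul {N : ℕ} (c : k) (y : Fin (N + 1) → k) :
    rot q (fun i => c * y i) = fun i => c * rot q y i := by
  ext i
  refine Fin.cases ?_ (fun i => ?_) i
  · simp only [rot, Fin.cons_zero]
    ring
  · simp only [rot, Fin.cons_succ]

end

/-! ### The normalised interpolation polynomials -/

theorem heckeCoeff_smul {k : Type*} [Field k] {n : ℕ} (t c : k) (hc : c ≠ 0) (i j : Fin n)
    (y : Fin n → k) : heckeCoeff t i j (fun l => c * y l) = heckeCoeff t i j y := by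
  rw [heckeCoeff, heckeCoeff, show c * y i - t * (c * y j) = c * (y i - t * y j) by ring,
    ← mul_sub, mul_div_mul_left _ _ hc]

section

variable {k : Type*} [Field k] {q t a : k} {N : ℕ}
  {g : (Fin (N + 1) → ℕ) → MvPolynomial (Fin (N + 1)) k}

/-- `g` is the family of interpolation polynomials, and `a` is independent of `q` and `t`. -/
structure Family (q t a : k) (g : (Fin (N + 1) → ℕ) → MvPolynomial (Fin (N + 1)) k) :
    Prop where
  generic : Generic q t
  a_ne : a ≠ 0
  a_mul_ne : ∀ i j : ℤ, a * (q ^ i * t ^ j) ≠ 1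
  interp : ∀ α, IsInterpolation q t α (g α)

theorem Family.a_mul_bar_inv_ne (h : Family q t a g) {n : ℕ} (v : Fin n → ℤ) (i : Fin n) :
    a * (bar q t v i)⁻¹ - 1 ≠ 0 := by
  rw [sub_ne_zero, bar, mul_inv, ← zpow_neg, ← zpow_neg]
  exact h.a_mul_ne _ _

theorem Family.zero (h : Family q t a g) : g 0 = 1 := by
  have h0 := h.interp 0
  have h1 := h0.totalDegree_le
  simp only [Pi.zero_apply, Finset.sum_const_zero, Nat.le_zero] at h1
  have h2 := h0.coeff_eq_one
  rw [MvPolynomial.totalDegree_eq_zero_iff_eq_C] at h1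
  rw [show Finsupp.equivFunOnFinite.symm (0 : Fin (N + 1) → ℕ) = 0 from
    Finsupp.ext fun _ => rfl] at h2
  rw [h1, h2, MvPolynomial.C_1]

/-- Nonvanishing propagates from `0`. For `cyc` the eigenvalue equation has the nonzero factor `a
ᾱ₁⁻¹ - 1`; for a swap of distinct entries the Hecke coefficient vanishes at `aτ` but not at the
spectral point of the label. -/
theorem Family.eval_geom_ne_zero (h : Family q t a g) (α : Fin (N + 1) → ℕ) :
    MvPolynomial.eval (geom t a) (g α) ≠ 0 := by
  induction α using composition_induction with
  | h0 => rw [h.zero, map_one]; exact one_ne_zero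
  | hcyc α ih =>
    obtain ⟨c, hc⟩ := (h.interp α).raise_eq h.generic (h.interp (cyc α))
    have h1 := (h.interp α).eval_geom h.generic h.a_ne
    rw [hc, map_mul] at h1
    intro h0
    rw [h0, mul_zero, mul_zero] at h1
    exact mul_ne_zero (h.a_mul_bar_inv_ne _ _) ih h1
  | hswap α i j hij ih =>
    by_cases hα : α i = α j
    · rwa [comp_swap_of_eq hα] at ih
    · set β : Fin (N + 1) → ℕ := fun l => α (Equiv.swap i j l) with hβ
      have hβα : (fun l => β (Equiv.swap i j l)) = α := comp_swap_swap α i j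
      have hβne : β i ≠ β j := by
        simp only [hβ, Equiv.swap_apply_left, Equiv.swap_apply_right]
        exact fun e => hα e.symm
      obtain ⟨e, he⟩ := (h.interp β).hecke_of_ne h.generic hij hβne (h.interp _)
      have h1 := he _ (h.generic.geom_ne h.a_ne hij)
      rw [heckeCoeff_geom h.generic.t_ne _ hij, zero_mul, hβα] at h1
      intro h0
      rw [h0, mul_zero, zero_sub, eq_comm, neg_eq_zero] at h1
      exact mul_ne_zero (h.generic.heckeCoeff_bar_ne_zero hij (by exact_mod_cast hβne)) ih h1

/-- The value of `K_α = G_α / G_α(aτ)` at `y`. -/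
def Keval (t a : k) (g : (Fin (N + 1) → ℕ) → MvPolynomial (Fin (N + 1)) k)
    (α : Fin (N + 1) → ℕ) (y : Fin (N + 1) → k) : k :=
  (MvPolynomial.eval (geom t a) (g α))⁻¹ * MvPolynomial.eval y (g α)

local notation "𝒦" => Keval t a g

theorem Family.Keval_zero (h : Family q t a g) (y : Fin (N + 1) → k) : 𝒦 0 y = 1 := by
  rw [Keval, h.zero, map_one, map_one, inv_one, mul_one]

/-- Evaluation at `aτ`, where the Hecke coefficient is zero, determines the constant in
`IsInterpolation.hecke_of_ne`. After normalisation, acting on the point is the same as acting on the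
label. -/
theorem Family.Keval_hecke (h : Family q t a g) (α : Fin (N + 1) → ℕ) {i j : Fin (N + 1)}
    (hij : (j : ℕ) = i + 1) {y : Fin (N + 1) → k} (hy : y i ≠ y j) :
    heckeCoeff t i j y * (𝒦 α (fun l => y (Equiv.swap i j l)) - 𝒦 α y) =
      heckeCoeff t i j (bar q t fun l => (α l : ℤ)) *
        (𝒦 (fun l => α (Equiv.swap i j l)) y - 𝒦 α y) := by
  by_cases hα : α i = α j
  · rw [heckeCoeff_bar_of_eq h.generic.t_ne hij (by exact_mod_cast hα), zero_mul, Keval, Keval]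
    have := (h.interp α).hecke_of_eq h.generic hij hα y hy
    linear_combination (MvPolynomial.eval (geom t a) (g α))⁻¹ * this
  · obtain ⟨e, he⟩ := (h.interp α).hecke_of_ne h.generic hij hα (h.interp _)
    have h1 := he _ (h.generic.geom_ne h.a_ne hij)
    have h2 := he y hy
    rw [heckeCoeff_geom h.generic.t_ne _ hij, zero_mul] at h1
    have h3 := h.eval_geom_ne_zero α
    have h4 := h.eval_geom_ne_zero fun l => α (Equiv.swap i j l)
    have h5 : e = heckeCoeff t i j (bar q t fun l => (α l : ℤ)) *
        MvPolynomial.eval (geom t a) (g α) /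
          MvPolynomial.eval (geom t a) (g fun l => α (Equiv.swap i j l)) := by
      rw [eq_div_iff h4]
      linear_combination -h1
    rw [Keval, Keval, Keval]
    rw [h5] at h2
    generalize heckeCoeff t i j y = c at *
    generalize heckeCoeff t i j (bar q t fun l => (α l : ℤ)) = c' at *
    field_simp at h2 ⊢
    linear_combination h2

/-- The constant in `IsInterpolation.raise_eq` is found from the eigenvalue equation at `aτ`. -/
theorem Family.Keval_rot (h : Family q t a g) (α : Fin (N + 1) → ℕ) (y : Fin (N + 1) → k) :
    (y (Fin.last N) - t ^ (-(N : ℤ))) * 𝒦 α (rot q y) =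
      t ^ (-(N : ℤ)) * (a * (bar q t (fun i => (α i : ℤ)) 0)⁻¹ - 1) * 𝒦 (cyc α) y := by
  obtain ⟨c, hc⟩ := (h.interp α).raise_eq h.generic (h.interp (cyc α))
  have h1 := (h.interp α).eval_geom h.generic h.a_ne
  have h2 := congrArg (MvPolynomial.eval y) hc
  rw [hc, map_mul, MvPolynomial.eval_C] at h1
  rw [eval_raise, map_mul, MvPolynomial.eval_C] at h2
  have h3 := h.eval_geom_ne_zero α
  have h4 := h.eval_geom_ne_zero (cyc α)
  have h5 : c = t ^ (-(N : ℤ)) * ((a * (bar q t (fun i => (α i : ℤ)) 0)⁻¹ - 1) *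
      MvPolynomial.eval (geom t a) (g α)) / MvPolynomial.eval (geom t a) (g (cyc α)) := by
    rw [h1, eq_div_iff h4, zpow_neg, zpow_natCast, inv_mul_cancel_left₀
      (pow_ne_zero _ h.generic.t_ne)]
  rw [h5] at h2
  rw [Keval, Keval, mul_left_comm, h2]
  field_simp

theorem Family.Keval_geom_cyc (h : Family q t a g) (α : Fin (N + 1) → ℕ) {b : k} (hb : b ≠ 0) :
    (b * (bar q t (fun i => (α i : ℤ)) 0)⁻¹ - 1) * 𝒦 α (geom t b) =
      (a * (bar q t (fun i => (α i : ℤ)) 0)⁻¹ - 1) * 𝒦 (cyc α) (geom t b) := by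
  have h1 := (h.interp α).eval_geom h.generic hb
  have h2 := h.Keval_rot α (geom t b)
  rw [eval_raise] at h1
  rw [Keval, mul_left_comm, h1]
  rw [Keval] at h2
  have h3 := pow_ne_zero N h.generic.t_ne
  have h4 : t ^ N * t ^ (-(N : ℤ)) = 1 := by
    rw [zpow_neg, zpow_natCast, mul_inv_cancel₀ h3]
  linear_combination t ^ N * h2 +
    (a * (bar q t (fun i => (α i : ℤ)) 0)⁻¹ - 1) * 𝒦 (cyc α) (geom t b) * h4

theorem Family.Keval_geom_swap (h : Family q t a g) (α : Fin (N + 1) → ℕ) {i j : Fin (N + 1)}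
    (hij : (j : ℕ) = i + 1) {b : k} (hb : b ≠ 0) :
    𝒦 (fun l => α (Equiv.swap i j l)) (geom t b) = 𝒦 α (geom t b) := by
  by_cases hα : α i = α j
  · rw [comp_swap_of_eq hα]
  · have h1 := h.Keval_hecke α hij (h.generic.geom_ne hb hij)
    rw [heckeCoeff_geom h.generic.t_ne _ hij, zero_mul, eq_comm, mul_eq_zero] at h1
    exact sub_eq_zero.1 (h1.resolve_left
      (h.generic.heckeCoeff_bar_ne_zero hij (by exact_mod_cast hα)))

theorem Family.Keval_rot_iterate (h : Family q t a g) (m : ℕ) (α : Fin (N + 1) → ℕ)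
    (y : Fin (N + 1) → k) :
    (∏ i ∈ Finset.range m, (((rot q)^[i] y) (Fin.last N) - t ^ (-(N : ℤ)))) *
        𝒦 α ((rot q)^[m] y) =
      (∏ i ∈ Finset.range m, (t ^ (-(N : ℤ)) *
        (a * (bar q t (cyc^[i] fun i => (α i : ℤ)) 0)⁻¹ - 1))) * 𝒦 (cyc^[m] α) y := by
  induction m generalizing α with
  | zero => simp
  | succ m ih =>
    rw [Finset.prod_range_succ, Finset.prod_range_succ', Function.iterate_succ_apply', mul_assoc,
      h.Keval_rot, mul_left_comm, ih, cast_cyc]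
    simp only [Function.iterate_succ_apply, Function.iterate_zero, id]
    ring

/-- A full turn of `n` rotations multiplies the point by `q⁻¹`, and `n` cyclic shifts add one to
each entry. This is what makes `K_v` independent of the choice of `m`. -/
theorem Family.Keval_add_one (h : Family q t a g) (α : Fin (N + 1) → ℕ)
    (y : Fin (N + 1) → k) :
    (∏ i, (y i - t ^ (-(N : ℤ)))) * 𝒦 α (fun i => q⁻¹ * y i) =
      (∏ i, (t ^ (-(N : ℤ)) * (a * (bar q t (fun i => (α i : ℤ)) i)⁻¹ - 1))) *
        𝒦 (fun i => α i + 1) y := by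
  have h0 := h.Keval_rot_iterate (N + 1) α y
  have h1 : (rot q)^[N + 1] y = fun i => q⁻¹ * y i := by
    ext l
    rw [rot_iterate y _ le_rfl, if_neg (by omega)]
    congr 2
    ext
    simp only [Fin.val_ofNat]
    rw [Nat.add_sub_cancel_left, Nat.mod_eq_of_lt l.isLt]
  rw [h1, cyc_iterate_full, ← Fin.prod_univ_eq_prod_range, ← Fin.prod_univ_eq_prod_range] at h0
  convert h0 using 2
  · rw [← Equiv.prod_comp Fin.revPerm]
    refine Finset.prod_congr rfl fun i _ => ?_
    rw [rot_iterate y i i.isLt.le, if_pos (by simp; omega)]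
    congr 2
    ext
    simp [Fin.val_rev]
  · refine Finset.prod_congr rfl fun i _ => ?_
    rw [bar_cyc_iterate _ _ _ (by simpa using i.isLt)]
    simp

end

/-! ### Functions labelled by integer vectors -/

/-- Both sides are `(z; q)_{m+1}`, split off at opposite ends. -/
theorem qPoch_shift {A : Type*} [CommRing A] (q z : A) (m : ℕ) :
    qPoch q (q * z) m * (1 - z) = qPoch q z m * (1 - q ^ m * z) := by
  have h1 : qPoch q z (m + 1) = qPoch q z m * (1 - q ^ m * z) := by
    rw [qPoch, Finset.prod_range_succ, qPoch]
  have h2 : qPoch q z (m + 1) = qPoch q (q * z) m * (1 - z) := by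
    rw [qPoch, Finset.prod_range_succ', qPoch, pow_zero, one_mul]
    congr 1
    refine Finset.prod_congr rfl fun j _ => ?_
    rw [pow_succ]
    ring
  rw [← h1, ← h2]

theorem qPoch_succ {A : Type*} [CommRing A] (q z : A) (m : ℕ) :
    qPoch q z (m + 1) = qPoch q z m * (1 - q ^ m * z) := by
  rw [qPoch, Finset.prod_range_succ, qPoch]

section

variable {k : Type*} [Field k] {q t a : k} {N : ℕ}
  {g : (Fin (N + 1) → ℕ) → MvPolynomial (Fin (N + 1)) k}

/-- The points at which none of the denominators of the functions `K_v` vanishes. -/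
def GenericPoint {n : ℕ} (q t : k) (y : Fin n → k) : Prop :=
  ∀ (i : Fin n) (j : ℤ), q ^ j * (t ^ ((n : ℤ) - 1) * y i) ≠ 1

theorem qPoch_ne_zero {n : ℕ} {y : Fin n → k} (hy : GenericPoint q t y) (i : Fin n) (m : ℕ) :
    qPoch q (q * t ^ ((n : ℤ) - 1) * y i) m ≠ 0 := by
  rw [qPoch, Finset.prod_ne_zero_iff]
  intro j _ h0
  refine hy i (j + 1 : ℕ) ?_
  rw [zpow_natCast, pow_succ]
  linear_combination -h0

/-- The numerator of `A_m`. -/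
def numer (q t a : k) (m : ℕ) {n : ℕ} (v : Fin n → ℤ) : k :=
  ∏ i, qPoch q (q * (a * (bar q t v i)⁻¹)) m

/-- The denominator of `A_m`. -/
def denom (q t : k) (m : ℕ) {n : ℕ} (y : Fin n → k) : k :=
  ∏ i, qPoch q (q * t ^ ((n : ℤ) - 1) * y i) m

theorem denom_ne_zero {n : ℕ} {y : Fin n → k} (hy : GenericPoint q t y) (m : ℕ) :
    denom q t m y ≠ 0 :=
  Finset.prod_ne_zero_iff.2 fun i _ => qPoch_ne_zero hy i m

theorem numer_comp_swap {n : ℕ} (m : ℕ) (v : Fin n → ℤ) {i j : Fin n} (hij : (j : ℕ) = i + 1) :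
    numer q t a m (fun l => v (Equiv.swap i j l)) = numer q t a m v := by
  by_cases hv : v i = v j
  · rw [comp_swap_of_eq hv]
  · simp only [numer, bar_comp_swap v hij hv]
    exact Equiv.prod_comp (Equiv.swap i j) fun l => qPoch q (q * (a * (bar q t v l)⁻¹)) m

theorem denom_comp_perm {n : ℕ} (m : ℕ) (y : Fin n → k) (σ : Equiv.Perm (Fin n)) :
    denom q t m (fun l => y (σ l)) = denom q t m y :=
  Equiv.prod_comp σ fun l => qPoch q (q * t ^ ((n : ℤ) - 1) * y l) m

theorem numer_cyc (hq : q ≠ 0) (m : ℕ) (v : Fin (N + 1) → ℤ) :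
    numer q t a m (cyc v) * (1 - q ^ m * (a * (bar q t v 0)⁻¹)) =
      numer q t a m v * (1 - a * (bar q t v 0)⁻¹) := by
  rw [numer, numer, Fin.prod_univ_castSucc, Fin.prod_univ_succ, bar_cyc_last hq]
  simp only [bar_cyc_castSucc]
  rw [show q * (a * (q * bar q t v 0)⁻¹) = a * (bar q t v 0)⁻¹ by field_simp]
  rw [mul_assoc, ← qPoch_shift]
  ring

theorem denom_rot (hq : q ≠ 0) (m : ℕ) (y : Fin (N + 1) → k) :
    denom q t m (rot q y) * (1 - q ^ m * (t ^ N * y (Fin.last N))) =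
      denom q t m y * (1 - t ^ N * y (Fin.last N)) := by
  have hN : ((N + 1 : ℕ) : ℤ) - 1 = N := by simp
  rw [denom, denom, Fin.prod_univ_castSucc (n := N) (f := fun i =>
    qPoch q (q * t ^ (((N + 1 : ℕ) : ℤ) - 1) * y i) m), Fin.prod_univ_succ]
  simp only [rot, Fin.cons_zero, Fin.cons_succ, hN, zpow_natCast]
  rw [show q * t ^ N * (q⁻¹ * y (Fin.last N)) = t ^ N * y (Fin.last N) by field_simp,
    mul_right_comm, ← qPoch_shift, mul_assoc q]
  ring

local notation "𝒦" => Keval t a g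

/-- The function `A_m(y; v) K_α(q^m y)`, where `α = v + (mⁿ)`. -/
def KM (q t a : k) (g : (Fin (N + 1) → ℕ) → MvPolynomial (Fin (N + 1)) k) (m : ℕ)
    (α : Fin (N + 1) → ℕ) (y : Fin (N + 1) → k) : k :=
  numer q t a m (fun i => (α i : ℤ)) / denom q t m y * Keval t a g α fun i => q ^ m * y i

theorem Family.KM_hecke (h : Family q t a g) (m : ℕ) (α : Fin (N + 1) → ℕ)
    {i j : Fin (N + 1)} (hij : (j : ℕ) = i + 1) {y : Fin (N + 1) → k} (hy : y i ≠ y j) :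
    heckeCoeff t i j y * (KM q t a g m α (fun l => y (Equiv.swap i j l)) - KM q t a g m α y) =
      heckeCoeff t i j (bar q t fun l => (α l : ℤ)) *
        (KM q t a g m (fun l => α (Equiv.swap i j l)) y - KM q t a g m α y) := by
  have hq := pow_ne_zero m h.generic.q_ne
  have h1 := h.Keval_hecke α hij (y := fun l => q ^ m * y l)
    (fun e => hy (mul_left_cancel₀ hq e))
  rw [heckeCoeff_smul _ _ hq] at h1
  rw [KM, KM, KM, denom_comp_perm, numer_comp_swap m (fun l => (α l : ℤ)) hij]
  linear_combination (numer q t a m fun i => (α i : ℤ)) / denom q t m y * h1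

/-- The ratios in `numer_cyc` and `denom_rot` remove `q^m` from the linear factor of the point and
put it into that of the label, where it turns `ᾱ` into `v̄` with `v = α - (mⁿ)`. The relation thus
keeps the form it has for compositions. -/
theorem Family.KM_rot (h : Family q t a g) (m : ℕ) (α : Fin (N + 1) → ℕ)
    {y : Fin (N + 1) → k} (hy : GenericPoint q t y) (hy' : GenericPoint q t (rot q y)) :
    (y (Fin.last N) - t ^ (-(N : ℤ))) * KM q t a g m α (rot q y) =
      t ^ (-(N : ℤ)) * (q ^ m * (a * (bar q t (fun i => (α i : ℤ)) 0)⁻¹) - 1) *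
        KM q t a g m (cyc α) y := by
  have e1 := h.Keval_rot α fun i => q ^ m * y i
  have e2 := numer_cyc (t := t) (a := a) h.generic.q_ne m fun i => (α i : ℤ)
  have e3 := denom_rot (t := t) h.generic.q_ne m y
  have d1 := denom_ne_zero hy m
  have d2 := denom_ne_zero hy' m
  rw [rot_smul] at e1
  rw [KM, KM, cast_cyc]
  have hT := pow_ne_zero N h.generic.t_ne
  rw [zpow_neg, zpow_natCast] at *
  generalize 𝒦 α (fun i => q ^ m * rot q y i) = κ at *
  generalize 𝒦 (cyc α) (fun i => q ^ m * y i) = κ' at *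
  generalize denom q t m (rot q y) = B' at *
  generalize denom q t m y = B at *
  generalize (numer q t a m fun i => (α i : ℤ)) = A at *
  generalize numer q t a m (cyc fun i => (α i : ℤ)) = A' at *
  generalize a * (bar q t (fun i => (α i : ℤ)) 0)⁻¹ = x at *
  generalize y (Fin.last N) = Y at *
  generalize t ^ N = T at *
  generalize q ^ m = Q at *
  field_simp at e1 ⊢
  linear_combination (-A * κ) * (-e3) + B' * A * e1 - B' * κ' * (-e2)

/-- Along `composition_induction` the numerator and `K_α(q^m aτ)` are unchanged by swaps and change
by inverse factors under `cyc`, so their product keeps its value at `α = 0`. -/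
theorem Family.KM_geom (h : Family q t a g) (m : ℕ) (α : Fin (N + 1) → ℕ)
    (hy : GenericPoint q t (geom t a : Fin (N + 1) → k)) :
    KM q t a g m α (geom t a) = 1 := by
  have hb : q ^ m * a ≠ 0 := mul_ne_zero (pow_ne_zero m h.generic.q_ne) h.a_ne
  have hgeom : (fun i : Fin (N + 1) => q ^ m * geom t a i) = geom t (q ^ m * a) := by
    ext i
    simp only [geom]
    ring
  have hrank : ∀ i : Fin (N + 1), rank (fun _ : Fin (N + 1) => (0 : ℤ)) i = i := by
    intro i
    have : (Finset.univ.filter fun j => j < i) = Finset.Iio i := by ext; simp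
    simp [rank, this]
  have key : ∀ α : Fin (N + 1) → ℕ, numer q t a m (fun i => (α i : ℤ)) *
      𝒦 α (geom t (q ^ m * a)) = denom q t m (geom t a : Fin (N + 1) → k) := by
    intro α
    induction α using composition_induction with
    | h0 =>
      rw [h.Keval_zero, mul_one, numer, denom, ← Equiv.prod_comp Fin.revPerm]
      refine Finset.prod_congr rfl fun i _ => ?_
      congr 1
      simp only [Pi.zero_apply, Nat.cast_zero, bar, hrank, zpow_zero, one_mul, geom,
        Fin.revPerm_apply, Fin.val_rev, ← zpow_neg]
      have e : t ^ (((N + 1 : ℕ) : ℤ) - 1) * t ^ (-((i : ℕ) : ℤ)) =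
          t ^ (- -((N + 1 - ((i : ℕ) + 1) : ℕ) : ℤ)) := by
        rw [← zpow_add₀ h.generic.t_ne]
        congr 1
        omega
      rw [← e]
      ring
    | hcyc α ih =>
      rw [← ih, cast_cyc]
      have e1 := h.Keval_geom_cyc α hb
      have e2 := numer_cyc (t := t) (a := a) h.generic.q_ne m fun i => (α i : ℤ)
      have e3 := h.a_mul_bar_inv_ne (fun i => (α i : ℤ)) 0
      rw [mul_assoc] at e1
      refine mul_left_cancel₀ e3 ?_
      linear_combination (-numer q t a m (cyc fun i => (α i : ℤ))) * e1 -
        𝒦 α (geom t (q ^ m * a)) * e2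
    | hswap α i j hij ih =>
      rwa [numer_comp_swap m (fun l => (α l : ℤ)) hij, h.Keval_geom_swap α hij hb] at ih
  rw [KM, hgeom, div_mul_eq_mul_div, key, div_self (denom_ne_zero hy m)]

/-- The factors gained by the numerator and the denominator are those in `Family.Keval_add_one`, up
to the same power of `-t^N`. -/
theorem Family.KM_add_one (h : Family q t a g) (m : ℕ) (α : Fin (N + 1) → ℕ)
    {y : Fin (N + 1) → k} (hy : GenericPoint q t y) :
    KM q t a g (m + 1) (fun i => α i + 1) y = KM q t a g m α y := by
  have hq := h.generic.q_ne
  have hT := pow_ne_zero N h.generic.t_ne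
  have e1 := h.Keval_add_one α fun i => q ^ (m + 1) * y i
  have hN : ((N + 1 : ℕ) : ℤ) - 1 = N := by simp
  have e0 : (fun i => q⁻¹ * (q ^ (m + 1) * y i)) = fun i => q ^ m * y i := by
    ext i
    rw [pow_succ]
    field_simp
  have e2 : numer q t a (m + 1) (fun i => ((α i + 1 : ℕ) : ℤ)) =
      numer q t a m (fun i => (α i : ℤ)) * ∏ i, (-(t ^ N) * (t ^ (-(N : ℤ)) *
        (a * (bar q t (fun i => (α i : ℤ)) i)⁻¹ - 1))) := by
    rw [numer, numer, ← Finset.prod_mul_distrib]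
    refine Finset.prod_congr rfl fun i _ => ?_
    push_cast
    rw [bar_add_const hq, zpow_one, show q * (a * (q * bar q t (fun i => (α i : ℤ)) i)⁻¹) =
      a * (bar q t (fun i => (α i : ℤ)) i)⁻¹ by field_simp, qPoch_succ, ← qPoch_shift, zpow_neg,
      zpow_natCast]
    congr 1
    field_simp
    ring
  have e3 : denom q t (m + 1) y = denom q t m y *
      ∏ i, (-(t ^ N) * (q ^ (m + 1) * y i - t ^ (-(N : ℤ)))) := by
    rw [denom, denom, ← Finset.prod_mul_distrib]
    refine Finset.prod_congr rfl fun i _ => ?_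
    rw [qPoch_succ, hN, zpow_neg, zpow_natCast]
    congr 1
    field_simp
    ring
  rw [Finset.prod_mul_distrib] at e2 e3
  have hC : ∏ i : Fin (N + 1), -(t ^ N) ≠ 0 :=
    Finset.prod_ne_zero_iff.2 fun _ _ => neg_ne_zero.2 hT
  have d1 := denom_ne_zero hy m
  have d2 := denom_ne_zero hy (m + 1)
  rw [e3] at d2
  have d3 := right_ne_zero_of_mul (right_ne_zero_of_mul d2)
  rw [e0] at e1
  rw [KM, KM, e2, e3]
  generalize (numer q t a m fun i => (α i : ℤ)) = A at *
  generalize denom q t m y = B at *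
  generalize ∏ i : Fin (N + 1), -(t ^ N) = C at *
  generalize (∏ i, (q ^ (m + 1) * y i - t ^ (-(N : ℤ)))) = D at *
  generalize (∏ i, (t ^ (-(N : ℤ)) * (a * (bar q t (fun i => (α i : ℤ)) i)⁻¹ - 1))) = E at *
  field_simp
  linear_combination -A * e1

/-- The value of `K_v` at `y`, for an integer vector `v`. -/
def Kval (q t a : k) (g : (Fin (N + 1) → ℕ) → MvPolynomial (Fin (N + 1)) k)
    (v : Fin (N + 1) → ℤ) (y : Fin (N + 1) → k) : k :=
  KM q t a g (shift v) (fun i => (v i + shift v).toNat) y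

theorem shift_le {n : ℕ} {v : Fin n → ℤ} {m : ℕ} (hm : ∀ i, 0 ≤ v i + m) : shift v ≤ m :=
  Finset.sup_le fun i _ => by have := hm i; omega

theorem Family.Kval_eq_KM (h : Family q t a g) {v : Fin (N + 1) → ℤ} {m : ℕ}
    (hm : ∀ i, 0 ≤ v i + m) {y : Fin (N + 1) → k} (hy : GenericPoint q t y) :
    Kval q t a g v y = KM q t a g m (fun i => (v i + m).toNat) y := by
  obtain ⟨d, rfl⟩ := Nat.exists_eq_add_of_le (shift_le hm)
  clear hm
  induction d with
  | zero => rfl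
  | succ d ih =>
    rw [ih, ← add_assoc, ← h.KM_add_one _ _ hy]
    congr 1
    ext i
    have := shift_nonneg v i
    push_cast
    omega

theorem bar_toNat (hq : q ≠ 0) {n : ℕ} {v : Fin n → ℤ} {m : ℕ} (hm : ∀ i, 0 ≤ v i + m) :
    bar q t (fun i => ((v i + m).toNat : ℤ)) = fun i => q ^ m * bar q t v i := by
  have : (fun i => ((v i + m).toNat : ℤ)) = fun i => v i + m :=
    funext fun i => Int.toNat_of_nonneg (hm i)
  ext i
  rw [this, bar_add_const hq, zpow_natCast]

theorem Family.Kval_hecke (h : Family q t a g) (v : Fin (N + 1) → ℤ) {i j : Fin (N + 1)}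
    (hij : (j : ℕ) = i + 1) {y : Fin (N + 1) → k} (hy : y i ≠ y j) (hg : GenericPoint q t y) :
    heckeCoeff t i j y * (Kval q t a g v (fun l => y (Equiv.swap i j l)) - Kval q t a g v y) =
      heckeCoeff t i j (bar q t v) *
        (Kval q t a g (fun l => v (Equiv.swap i j l)) y - Kval q t a g v y) := by
  have hm := shift_nonneg v
  have h1 := h.KM_hecke (shift v) (fun i => (v i + shift v).toNat) hij hy
  rw [bar_toNat h.generic.q_ne hm,
    heckeCoeff_smul _ _ (pow_ne_zero _ h.generic.q_ne)] at h1
  rw [h.Kval_eq_KM (v := fun l => v (Equiv.swap i j l)) (m := shift v) (fun l => hm _) hg]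
  exact h1

theorem Family.Kval_rot (h : Family q t a g) (v : Fin (N + 1) → ℤ)
    {y : Fin (N + 1) → k} (hy : GenericPoint q t y) (hy' : GenericPoint q t (rot q y)) :
    (y (Fin.last N) - t ^ (-(N : ℤ))) * Kval q t a g v (rot q y) =
      t ^ (-(N : ℤ)) * (a * (bar q t v 0)⁻¹ - 1) * Kval q t a g (cyc v) y := by
  have hm := shift_nonneg v
  have hm' : ∀ i, 0 ≤ cyc v i + shift v := by
    refine Fin.lastCases ?_ fun i => ?_
    · rw [cyc_last]
      have := hm 0
      omega
    · rw [cyc_castSucc]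
      exact hm _
  have h1 := h.KM_rot (shift v) (fun i => (v i + shift v).toNat) hy hy'
  have e1 : cyc (fun i => (v i + shift v).toNat) = fun i => (cyc v i + shift v).toNat := by
    ext i
    refine Fin.lastCases ?_ (fun i => ?_) i
    · simp only [cyc_last]
      have := hm 0
      omega
    · simp only [cyc_castSucc]
  have hq := pow_ne_zero (shift v) h.generic.q_ne
  rw [bar_toNat h.generic.q_ne hm, e1, mul_inv, mul_left_comm a, mul_inv_cancel_left₀ hq] at h1
  rw [h.Kval_eq_KM hm' hy]
  exact h1

theorem Family.Kval_geom (h : Family q t a g) (v : Fin (N + 1) → ℤ)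
    (hy : GenericPoint q t (geom t a : Fin (N + 1) → k)) : Kval q t a g v (geom t a) = 1 :=
  h.KM_geom _ _ hy

theorem Family.Kval_zero (h : Family q t a g) (y : Fin (N + 1) → k) : Kval q t a g 0 y = 1 := by
  have h0 : shift (0 : Fin (N + 1) → ℤ) = 0 := Nat.le_zero.1 (shift_le (by simp))
  rw [Kval, h0, KM]
  have : (fun i : Fin (N + 1) => ((0 : Fin (N + 1) → ℤ) i + (0 : ℕ)).toNat) = 0 := by
    ext
    simp
  rw [this, h.Keval_zero]
  simp [numer, denom, qPoch]

/-! ### Duality -/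

/-- The point `a ṽ`, where `ṽ` is the spectral point of `-w₀ v`. -/
def dualPoint {n : ℕ} (q t a : k) (v : Fin n → ℤ) : Fin n → k :=
  fun i => a * bar q t (fun j => -v j.rev) i

theorem genericPoint_mul_bar (h : Generic q t) (ha : ∀ i j : ℤ, a * (q ^ i * t ^ j) ≠ 1) {n : ℕ}
    (v : Fin n → ℤ) : GenericPoint q t fun i => a * bar q t v i := by
  intro i j e
  beta_reduce at e
  refine ha (j + v i) ((n : ℤ) - 1 + -(rank v i : ℤ)) ?_
  rw [zpow_add₀ h.q_ne, zpow_add₀ h.t_ne, ← e, bar]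
  ring

theorem Family.genericPoint_dualPoint (h : Family q t a g) (v : Fin (N + 1) → ℤ) :
    GenericPoint q t (dualPoint q t a v) := genericPoint_mul_bar h.generic h.a_mul_ne _

/-- The vector `-w₀ v` is the cyclic shift of `-w₀ (cyc v)`, and `rot` undoes a cyclic shift. -/
theorem Family.rot_dualPoint (h : Family q t a g) (v : Fin (N + 1) → ℤ) :
    rot q (dualPoint q t a v) = dualPoint q t a (cyc v) := by
  have h1 : (fun j => -v j.rev) = cyc fun j => -cyc v j.rev := by
    ext j
    refine Fin.lastCases ?_ (fun j => ?_) j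
    · rw [cyc_last, Fin.rev_zero, cyc_last, Fin.rev_last]
      ring
    · rw [cyc_castSucc, Fin.rev_succ, cyc_castSucc, Fin.rev_castSucc]
  change rot q (fun i => a * bar q t (fun j => -v j.rev) i) = _
  rw [rot_smul, h1, rot_bar_cyc h.generic.q_ne]
  rfl

theorem dualPoint_zero {n : ℕ} : dualPoint q t a (0 : Fin n → ℤ) = geom t a := by
  ext i
  have : (Finset.univ.filter fun j => j < i) = Finset.Iio i := by ext; simp
  simp [dualPoint, bar, rank, geom, this]

/-- At `aṽ` the linear factor in `Family.Kval_rot` is `t^{-N} (a v̄₁⁻¹ - 1)`, the same expression in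
`v` as the other factor is in `u`. -/
theorem Family.Kval_dualPoint_cyc (h : Family q t a g) (u v : Fin (N + 1) → ℤ) :
    (a * (bar q t v 0)⁻¹ - 1) * Kval q t a g u (dualPoint q t a (cyc v)) =
      (a * (bar q t u 0)⁻¹ - 1) * Kval q t a g (cyc u) (dualPoint q t a v) := by
  have h1 := h.Kval_rot u (h.genericPoint_dualPoint v)
    (by rw [h.rot_dualPoint]; exact h.genericPoint_dualPoint _)
  rw [h.rot_dualPoint] at h1
  have h2 : dualPoint q t a v (Fin.last N) = t ^ (-(N : ℤ)) * (a * (bar q t v 0)⁻¹) := by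
    rw [dualPoint, bar_neg_rev h.generic.t_ne, Fin.rev_last,
      show 1 - ((N + 1 : ℕ) : ℤ) = -(N : ℤ) by push_cast; ring]
    ring
  have h3 : t ^ (-(N : ℤ)) ≠ 0 := zpow_ne_zero _ h.generic.t_ne
  refine mul_left_cancel₀ h3 ?_
  rw [h2] at h1
  linear_combination h1

/-- Dual points are reversed inverses of spectral points up to a scalar, and inverting the two
coordinates exchanges their roles in the coefficient. -/
theorem heckeCoeff_dualPoint (hq : q ≠ 0) (ht : t ≠ 0) (ha : a ≠ 0) {n : ℕ} (v : Fin n → ℤ)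
    (i j : Fin n) :
    heckeCoeff t i j (dualPoint q t a v) = heckeCoeff t j.rev i.rev (bar q t v) := by
  have h1 := bar_ne_zero hq ht v i.rev
  have h2 := bar_ne_zero hq ht v j.rev
  have e : dualPoint q t a v = fun i => (a * t ^ (1 - (n : ℤ))) * (bar q t v i.rev)⁻¹ := by
    ext i
    rw [dualPoint, bar_neg_rev ht, mul_assoc]
  rw [e, heckeCoeff_smul _ _ (mul_ne_zero ha (zpow_ne_zero _ ht)), heckeCoeff, heckeCoeff]
  rw [show (bar q t v i.rev)⁻¹ - t * (bar q t v j.rev)⁻¹ =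
      (bar q t v j.rev - t * bar q t v i.rev) / (bar q t v i.rev * bar q t v j.rev) by
    field_simp,
    show (bar q t v i.rev)⁻¹ - (bar q t v j.rev)⁻¹ =
      (bar q t v j.rev - bar q t v i.rev) / (bar q t v i.rev * bar q t v j.rev) by
    field_simp]
  exact div_div_div_cancel_right₀ (mul_ne_zero h1 h2) _ _

theorem rev_swap {n : ℕ} (i j l : Fin n) :
    (Equiv.swap i j l).rev = Equiv.swap j.rev i.rev l.rev := by
  rw [Equiv.swap_comm, Equiv.swap_apply_def, Equiv.swap_apply_def]
  simp only [Fin.rev_inj]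
  split_ifs <;> rfl

/-- The Hecke relation at a dual point: `u` and `v` now enter in the same way, apart from the
mirrored index. -/
theorem Family.Kval_dualPoint_hecke (h : Family q t a g) (u v : Fin (N + 1) → ℤ)
    {i j : Fin (N + 1)} (hij : (j : ℕ) = i + 1) :
    heckeCoeff t j.rev i.rev (bar q t v) *
      (Kval q t a g u (dualPoint q t a fun l => v (Equiv.swap j.rev i.rev l)) -
        Kval q t a g u (dualPoint q t a v)) =
      heckeCoeff t i j (bar q t u) *
        (Kval q t a g (fun l => u (Equiv.swap i j l)) (dualPoint q t a v) -
          Kval q t a g u (dualPoint q t a v)) := by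
  have hne : i ≠ j := by rintro rfl; omega
  rw [← h.Kval_hecke u hij _ (h.genericPoint_dualPoint v)]
  · rw [heckeCoeff_dualPoint h.generic.q_ne h.generic.t_ne h.a_ne]
    have hij' : (i.rev : ℕ) = j.rev + 1 := by
      simp only [Fin.val_rev]
      omega
    by_cases hv : v j.rev = v i.rev
    · rw [heckeCoeff_bar_of_eq h.generic.t_ne hij' hv, zero_mul, zero_mul]
    · congr 3
      ext l
      have hv' : (fun j => -v j.rev) i ≠ (fun j => -v j.rev) j := by
        intro e
        exact hv (neg_injective e).symm
      rw [dualPoint, dualPoint, ← bar_comp_swap _ hij hv']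
      simp only [rev_swap]
  · intro e
    exact hne (h.generic.bar_injective _ (mul_left_cancel₀ h.a_ne e))

/-- Duality: `K_u(a ṽ) = K_v(a ũ)`. -/
theorem Family.duality (h : Family q t a g) (u v : Fin (N + 1) → ℤ) :
    Kval q t a g u (dualPoint q t a v) = Kval q t a g v (dualPoint q t a u) := by
  have hnat : ∀ (α : Fin (N + 1) → ℕ) (v : Fin (N + 1) → ℤ),
      Kval q t a g (fun i => (α i : ℤ)) (dualPoint q t a v) =
        Kval q t a g v (dualPoint q t a fun i => (α i : ℤ)) := by
    intro α
    induction α using composition_induction with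
    | h0 =>
      intro v
      have h0 : (fun i : Fin (N + 1) => (((0 : Fin (N + 1) → ℕ) i : ℕ) : ℤ)) = 0 := by
        ext
        simp
      have hy := h.genericPoint_dualPoint 0
      rw [dualPoint_zero] at hy
      rw [h0, h.Kval_zero, dualPoint_zero, h.Kval_geom v hy]
    | hcyc α ih =>
      intro v
      rw [cast_cyc]
      refine mul_left_cancel₀ (h.a_mul_bar_inv_ne (fun i => (α i : ℤ)) 0) ?_
      rw [← h.Kval_dualPoint_cyc, ih, h.Kval_dualPoint_cyc]
    | hswap α i j hij ih =>
      intro v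
      by_cases hα : α i = α j
      · rw [comp_swap_of_eq hα] at ih
        exact ih v
      set β : Fin (N + 1) → ℤ := fun l => (α (Equiv.swap i j l) : ℤ) with hβ
      have hβα : (fun l => β (Equiv.swap i j l)) = fun i => (α i : ℤ) := by
        ext l
        simp [hβ]
      have hβne : β i ≠ β j := by
        simp only [hβ, Equiv.swap_apply_left, Equiv.swap_apply_right]
        intro e
        exact hα (by exact_mod_cast e.symm)
      have hij' : (i.rev : ℕ) = j.rev + 1 := by
        simp only [Fin.val_rev]
        omega
      -- The relation is read with `β` as label and with `β` as point. The induction hypothesis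
      -- matches the sides that act on `v`, so the sides that act on `β` agree.
      have h1 := h.Kval_dualPoint_hecke β v hij
      have h2 := h.Kval_dualPoint_hecke v β hij'
      rw [Fin.rev_rev, Fin.rev_rev, hβα, ← ih v, ← ih] at h2
      rw [hβα] at h1
      have h3 := h1.symm.trans h2.symm
      exact sub_left_injective
        (mul_left_cancel₀ (h.generic.heckeCoeff_bar_ne_zero hij hβne) h3)
  -- On integer vectors `cyc` is onto, so duality also descends from `cyc u` to `u`. Every `u` is
  -- thereby reached from a composition `u + (mⁿ)`.
  have hcyc : ∀ (m : ℕ) (u : Fin (N + 1) → ℤ), (∀ v, Kval q t a g (cyc^[m] u)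
      (dualPoint q t a v) = Kval q t a g v (dualPoint q t a (cyc^[m] u))) →
      ∀ v, Kval q t a g u (dualPoint q t a v) = Kval q t a g v (dualPoint q t a u) := by
    intro m
    induction m with
    | zero => intro u hu; exact hu
    | succ m ih =>
      intro u hu v
      refine ih u (fun v => ?_) v
      rw [Function.iterate_succ_apply'] at hu
      obtain ⟨w, rfl⟩ : ∃ w, v = cyc w := by
        refine ⟨Fin.cons (v (Fin.last N) - 1) fun i => v i.castSucc, ?_⟩
        ext i
        refine Fin.lastCases ?_ (fun i => ?_) i
        · rw [cyc_last, Fin.cons_zero, sub_add_cancel]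
        · rw [cyc_castSucc, Fin.cons_succ]
      refine mul_left_cancel₀ (h.a_mul_bar_inv_ne w 0) ?_
      rw [h.Kval_dualPoint_cyc, hu, h.Kval_dualPoint_cyc]
  have hiter : ∀ (m : ℕ) (u : Fin (N + 1) → ℤ), cyc^[(N + 1) * m] u = fun i => u i + m := by
    intro m
    induction m with
    | zero => intro u; simp
    | succ m ih =>
      intro u
      rw [Nat.mul_succ, Function.iterate_add_apply, cyc_iterate_full, ih]
      ext i
      push_cast
      ring
  refine hcyc ((N + 1) * shift u) u (fun v => ?_) v
  rw [hiter, show (fun i => u i + (shift u : ℤ)) = fun i => (((u i + shift u).toNat : ℕ) : ℤ) from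
    funext fun i => (Int.toNat_of_nonneg (shift_nonneg u i)).symm]
  exact hnat _ v

end

/-! ### Values of rational functions -/

section Values

variable {k : Type*} [Field k] {n : ℕ}

/-- `f` is regular at `y` with value `c`. -/
def HasVal (f : RatField k n) (y : Fin n → k) (c : k) : Prop :=
  ∃ p d : MvPolynomial (Fin n) k, MvPolynomial.eval y d ≠ 0 ∧
    f = algebraMap _ (RatField k n) p / algebraMap _ (RatField k n) d ∧
    MvPolynomial.eval y p / MvPolynomial.eval y d = c

theorem HasVal.isRegularAt {f : RatField k n} {y : Fin n → k} {c : k} (h : HasVal f y c) :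
    IsRegularAt f y := by
  obtain ⟨p, d, hd, hf, -⟩ := h
  exact ⟨p, d, hd, hf⟩

theorem IsRegularAt.hasVal {f : RatField k n} {y : Fin n → k} (h : IsRegularAt f y) :
    ∃ c, HasVal f y c := by
  obtain ⟨p, d, hd, hf⟩ := h
  exact ⟨_, p, d, hd, hf, rfl⟩

theorem HasVal.value_eq {f : RatField k n} {y : Fin n → k} {c : k} (h : HasVal f y c) :
    value f y = c := by
  obtain ⟨p, d, hd, rfl, rfl⟩ := h
  exact value_div y p d hd

theorem algebraMap_ne_zero_of_eval {y : Fin n → k} {d : MvPolynomial (Fin n) k}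
    (hd : MvPolynomial.eval y d ≠ 0) : algebraMap _ (RatField k n) d ≠ 0 := by
  have hd0 : d ≠ 0 := by rintro rfl; simp at hd
  exact (map_ne_zero_iff _ (IsFractionRing.injective (MvPolynomial (Fin n) k)
    (RatField k n))).2 hd0

theorem hasVal_algebraMap (p : MvPolynomial (Fin n) k) (y : Fin n → k) :
    HasVal (algebraMap _ (RatField k n) p) y (MvPolynomial.eval y p) :=
  ⟨p, 1, by simp, by simp, by simp⟩

theorem hasVal_const (c : k) (y : Fin n → k) : HasVal (algebraMap k (RatField k n) c) y c := by
  rw [IsScalarTower.algebraMap_apply k (MvPolynomial (Fin n) k) (RatField k n)]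
  simpa [MvPolynomial.algebraMap_eq] using
    hasVal_algebraMap (algebraMap k (MvPolynomial (Fin n) k) c) y

theorem hasVal_one (y : Fin n → k) : HasVal (1 : RatField k n) y 1 := by
  simpa using hasVal_algebraMap 1 y

theorem hasVal_var (i : Fin n) (y : Fin n → k) : HasVal (var i) y (y i) := by
  have h := hasVal_algebraMap (MvPolynomial.X i) y
  rwa [MvPolynomial.eval_X] at h

theorem HasVal.add {f f' : RatField k n} {y : Fin n → k} {c c' : k} (h : HasVal f y c)
    (h' : HasVal f' y c') : HasVal (f + f') y (c + c') := by
  obtain ⟨p, d, hd, rfl, rfl⟩ := h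
  obtain ⟨p', d', hd', rfl, rfl⟩ := h'
  refine ⟨p * d' + d * p', d * d', by simp [hd, hd'], ?_, ?_⟩
  · rw [div_add_div _ _ (algebraMap_ne_zero_of_eval hd) (algebraMap_ne_zero_of_eval hd')]
    simp only [map_add, map_mul]
  · rw [div_add_div _ _ hd hd']
    simp only [map_add, map_mul]

theorem HasVal.mul {f f' : RatField k n} {y : Fin n → k} {c c' : k} (h : HasVal f y c)
    (h' : HasVal f' y c') : HasVal (f * f') y (c * c') := by
  obtain ⟨p, d, hd, rfl, rfl⟩ := h
  obtain ⟨p', d', hd', rfl, rfl⟩ := h'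
  refine ⟨p * p', d * d', by simp [hd, hd'], ?_, ?_⟩ <;>
    simp only [map_mul, div_mul_div_comm]

theorem HasVal.neg {f : RatField k n} {y : Fin n → k} {c : k} (h : HasVal f y c) :
    HasVal (-f) y (-c) := by
  obtain ⟨p, d, hd, rfl, rfl⟩ := h
  exact ⟨-p, d, hd, by simp only [map_neg, neg_div], by simp only [map_neg, neg_div]⟩

theorem HasVal.sub {f f' : RatField k n} {y : Fin n → k} {c c' : k} (h : HasVal f y c)
    (h' : HasVal f' y c') : HasVal (f - f') y (c - c') := by
  rw [sub_eq_add_neg, sub_eq_add_neg]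
  exact h.add h'.neg

theorem HasVal.inv {f : RatField k n} {y : Fin n → k} {c : k} (h : HasVal f y c)
    (hc : c ≠ 0) : HasVal f⁻¹ y c⁻¹ := by
  obtain ⟨p, d, hd, rfl, rfl⟩ := h
  exact ⟨d, p, fun h0 => hc (by rw [h0, zero_div]), inv_div _ _, (inv_div _ _).symm⟩

theorem HasVal.div {f f' : RatField k n} {y : Fin n → k} {c c' : k} (h : HasVal f y c)
    (h' : HasVal f' y c') (hc : c' ≠ 0) : HasVal (f / f') y (c / c') := by
  rw [div_eq_mul_inv, div_eq_mul_inv]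
  exact h.mul (h'.inv hc)

theorem HasVal.prod {ι : Type*} (s : Finset ι) {f : ι → RatField k n} {y : Fin n → k}
    {c : ι → k} (h : ∀ i ∈ s, HasVal (f i) y (c i)) :
    HasVal (∏ i ∈ s, f i) y (∏ i ∈ s, c i) := by
  classical
  induction s using Finset.induction_on with
  | empty => simpa using hasVal_one y
  | insert i s hi ih =>
    rw [Finset.prod_insert hi, Finset.prod_insert hi]
    exact (h i (Finset.mem_insert_self _ _)).mul
      (ih fun j hj => h j (Finset.mem_insert_of_mem hj))

theorem permAct_algebraMap (w : Equiv.Perm (Fin n)) (p : MvPolynomial (Fin n) k) :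
    permAct w (algebraMap _ (RatField k n) p) =
      algebraMap _ (RatField k n) (MvPolynomial.rename w p) := by
  simp [permAct, IsFractionRing.map]

theorem scale_algebraMap (c : kˣ) (p : MvPolynomial (Fin n) k) :
    scale c (algebraMap _ (RatField k n) p) = algebraMap _ (RatField k n) (scalePoly c p) := by
  simp [scale, IsFractionRing.map]

theorem coeffAct_algebraMap (σ : k →+* k) (p : MvPolynomial (Fin n) k) :
    coeffAct σ (algebraMap _ (RatField k n) p) =
      algebraMap _ (RatField k n) (MvPolynomial.map σ p) := by
  simp [coeffAct, IsFractionRing.map]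

theorem HasVal.permAct {f : RatField k n} {y : Fin n → k} {c : k} (w : Equiv.Perm (Fin n))
    (h : HasVal f (fun i => y (w i)) c) : HasVal (permAct w f) y c := by
  obtain ⟨p, d, hd, rfl, rfl⟩ := h
  have e : ∀ p : MvPolynomial (Fin n) k, MvPolynomial.eval y (MvPolynomial.rename w p) =
      MvPolynomial.eval (fun i => y (w i)) p := fun p => by
    rw [MvPolynomial.eval_rename]
    rfl
  exact ⟨MvPolynomial.rename w p, MvPolynomial.rename w d, by rwa [e],
    by rw [map_div₀, permAct_algebraMap, permAct_algebraMap], by rw [e, e]⟩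

theorem HasVal.scale {f : RatField k n} {y : Fin n → k} {c : k} (b : kˣ)
    (h : HasVal f (fun i => (b : k) * y i) c) : HasVal (scale b f) y c := by
  obtain ⟨p, d, hd, rfl, rfl⟩ := h
  have e : ∀ p : MvPolynomial (Fin n) k, MvPolynomial.eval y (scalePoly b p) =
      MvPolynomial.eval (fun i => (b : k) * y i) p := fun p => by
    rw [scalePoly, eval_aeval_eq]
    simp
  exact ⟨scalePoly b p, scalePoly b d, by rwa [e],
    by rw [map_div₀, scale_algebraMap, scale_algebraMap], by rw [e, e]⟩

theorem HasVal.coeffAct {f : RatField k n} {y : Fin n → k} {c : k} (σ : k →+* k)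
    (h : HasVal f y c) : HasVal (coeffAct σ f) (fun i => σ (y i)) (σ c) := by
  obtain ⟨p, d, hd, rfl, rfl⟩ := h
  have e : ∀ p : MvPolynomial (Fin n) k, MvPolynomial.eval (fun i => σ (y i))
      (MvPolynomial.map σ p) = σ (MvPolynomial.eval y p) := fun p => by
    rw [MvPolynomial.eval_map, MvPolynomial.eval₂_eq', MvPolynomial.eval_eq', map_sum]
    simp only [map_mul, map_prod, map_pow]
  refine ⟨MvPolynomial.map σ p, MvPolynomial.map σ d, ?_, ?_, ?_⟩
  · rw [e]
    exact (map_ne_zero σ).2 hd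
  · rw [map_div₀, coeffAct_algebraMap, coeffAct_algebraMap]
  · rw [e, e, map_div₀]

theorem hasVal_qPoch (q c : k) (i : Fin n) (m : ℕ) (y : Fin n → k) :
    HasVal (qPoch (algebraMap k (RatField k n) q) (algebraMap k (RatField k n) c * var i) m) y
      (qPoch q (c * y i) m) := by
  refine HasVal.prod _ fun j _ => (hasVal_one y).sub (HasVal.mul ?_
    ((hasVal_const c y).mul (hasVal_var i y)))
  rw [← map_pow]
  exact hasVal_const _ y

end Values

/-! ### Braid relations -/

section Braid

/-- With the six images of `f` under the group generated by `σ₁` and `σ₂` replaced by independent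
letters, this is an identity of rational functions in `T`, `x₁`, `x₂`, `x₃`. -/
theorem hecke_braid {L : Type*} [Field L] (σ₁ σ₂ : L →+* L) (h₁ : ∀ f, σ₁ (σ₁ f) = f)
    (h₂ : ∀ f, σ₂ (σ₂ f) = f) (h₁₂ : ∀ f, σ₁ (σ₂ (σ₁ f)) = σ₂ (σ₁ (σ₂ f))) (T x₁ x₂ x₃ : L)
    (hT₁ : σ₁ T = T) (hT₂ : σ₂ T = T) (e₁ : σ₁ x₁ = x₂) (e₂ : σ₁ x₂ = x₁) (e₃ : σ₁ x₃ = x₃)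
    (e₄ : σ₂ x₁ = x₁) (e₅ : σ₂ x₂ = x₃) (e₆ : σ₂ x₃ = x₂) (n₁₂ : x₁ ≠ x₂) (n₂₃ : x₂ ≠ x₃)
    (n₁₃ : x₁ ≠ x₃) (H₁ H₂ : L → L)
    (hH₁ : ∀ f, H₁ f = T * f + (x₁ - T * x₂) / (x₁ - x₂) * (σ₁ f - f))
    (hH₂ : ∀ f, H₂ f = T * f + (x₂ - T * x₃) / (x₂ - x₃) * (σ₂ f - f)) (f : L) :
    H₁ (H₂ (H₁ f)) = H₂ (H₁ (H₂ f)) := by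
  simp only [hH₁, hH₂, map_add, map_mul, map_sub, map_div₀, hT₁, hT₂, e₁, e₂, e₃, e₄, e₅, e₆,
    h₁, h₂, h₁₂]
  have d1 := sub_ne_zero.2 n₁₂
  have d2 := sub_ne_zero.2 n₂₃
  have d3 := sub_ne_zero.2 n₁₃
  have d4 := sub_ne_zero.2 n₁₂.symm
  have d5 := sub_ne_zero.2 n₂₃.symm
  generalize σ₂ (σ₁ (σ₂ f)) = f₁
  generalize σ₁ (σ₂ f) = f₂
  generalize σ₂ (σ₁ f) = f₃
  generalize σ₁ f = f₄
  generalize σ₂ f = f₅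
  rw [← neg_sub x₁ x₂, ← neg_sub x₂ x₃]
  field_simp
  ring

theorem hecke_comm {L : Type*} [Field L] (σ₁ σ₂ : L →+* L)
    (h₁₂ : ∀ f, σ₁ (σ₂ f) = σ₂ (σ₁ f)) (T c₁ c₂ : L)
    (hT₁ : σ₁ T = T) (hT₂ : σ₂ T = T) (e₁ : σ₁ c₂ = c₂) (e₂ : σ₂ c₁ = c₁) (H₁ H₂ : L → L)
    (hH₁ : ∀ f, H₁ f = T * f + c₁ * (σ₁ f - f))
    (hH₂ : ∀ f, H₂ f = T * f + c₂ * (σ₂ f - f)) (f : L) :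
    H₁ (H₂ f) = H₂ (H₁ f) := by
  simp only [hH₁, hH₂, map_add, map_mul, map_sub, hT₁, hT₂, e₁, e₂, h₁₂]
  ring

variable {k : Type*} [Field k] {n : ℕ}

theorem permAct_mul (w w' : Equiv.Perm (Fin n)) (f : RatField k n) :
    permAct (w * w') f = permAct w (permAct w' f) := by
  obtain ⟨p, d, -, rfl⟩ := IsFractionRing.div_surjective (A := MvPolynomial (Fin n) k) f
  simp only [map_div₀, permAct_algebraMap, MvPolynomial.rename_rename]
  rfl

theorem permAct_one (f : RatField k n) : permAct (1 : Equiv.Perm (Fin n)) f = f := by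
  obtain ⟨p, d, -, rfl⟩ := IsFractionRing.div_surjective (A := MvPolynomial (Fin n) k) f
  simp only [map_div₀, permAct_algebraMap, Equiv.Perm.coe_one, MvPolynomial.rename_id,
    AlgHom.id_apply]

theorem var_ne_var {i j : Fin n} (h : i ≠ j) : (var i : RatField k n) ≠ var j := by
  intro e
  exact h (MvPolynomial.X_injective (IsFractionRing.injective (MvPolynomial (Fin n) k)
    (RatField k n) e))

theorem simple_mul_self (i : Fin (n - 1)) : simple i * simple i = 1 :=
  Equiv.swap_mul_self _ _

theorem simple_apply_of_ne {i : Fin (n - 1)} {j : Fin n} (h1 : (j : ℕ) ≠ i)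
    (h2 : (j : ℕ) ≠ i + 1) : simple i j = j := by
  ext
  rw [simple_val, if_neg h1, if_neg h2]

theorem heckeOp_braid (t : k) {i j : Fin (n - 1)} (hij : (j : ℕ) = i + 1) (f : RatField k n) :
    heckeOp t i (heckeOp t j (heckeOp t i f)) = heckeOp t j (heckeOp t i (heckeOp t j f)) := by
  have hr : lft j = rgt i := Fin.ext hij
  have inv : ∀ (l : Fin (n - 1)) (f : RatField k n),
      permAct (simple l) (permAct (simple l) f) = f := fun l f => by
    rw [← permAct_mul, simple_mul_self, permAct_one]
  have n₁₂ : lft i ≠ rgt i := by simp [lft, rgt]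
  have n₂₃ : rgt i ≠ rgt j := by simp [rgt, Fin.ext_iff]; omega
  have n₁₃ : lft i ≠ rgt j := by simp [lft, rgt]; omega
  have braid : simple i * simple j * simple i = simple j * simple i * simple j := by
    rw [simple, simple, hr, Equiv.swap_mul_swap_mul_swap n₁₂ n₁₃,
      Equiv.swap_comm (lft i) (rgt i), Equiv.swap_comm (rgt i) (rgt j),
      Equiv.swap_mul_swap_mul_swap n₂₃.symm n₁₃.symm, Equiv.swap_comm]
  refine hecke_braid (permAct (simple i)) (permAct (simple j)) (inv i) (inv j) (fun f => ?_)
    (algebraMap k _ t) (var (lft i)) (var (rgt i)) (var (rgt j)) (permAct_const _ _)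
    (permAct_const _ _) ?_ ?_ ?_ ?_ ?_ ?_ ?_ ?_ ?_ (heckeOp t i) (heckeOp t j)
    (fun f => by rw [heckeOp]) (fun f => by rw [heckeOp, hr]) f
  · rw [← permAct_mul, ← permAct_mul, ← permAct_mul, ← permAct_mul, braid]
  · rw [permAct_var, simple, Equiv.swap_apply_left]
  · rw [permAct_var, simple, Equiv.swap_apply_right]
  · rw [permAct_var, simple_apply_of_ne] <;> simp only [rgt] <;> omega
  · rw [permAct_var, simple_apply_of_ne] <;> simp only [lft] <;> omega
  · rw [← hr, permAct_var, simple, Equiv.swap_apply_left]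
  · rw [← hr, permAct_var, simple, Equiv.swap_apply_right]
  · exact var_ne_var n₁₂
  · exact var_ne_var n₂₃
  · exact var_ne_var n₁₃

theorem permAct_heckeFactor (t : k) (w : Equiv.Perm (Fin n)) (i j : Fin n) :
    permAct w ((var i - algebraMap k (RatField k n) t * var j) / (var i - var j)) =
      (var (w i) - algebraMap k (RatField k n) t * var (w j)) / (var (w i) - var (w j)) := by
  rw [map_div₀, map_sub, map_sub, map_mul, permAct_const, permAct_var, permAct_var]

theorem heckeOp_comm (t : k) {i j : Fin (n - 1)} (hij : (i : ℕ) + 2 ≤ j) (f : RatField k n) :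
    heckeOp t i (heckeOp t j f) = heckeOp t j (heckeOp t i f) := by
  have e1 : simple i (lft j) = lft j :=
    simple_apply_of_ne (by simp only [lft]; omega) (by simp only [lft]; omega)
  have e2 : simple i (rgt j) = rgt j :=
    simple_apply_of_ne (by simp only [rgt]; omega) (by simp only [rgt]; omega)
  have e3 : simple j (lft i) = lft i :=
    simple_apply_of_ne (by simp only [lft]; omega) (by simp only [lft]; omega)
  have e4 : simple j (rgt i) = rgt i :=
    simple_apply_of_ne (by simp only [rgt]; omega) (by simp only [rgt]; omega)
  have comm : simple i * simple j = simple j * simple i := by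
    conv_lhs => rw [simple.eq_1 j, Equiv.mul_swap_eq_swap_mul, e1, e2]
    rfl
  refine hecke_comm (permAct (simple i)) (permAct (simple j)) (fun f => ?_)
    (algebraMap k _ t)
    ((var (lft i) - algebraMap k _ t * var (rgt i)) / (var (lft i) - var (rgt i)))
    ((var (lft j) - algebraMap k _ t * var (rgt j)) / (var (lft j) - var (rgt j)))
    (permAct_const _ _) (permAct_const _ _) ?_ ?_ (heckeOp t i) (heckeOp t j)
    (fun f => by rw [heckeOp]) (fun f => by rw [heckeOp]) f
  · rw [← permAct_mul, ← permAct_mul, comm]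
  · rw [permAct_heckeFactor, e1, e2]
  · rw [permAct_heckeFactor, e3, e4]

end Braid

/-! ### The longest word -/

section Words

/-- The word `s + c - 1, …, s + 1, s`. -/
def descList (s : ℕ) : ℕ → List ℕ
  | 0 => []
  | c + 1 => (s + c) :: descList s c

/-- The word `(0)(1, 0) ⋯ (c - 1, …, 0)`. -/
def stairList : ℕ → List ℕ
  | 0 => []
  | c + 1 => stairList c ++ descList 0 (c + 1)

/-- The word `(s + c - 1, …, s)(s + c - 1, …, s + 1) ⋯ (s + c - 1)`. -/
def veeList : ℕ → ℕ → List ℕ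
  | _, 0 => []
  | s, c + 1 => descList s (c + 1) ++ veeList (s + 1) c

theorem descList_succ' (s c : ℕ) : descList s (c + 1) = descList (s + 1) c ++ [s] := by
  induction c with
  | zero => rfl
  | succ c ih =>
    rw [descList, ih, descList, List.cons_append]
    congr 1
    omega

theorem descList_map_succ (s c : ℕ) : (descList s c).map (· + 1) = descList (s + 1) c := by
  induction c with
  | zero => rfl
  | succ c ih =>
    rw [descList, List.map_cons, ih, descList]
    congr 1
    omega

theorem veeList_map_succ (s c : ℕ) : (veeList s c).map (· + 1) = veeList (s + 1) c := by
  induction c generalizing s with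
  | zero => rfl
  | succ c ih => rw [veeList, List.map_append, ih, descList_map_succ, veeList]

theorem mem_descList {s c i : ℕ} (h : i ∈ descList s c) : i < s + c := by
  induction c with
  | zero => simp [descList] at h
  | succ c ih =>
    rw [descList, List.mem_cons] at h
    rcases h with h | h
    · omega
    · have := ih h
      omega

theorem mem_veeList {s c i : ℕ} (h : i ∈ veeList s c) : i < s + c := by
  induction c generalizing s with
  | zero => simp [veeList] at h
  | succ c ih =>
    rw [veeList, List.mem_append] at h
    rcases h with h | h
    · exact mem_descList h
    · have := ih h
      omega

theorem descList_reverse (s c : ℕ) :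
    ((descList 0 c).map fun i => s + c - 1 - i).reverse = descList s c := by
  induction c generalizing s with
  | zero => rfl
  | succ c ih =>
    rw [descList, List.map_cons, List.reverse_cons, descList_succ', ← ih (s + 1), zero_add,
      show s + (c + 1) - 1 - c = s by omega,
      show (fun i => s + (c + 1) - 1 - i) = fun i => s + 1 + c - 1 - i from
        funext fun i => by omega]

theorem stairList_reverse (s c : ℕ) :
    ((stairList c).map fun i => s + c - 1 - i).reverse = veeList s c := by
  induction c generalizing s with
  | zero => rfl
  | succ c ih =>
    rw [stairList, List.map_append, List.reverse_append, descList_reverse, veeList, ← ih]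
    congr 3
    ext i
    omega

variable {M : Type*} [Monoid M]

/-- Write `D_c = T_c ⋯ T_0`. The relations give `T_i D_c = D_c T_{i+1}` for `i < c`, so `D_c` passes
to the front of a word in letters below `c` and raises each by one. Induction on the number of
blocks then rebuilds the word. -/
theorem prod_stairList_eq (T : ℕ → M) (m : ℕ)
    (hcomm : ∀ i j, i + 2 ≤ j → j < m → T i * T j = T j * T i)
    (hbraid : ∀ i, i + 1 < m → T i * T (i + 1) * T i = T (i + 1) * T i * T (i + 1)) :
    ((stairList m).map T).prod = ((veeList 0 m).map T).prod := by
  have comm : ∀ c j, c + 1 ≤ j → j < m →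
      ((descList 0 c).map T).prod * T j = T j * ((descList 0 c).map T).prod := by
    intro c
    induction c with
    | zero => intro j _ _; simp [descList]
    | succ c ih =>
      intro j hj hjm
      rw [descList, List.map_cons, List.prod_cons, zero_add, mul_assoc, ih j (by omega) hjm,
        ← mul_assoc, hcomm c j (by omega) hjm, mul_assoc]
  have shift1 : ∀ c i, i < c → c < m → T i * ((descList 0 (c + 1)).map T).prod =
      ((descList 0 (c + 1)).map T).prod * T (i + 1) := by
    intro c
    induction c with
    | zero => intro i hi; omega
    | succ c ih =>
      intro i hi hc
      rw [descList, List.map_cons, List.prod_cons, zero_add]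
      rcases Nat.lt_succ_iff_lt_or_eq.1 hi with h | rfl
      · rw [← mul_assoc, hcomm i (c + 1) (by omega) hc, mul_assoc, ih i h (by omega), mul_assoc]
      · rw [descList, List.map_cons, List.prod_cons, zero_add, ← mul_assoc, ← mul_assoc,
          hbraid i hc, mul_assoc, mul_assoc, mul_assoc, mul_assoc, comm i (i + 1) le_rfl hc]
  have shiftL : ∀ c, c < m → ∀ L : List ℕ, (∀ i ∈ L, i < c) →
      (L.map T).prod * ((descList 0 (c + 1)).map T).prod =
        ((descList 0 (c + 1)).map T).prod * ((L.map (· + 1)).map T).prod := by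
    intro c hc L
    induction L with
    | nil => intro _; simp
    | cons i L ih =>
      intro hL
      rw [List.map_cons, List.prod_cons, mul_assoc, ih fun j hj => hL j (List.mem_cons_of_mem _ hj),
        ← mul_assoc, shift1 c i (hL i List.mem_cons_self) hc, mul_assoc]
      simp
  have main : ∀ c, c ≤ m → ((stairList c).map T).prod = ((veeList 0 c).map T).prod := by
    intro c
    induction c with
    | zero => intro _; rfl
    | succ c ih =>
      intro hc
      rw [stairList, List.map_append, List.prod_append, ih (by omega), shiftL c (by omega) _
        fun i hi => by simpa using mem_veeList hi, veeList_map_succ, veeList, List.map_append,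
        List.prod_append]
  exact main m le_rfl

theorem longWord_map_val (n : ℕ) : (longWord n).map Fin.val = stairList (n - 1) := by
  have h1 : ∀ m h, (descWord n m h).map Fin.val = descList 0 m := by
    intro m
    induction m with
    | zero => intro h; rfl
    | succ m ih => intro h; rw [descWord, List.map_cons, ih, descList, zero_add]
  have h2 : ∀ m h, (stairWord n m h).map Fin.val = stairList m := by
    intro m
    induction m with
    | zero => intro h; rfl
    | succ m ih => intro h; rw [stairWord, List.map_append, ih, h1, stairList]
  exact h2 _ _

/-- Inversion and conjugation by `w₀` both fix `w₀`, so the reversed, mirrored word is again a word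
for it. Only this one change of reduced word is needed. -/
theorem heckeWord_longWord {k : Type*} [Field k] {n : ℕ} (t : k) (f : RatField k n) :
    heckeWord t (longWord n) f = heckeWord t ((longWord n).map Fin.rev).reverse f := by
  obtain ⟨T, hTi⟩ : ∃ T : ℕ → Function.End (RatField k n),
      ∀ i (h : i < n - 1), T i = heckeOp t ⟨i, h⟩ :=
    ⟨fun i => if h : i < n - 1 then heckeOp t ⟨i, h⟩ else id, fun i h => dif_pos h⟩
  have hT : ∀ L : List (Fin (n - 1)), heckeWord t L f = ((L.map Fin.val).map T).prod f := by
    intro L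
    induction L with
    | nil => rfl
    | cons i L ih =>
      rw [List.map_cons, List.map_cons, List.prod_cons]
      change heckeOp t i (heckeWord t L f) = T i (((L.map Fin.val).map T).prod f)
      rw [ih, hTi i i.isLt]
  have hrev : (((longWord n).map Fin.rev).reverse).map Fin.val = veeList 0 (n - 1) := by
    rw [← stairList_reverse, ← longWord_map_val, List.map_reverse, List.map_map, List.map_map]
    congr 2
    ext i
    simp only [Function.comp_apply, Fin.val_rev]
    omega
  rw [hT, hT, hrev, longWord_map_val, prod_stairList_eq]
  · intro i j hij hj
    funext f
    have hi : i < n - 1 := by omega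
    change T i (T j f) = T j (T i f)
    rw [hTi i hi, hTi j hj]
    exact heckeOp_comm t hij f
  · intro i hi
    funext f
    have hi' : i < n - 1 := by omega
    change T i (T (i + 1) (T i f)) = T (i + 1) (T i (T (i + 1) f))
    rw [hTi i hi', hTi (i + 1) hi]
    exact heckeOp_braid t rfl f

end Words

/-! ### Hecke operators on functions of integer vectors -/

section Discrete

variable {k : Type*} [Field k] {q t : k} {n : ℕ}

/-- The action of the `i`-th Demazure–Lusztig operator on functions of integer vectors. -/
def latticeOp (q t : k) (i : Fin (n - 1)) (φ : (Fin n → ℤ) → k) (u : Fin n → ℤ) : k :=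
  t⁻¹ * φ u + heckeCoeff t⁻¹ (rgt i) (lft i) (bar q t u) * (φ (fun l => u (simple i l)) - φ u)

/-- `latticeOp` acting on the first of two variables. -/
def opLeft (q t : k) (i : Fin (n - 1)) (S : (Fin n → ℤ) → (Fin n → ℤ) → k)
    (u v : Fin n → ℤ) : k := latticeOp q t i (fun u => S u v) u

/-- `latticeOp` acting on the second of two variables. -/
def opRight (q t : k) (i : Fin (n - 1)) (S : (Fin n → ℤ) → (Fin n → ℤ) → k)
    (u v : Fin n → ℤ) : k := latticeOp q t i (S u) v

theorem opLeft_opRight (i j : Fin (n - 1)) (S : (Fin n → ℤ) → (Fin n → ℤ) → k) :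
    opRight q t j (opLeft q t i S) = opLeft q t i (opRight q t j S) := by
  ext u v
  simp only [opLeft, opRight, latticeOp]
  ring

theorem opRight_foldr_opLeft (j : Fin (n - 1)) (L : List (Fin (n - 1)))
    (S : (Fin n → ℤ) → (Fin n → ℤ) → k) :
    opRight q t j (L.foldr (opLeft q t) S) = L.foldr (opLeft q t) (opRight q t j S) := by
  induction L with
  | nil => rfl
  | cons i L ih => rw [List.foldr_cons, opLeft_opRight, ih, List.foldr_cons]

/-- Each right operator commutes past the left operators already produced, reaches `S` and becomes a
left operator there; the word comes out reversed. -/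
theorem foldr_opRight_rev {S : (Fin n → ℤ) → (Fin n → ℤ) → k}
    (hS : ∀ i : Fin (n - 1), opRight q t i.rev S = opLeft q t i S) (L : List (Fin (n - 1))) :
    L.foldr (fun i => opRight q t i.rev) S = L.reverse.foldr (opLeft q t) S := by
  induction L with
  | nil => rfl
  | cons i L ih =>
    rw [List.foldr_cons, ih, opRight_foldr_opLeft, hS, List.reverse_cons, List.foldr_append]
    rfl

theorem foldr_opLeft_flip {S : (Fin n → ℤ) → (Fin n → ℤ) → k} (hS : ∀ u v, S u v = S v u)
    (L : List (Fin (n - 1))) (u v : Fin n → ℤ) :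
    L.foldr (opLeft q t) S u v = L.foldr (opRight q t) S v u := by
  induction L generalizing u v with
  | nil => exact hS u v
  | cons i L ih => simp only [List.foldr_cons, opLeft, opRight, latticeOp, ih]

/-- For a symmetric function of two vectors on which the operators in the two variables agree,
applying a word in the second variable is the same, up to exchanging the variables, as applying
the reverse of the mirrored word. -/
theorem foldr_opRight_symm {S : (Fin n → ℤ) → (Fin n → ℤ) → k} (hS : ∀ u v, S u v = S v u)
    (hS' : ∀ i : Fin (n - 1), opRight q t i.rev S = opLeft q t i S) (L : List (Fin (n - 1)))
    (u v : Fin n → ℤ) :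
    L.foldr (fun i => opRight q t i.rev) S v u =
      (L.map Fin.rev).reverse.foldr (fun i => opRight q t i.rev) S u v := by
  rw [foldr_opRight_rev hS', foldr_opLeft_flip hS, ← List.map_reverse, List.foldr_map]
  simp only [Fin.rev_rev]

theorem foldr_opRight_apply (S : (Fin n → ℤ) → (Fin n → ℤ) → k) (L : List (Fin (n - 1)))
    (v : Fin n → ℤ) :
    L.foldr (fun i => opRight q t i.rev) S v =
      L.foldr (fun i => latticeOp q t i.rev) (S v) := by
  induction L with
  | nil => rfl
  | cons i L ih =>
    rw [List.foldr_cons, List.foldr_cons, ← ih]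
    rfl

/-! ### Rational functions on orbits of spectral points -/

/-- `f` is regular at all permutations of the points `b ū`, and its value at `b w₀ ū` is
`φ u`. -/
structure HasLatticeVal (q t b : k) (f : RatField k n) (φ : (Fin n → ℤ) → k) : Prop where
  regular : ∀ (u : Fin n → ℤ) (w : Equiv.Perm (Fin n)),
    IsRegularAt f fun i => b * bar q t u (w i)
  hasVal : ∀ u : Fin n → ℤ, HasVal f (fun i => b * bar q t u i.rev) (φ u)

theorem HasVal.heckeOp {f : RatField k n} {y : Fin n → k} {c c' : k} (s : k) (i : Fin (n - 1))
    (h : HasVal f y c) (h' : HasVal f (fun l => y (simple i l)) c')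
    (hy : y (lft i) ≠ y (rgt i)) :
    HasVal (heckeOp s i f) y (s * c + heckeCoeff s (lft i) (rgt i) y * (c' - c)) :=
  ((hasVal_const s y).mul h).add
    ((((hasVal_var _ y).sub ((hasVal_const s y).mul (hasVal_var _ y))).div
      ((hasVal_var _ y).sub (hasVal_var _ y)) (sub_ne_zero.2 hy)).mul ((h'.permAct _).sub h))

theorem lft_ne_rgt (i : Fin (n - 1)) : lft i ≠ rgt i := by simp [lft, rgt]

theorem lft_rev (i : Fin (n - 1)) : lft i.rev = (rgt i).rev := by
  ext
  simp only [lft, rgt, Fin.val_rev]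
  omega

theorem rgt_rev (i : Fin (n - 1)) : rgt i.rev = (lft i).rev := by
  ext
  simp only [lft, rgt, Fin.val_rev]
  omega

theorem rev_simple (i : Fin (n - 1)) (l : Fin n) :
    (simple i l).rev = simple i.rev l.rev := by
  rw [simple, rev_swap, simple, lft_rev, rgt_rev]

theorem heckeCoeff_inv_of_eq (ht : t ≠ 0) {u : Fin n → ℤ} {i j : Fin n}
    (hij : (j : ℕ) = i + 1) (hu : u i = u j) : heckeCoeff t⁻¹ j i (bar q t u) = 0 := by
  rw [heckeCoeff, bar_of_eq ht u hij hu, inv_mul_cancel_left₀ ht, sub_self, zero_div]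

/-- The index is mirrored because the points are reversed. Regularity at all permutations is carried
along because, at equal entries, the swapped point is not of the form `b w₀ū`: the function must be
regular there, although its value is multiplied by zero. -/
theorem HasLatticeVal.heckeOp (hg : Generic q t) {b : k} (hb : b ≠ 0) {f : RatField k n}
    {φ : (Fin n → ℤ) → k} (h : HasLatticeVal q t b f φ) (i : Fin (n - 1)) :
    HasLatticeVal q t b (heckeOp t⁻¹ i f) (latticeOp q t i.rev φ) := by
  have hne : ∀ (u : Fin n → ℤ) (w : Equiv.Perm (Fin n)),
      b * bar q t u (w (lft i)) ≠ b * bar q t u (w (rgt i)) := fun u w e =>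
    lft_ne_rgt i (w.injective (hg.bar_injective u (mul_left_cancel₀ hb e)))
  refine ⟨fun u w => ?_, fun u => ?_⟩
  · obtain ⟨c, hc⟩ := (h.regular u w).hasVal
    obtain ⟨c', hc'⟩ := (h.regular u (w * simple i)).hasVal
    exact (HasVal.heckeOp t⁻¹ i hc hc' (hne u w)).isRegularAt
  · have h1 := h.hasVal u
    obtain ⟨c', hc'⟩ := (h.regular u (Fin.revPerm * simple i)).hasVal
    have h2 := HasVal.heckeOp t⁻¹ i h1 hc' (hne u Fin.revPerm)
    have e1 : heckeCoeff t⁻¹ (lft i) (rgt i) (fun l => b * bar q t u l.rev) =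
        heckeCoeff t⁻¹ (rgt i.rev) (lft i.rev) (bar q t u) := by
      rw [heckeCoeff_smul _ _ hb, heckeCoeff, heckeCoeff, lft_rev, rgt_rev]
    have hadj : (rgt i.rev : ℕ) = lft i.rev + 1 := rfl
    convert h2 using 1
    rw [latticeOp, e1]
    by_cases hu : u (lft i.rev) = u (rgt i.rev)
    · rw [heckeCoeff_inv_of_eq hg.t_ne hadj hu, zero_mul, zero_mul]
    · congr 2
      have e2 : (fun l => b * bar q t u ((Fin.revPerm * simple i : Equiv.Perm (Fin n)) l)) =
          fun l : Fin n => b * bar q t (fun l => u (simple i.rev l)) l.rev := by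
        ext l
        rw [Equiv.Perm.mul_apply, Fin.revPerm_apply, rev_simple]
        exact congrArg (b * ·) (bar_comp_swap u hadj hu l.rev).symm
      rw [e2] at hc'
      rw [← (h.hasVal fun l => u (simple i.rev l)).value_eq, ← hc'.value_eq]

theorem HasLatticeVal.heckeWord (hg : Generic q t) {b : k} (hb : b ≠ 0) {f : RatField k n}
    {φ : (Fin n → ℤ) → k} (h : HasLatticeVal q t b f φ) (L : List (Fin (n - 1))) :
    HasLatticeVal q t b (heckeWord t⁻¹ L f) (L.foldr (fun i => latticeOp q t i.rev) φ) := by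
  induction L with
  | nil => exact h
  | cons i L ih => exact ih.heckeOp hg hb i

theorem HasLatticeVal.permAct_rev {b : k} {f : RatField k n} {φ : (Fin n → ℤ) → k}
    (h : HasLatticeVal q t b f φ) (c : k) (u : Fin n → ℤ) :
    HasVal (algebraMap k (RatField k n) c * permAct (w0 n) f) (fun i => b * bar q t u i)
      (c * φ u) :=
  (hasVal_const c _).mul (HasVal.permAct (w0 n) (h.hasVal u))

theorem map_bar {σ : k →+* k} (hσq : σ q = q⁻¹) (hσt : σ t = t⁻¹) (u : Fin n → ℤ) (i : Fin n) :
    σ (bar q t u i) = (bar q t u i)⁻¹ := by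
  rw [bar, map_mul, map_zpow₀, map_zpow₀, hσq, hσt, inv_zpow, inv_zpow, mul_inv]

theorem map_heckeCoeff_bar (hg : Generic q t) {σ : k →+* k} (hσq : σ q = q⁻¹) (hσt : σ t = t⁻¹)
    (u : Fin n → ℤ) (i j : Fin n) :
    σ (heckeCoeff t i j (bar q t u)) = heckeCoeff t⁻¹ j i (bar q t u) := by
  have h1 := bar_ne_zero hg.q_ne hg.t_ne u i
  have h2 := bar_ne_zero hg.q_ne hg.t_ne u j
  rw [heckeCoeff, heckeCoeff, map_div₀, map_sub, map_sub, map_mul, map_bar hσq hσt,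
    map_bar hσq hσt, hσt]
  rw [show (bar q t u i)⁻¹ - t⁻¹ * (bar q t u j)⁻¹ =
      (bar q t u j - t⁻¹ * bar q t u i) / (bar q t u i * bar q t u j) by field_simp,
    show (bar q t u i)⁻¹ - (bar q t u j)⁻¹ =
      (bar q t u j - bar q t u i) / (bar q t u i * bar q t u j) by field_simp]
  exact div_div_div_cancel_right₀ (mul_ne_zero h1 h2) _ _

end Discrete

/-! ### Symmetry of the primed functions for an abstract family -/

section Assembly

variable {k : Type*} [Field k] {N : ℕ} {g : (Fin (N + 1) → ℕ) → MvPolynomial (Fin (N + 1)) k}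

theorem Family.hasVal_Kval {q t a : kˣ} (h : Family (q : k) t a g) (v : Fin (N + 1) → ℤ)
    {y : Fin (N + 1) → k} (hy : GenericPoint (q : k) t y) :
    HasVal ((∏ i, algebraMap k (RatField k (N + 1))
      (qPoch (q : k) ((q : k) ^ (1 - (shift v : ℤ)) * a * (bar (q : k) t v i)⁻¹) (shift v)) /
        qPoch (algebraMap k (RatField k (N + 1)) q) (algebraMap k (RatField k (N + 1))
          ((q : k) * (t : k) ^ (((N + 1 : ℕ) : ℤ) - 1)) * var i) (shift v)) *
      scale (q ^ shift v) (algebraMap _ (RatField k (N + 1))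
        (MvPolynomial.C (MvPolynomial.eval (fun i : Fin (N + 1) => (a : k) * (t : k) ^ (-((i : ℕ) : ℤ)))
          (g fun i => (v i + shift v).toNat))⁻¹ * g fun i => (v i + shift v).toNat))) y
      (Kval (q : k) t a g v y) := by
  have hq := h.generic.q_ne
  have h1 := (HasVal.prod Finset.univ fun i _ => (hasVal_const
    (qPoch (q : k) ((q : k) ^ (1 - (shift v : ℤ)) * a * (bar (q : k) t v i)⁻¹) (shift v)) y).div
      (hasVal_qPoch (q : k) ((q : k) * (t : k) ^ (((N + 1 : ℕ) : ℤ) - 1)) i (shift v) y)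
        (qPoch_ne_zero hy i (shift v))).mul ((hasVal_algebraMap
        (MvPolynomial.C (MvPolynomial.eval (fun i : Fin (N + 1) => (a : k) * (t : k) ^ (-((i : ℕ) : ℤ)))
          (g fun i => (v i + shift v).toNat))⁻¹ * g fun i => (v i + shift v).toNat)
          _).scale (q ^ shift v))
  convert h1 using 1
  rw [Kval, KM, Keval, Finset.prod_div_distrib, map_mul, MvPolynomial.eval_C, denom, numer,
    bar_toNat hq (shift_nonneg v)]
  congr 2
  · refine Finset.prod_congr rfl fun i _ => ?_
    congr 1
    rw [mul_inv, zpow_sub₀ hq, zpow_one, zpow_natCast, div_eq_mul_inv]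
    ring

theorem GenericPoint.comp_perm {q t : k} {n : ℕ} {y : Fin n → k} (h : GenericPoint q t y)
    (w : Equiv.Perm (Fin n)) : GenericPoint q t fun i => y (w i) := fun i => h (w i)

/-- The values of `K_v°(t^{n-1} x)` at the points `a⁻¹ w₀ ū`. -/
theorem Family.hasLatticeVal {q t a : kˣ} (h : Family (q : k) t a g) {σ : k →+* k}
    (hσq : σ q = (q : k)⁻¹) (hσt : σ t = (t : k)⁻¹) (hσa : σ a = (a : k)⁻¹)
    {f : RatField k (N + 1)} {v : Fin (N + 1) → ℤ}
    (hf : ∀ y, GenericPoint (q : k) t y → HasVal f y (Kval (q : k) t a g v y)) :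
    HasLatticeVal (q : k) t (a : k)⁻¹ (scale (t ^ (((N + 1 : ℕ) : ℤ) - 1)) (coeffAct σ f))
      fun u => σ (Kval (q : k) t a g v (dualPoint (q : k) t a u)) := by
  -- The scaling by `t^{n-1}` carries the points `a⁻¹ w₀ū` to the images under `σ` of the dual
  -- points `aũ`; the permutation `w` is there for the regularity claim.
  have key : ∀ (u : Fin (N + 1) → ℤ) (w : Equiv.Perm (Fin (N + 1))),
      (fun i => ((t ^ (((N + 1 : ℕ) : ℤ) - 1) : kˣ) : k) *
        ((a : k)⁻¹ * bar (q : k) t u (w i).rev)) =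
      fun i => σ (dualPoint (q : k) t a u (w i)) := by
    intro u w
    ext i
    rw [dualPoint, bar_neg_rev h.generic.t_ne, map_mul, map_mul, map_zpow₀, map_inv₀,
      map_bar hσq hσt, hσa, hσt, inv_inv, inv_zpow, ← zpow_neg, neg_sub,
      Units.val_zpow_eq_zpow_val]
    ring
  refine ⟨fun u w => ?_, fun u => ?_⟩
  · have h1 := ((hf _ ((h.genericPoint_dualPoint u).comp_perm (Fin.revPerm * w))).coeffAct σ)
    rw [← key u (Fin.revPerm * w)] at h1
    have h2 := (h1.scale (t ^ (((N + 1 : ℕ) : ℤ) - 1))).isRegularAt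
    simpa using h2
  · have h1 := ((hf _ (h.genericPoint_dualPoint u)).coeffAct σ)
    have h2 := key u 1
    simp only [Equiv.Perm.coe_one, id] at h2
    rw [← h2] at h1
    exact h1.scale (t ^ (((N + 1 : ℕ) : ℤ) - 1))

/-- Under `σ`, duality makes `S` symmetric, and the Hecke relation makes the operators in its two
variables agree up to mirroring. Exchanging the variables then reverses and mirrors the word, which
leaves `H°_{w₀}` unchanged. -/
theorem Family.primed_duality {q t a : kˣ} (h : Family (q : k) t a g) {σ : k →+* k}
    (hσq : σ q = (q : k)⁻¹) (hσt : σ t = (t : k)⁻¹) (hσa : σ a = (a : k)⁻¹)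
    (f : (Fin (N + 1) → ℤ) → RatField k (N + 1))
    (hf : ∀ v y, GenericPoint (q : k) t y → HasVal (f v) y (Kval (q : k) t a g v y)) (c : k) :
    ∃ V : (Fin (N + 1) → ℤ) → (Fin (N + 1) → ℤ) → k, (∀ u v, V u v = V v u) ∧
      ∀ u v, HasVal (algebraMap k (RatField k (N + 1)) c * permAct (w0 (N + 1))
        (heckeLong (t : k)⁻¹ (scale (t ^ (((N + 1 : ℕ) : ℤ) - 1)) (coeffAct σ (f v)))))
        (fun i => (a : k)⁻¹ * bar (q : k) t u i) (V v u) := by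
  have hg := h.generic
  have ha := inv_ne_zero h.a_ne
  set S : (Fin (N + 1) → ℤ) → (Fin (N + 1) → ℤ) → k :=
    fun v u => σ (Kval (q : k) t a g v (dualPoint (q : k) t a u)) with hS
  have hsymm : ∀ u v, S u v = S v u := fun u v => congrArg σ (h.duality u v)
  have hop : ∀ i : Fin (N + 1 - 1), opRight (q : k) t i.rev S = opLeft (q : k) t i S := by
    intro i
    ext u v
    have h1 := congrArg σ (h.Kval_dualPoint_hecke u v (i := lft i) (j := rgt i) rfl)
    rw [map_mul, map_mul, map_sub, map_sub, map_heckeCoeff_bar hg hσq hσt,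
      map_heckeCoeff_bar hg hσq hσt, ← lft_rev, ← rgt_rev] at h1
    rw [opRight, opLeft, latticeOp, latticeOp]
    exact congrArg (fun x => (t : k)⁻¹ * S u v + x) h1
  have hL := fun (v : Fin (N + 1) → ℤ) (L : List (Fin (N + 1 - 1))) =>
    (h.hasLatticeVal hσq hσt hσa (hf v)).heckeWord hg ha L
  refine ⟨fun v u => c * (longWord (N + 1)).foldr (fun i => opRight (q : k) t i.rev) S v u,
    fun u v => ?_, fun u v => ?_⟩
  -- The two words are known to agree as operators on rational functions; uniqueness of values
  -- transfers this to the operators on integer vectors.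
  · have h1 := ((hL u (longWord (N + 1))).permAct_rev 1 v).value_eq
    rw [heckeWord_longWord] at h1
    have h2 := ((hL u ((longWord (N + 1)).map Fin.rev).reverse).permAct_rev 1 v).value_eq
    have h3 := h1.symm.trans h2
    rw [one_mul, one_mul, ← foldr_opRight_apply S, ← foldr_opRight_apply S] at h3
    beta_reduce
    rw [h3, ← foldr_opRight_symm hsymm hop]
  · have h1 := (hL v (longWord (N + 1))).permAct_rev c u
    rw [← foldr_opRight_apply S] at h1
    exact h1

end Assembly

/-! ### Specialisation to `𝕂 = ℚ(q,t,a)` -/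

theorem a_mul_ne_one (i j : ℤ) : (a : KK) * ((q : KK) ^ i * (t : KK) ^ j) ≠ 1 := by
  intro h
  have h1 : (q : KK) ^ i * (t : KK) ^ j = algebraMap FF KK (qF ^ i * tF ^ j) := by
    rw [map_mul, map_zpow₀, map_zpow₀]
    rfl
  have h2 : (RatFunc.X : KK) = algebraMap FF KK (qF ^ i * tF ^ j)⁻¹ := by
    rw [map_inv₀, ← h1]
    exact eq_inv_of_mul_eq_one_left h
  exact RatFunc.transcendental_X (K := FF) (h2 ▸ isAlgebraic_algebraMap _)

theorem family_GK (N : ℕ) :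
    Family (q : KK) (t : KK) (a : KK) (fun α : Fin (N + 1) → ℕ => GK α) :=
  ⟨generic_KK, a.ne_zero, a_mul_ne_one, isInterpolation_GK⟩

theorem hasVal_K {N : ℕ} (v : Fin (N + 1) → ℤ) (y : Fin (N + 1) → KK)
    (hy : GenericPoint (q : KK) (t : KK) y) :
    HasVal (K v) y (Kval (q : KK) (t : KK) (a : KK) (fun α => GK α) v y) :=
  (family_GK N).hasVal_Kval v hy

theorem exists_hasVal_Kprime (N : ℕ) :
    ∃ V : (Fin (N + 1) → ℤ) → (Fin (N + 1) → ℤ) → KK, (∀ u v, V u v = V v u) ∧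
      ∀ u v, HasVal (Kprime v) (ainvBar u) (V v u) :=
  (family_GK N).primed_duality iota_q iota_t iota_a K hasVal_K
    ((t : KK) ^ len (w0 (N + 1)))

/-- Covers `n = 0`, where polynomials are constants and a nonzero denominator has a nonzero value.
-/
theorem isRegularAt_zero_vars {k : Type*} [Field k] (f : RatField k 0) (y : Fin 0 → k) :
    IsRegularAt f y := by
  obtain ⟨p, d, hd, rfl⟩ := IsFractionRing.div_surjective (A := MvPolynomial (Fin 0) k) f
  refine ⟨p, d, fun h => nonZeroDivisors.ne_zero hd ?_, rfl⟩
  rw [MvPolynomial.eq_C_of_isEmpty d] at h ⊢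
  rw [MvPolynomial.eval_C] at h
  rw [h, MvPolynomial.C_0]

end InterpMacdonald

end

theorem mainTheorem6 {n : ℕ} (u v : Fin n → ℤ) :
    InterpMacdonald.IsRegularAt (InterpMacdonald.Kprime v) (InterpMacdonald.ainvBar u) ∧
    InterpMacdonald.IsRegularAt (InterpMacdonald.Kprime u) (InterpMacdonald.ainvBar v) ∧
    InterpMacdonald.value (InterpMacdonald.Kprime v) (InterpMacdonald.ainvBar u) =
      InterpMacdonald.value (InterpMacdonald.Kprime u) (InterpMacdonald.ainvBar v) := by
  rcases n with _ | N
  · exact ⟨InterpMacdonald.isRegularAt_zero_vars _ _, InterpMacdonald.isRegularAt_zero_vars _ _,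
      by rw [Subsingleton.elim u v]⟩
  · obtain ⟨V, hV, h⟩ := InterpMacdonald.exists_hasVal_Kprime N
    exact ⟨(h u v).isRegularAt, (h v u).isRegularAt, by
      rw [(h u v).value_eq, (h v u).value_eq, hV]⟩
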